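/- Let $(M^n,g)$ be a smooth semi-Riemannian manifold with Levi-Civita connection $\overline\nabla$, let $(\Sigma^m,\langle\cdot,\cdot\rangle)$ be a closed oriented semi-Riemannian manifold, $m\ge 1$, and let $\phi:\Sigma\to M$ be an isometric immersion. Write $u\cdot v=g(u,v)$, and let $X^T$, $X^\perp$ be the tangential and normal components of $X$. Let $A(u,v)=-(\overline\nabla_u v)^\perp$ be the (normal-valued) second fundamental form, and let $A_i^{\,j}=\sum_l\langle\cdot,\cdot\rangle^{jl}A(e_i,e_l)$ be its mixed components in a local frame $(e_i)$ of $\Sigma$. Let $\epsilon^{i_1\cdots i_k}_{j_1\cdots j_k}$ be the generalized Kronecker symbol. For even $k$ put $$H_k=\frac1{k!}\sum\epsilon^{i_1\cdots i_k}_{j_1\cdots j_k}(A_{i_1}^{\,j_1}\cdot A_{i_2}^{\,j_2})\cdots(A_{i_{k-1}}^{\,j_{k-1}}\cdot A_{i_k}^{\,j_k}),\qquad (T_k)_j^{\,i}=\frac1{k!}\sum\epsilon^{i\,i_1\cdots i_k}_{j\,j_1\cdots j_k}(A_{i_1}^{\,j_1}\cdot A_{i_2}^{\,j_2})\cdots(A_{i_{k-1}}^{\,j_{k-1}}\cdot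 A_{i_k}^{\,j_k}),$$ and for odd $k$ let $H_k$ be the normal vector field $$H_k=\frac1{k!}\sum\epsilon^{i_1\cdots i_k}_{j_1\cdots j_k}(A_{i_1}^{\,j_1}\cdot A_{i_2}^{\,j_2})\cdots(A_{i_{k-2}}^{\,j_{k-2}}\cdot A_{i_{k-1}}^{\,j_{k-1}})A_{i_k}^{\,j_k};$$ thus $H_0=1$ and $T_0=I$. Put $\sigma_k=H_k/\binom mk$. Let $X$ be a smooth section of $\phi^*(TM)$ that is conformal along $\Sigma$ with factor $\alpha:\Sigma\to\mathbb R$, that is, $\overline\nabla_YX\cdot Z+\overline\nabla_ZX\cdot Y=2\alpha\langle Y,Z\rangle$ for all $Y,Z$ tangent to $\Sigma$ (which holds if $X$ is the restriction of a vector field with $\mathcal L_Xg=2\alpha g$), and let $f$ be a smooth function on $\Sigma$. Integrals are taken with respect to the volume element of $\Sigma$; all integrands below are integrable. 1. If $M$ has constant sectional curvature and $0\le k\le m-1$ is even, then $$\int_\Sigma\alpha f\sigma_k=\int_\Sigma f\,\sigma_{k+1}\cdot X-\frac1{(m-k)\binom mk}\int_\Sigma\langle T_k(\nabla f),X^T\rangle.$$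 For $k=0$ no assumption on the curvature of $M$ is needed. 2. Let $m=n-1$, and let $\nu$ be a smooth unit normal vector field, $\nu\cdot\nu=\pm1$. Let $B$ be the shape operator given by $A(u,v)=\langle Bu,v\rangle\,\nu$, and let now $H_k$ be the scalar $k$-th elementary symmetric function of the principal curvatures (the eigenvalues of $B$), $H_k=\frac1{k!}\sum\epsilon^{i_1\cdots i_k}_{j_1\cdots j_k}B_{i_1}^{\,j_1}\cdots B_{i_k}^{\,j_k}$, let $\sigma_k=H_k/\binom mk$, and $(T_k)_j^{\,i}=\frac1{k!}\sum\epsilon^{i\,i_1\cdots i_k}_{j\,j_1\cdots j_k}B_{i_1}^{\,j_1}\cdots B_{i_k}^{\,j_k}$. If $M$ has constant sectional curvature and $0\le k\le m-1$, then $$\int_\Sigma\alpha f\sigma_k=\int_\Sigma f\,\sigma_{k+1}\,\nu\cdot X-\frac1{(m-k)\binom mk}\int_\Sigma\langle T_k(\nabla f),X^T\rangle.$$ For $k=1$ (and $m\ge2$) it suffices that $M$ is Einstein, $\mathrm{Ric}=c\,g$ with a constant $c$; for $k=0$ no assumption on the curvature of $M$ is needed. -/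

import Mathlib

open scoped Manifold ContDiff Bundle
open MeasureTheory Bundle

noncomputable section

namespace HsiungMinkowski

/-- Coordinate space of dimension `d`. -/
abbrev Coord (d : ℕ) : Type := EuclideanSpace ℝ (Fin d)

/-! ### Semi-Riemannian metrics and their coordinate expressions -/

section Metric

variable {d : ℕ} {N : Type*} [TopologicalSpace N] [ChartedSpace (Coord d) N]
  [IsManifold (𝓡 d) ∞ N]

/-- A smooth semi-Riemannian metric: a smooth field of symmetric nondegenerate bilinear forms, of
arbitrary signature, on the tangent spaces. -/
structure SemiRiemannianMetric (d : ℕ) (N : Type*) [TopologicalSpace N] [ChartedSpace (Coord d) N]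
    [IsManifold (𝓡 d) ∞ N] where
  inner (x : N) : TangentSpace (𝓡 d) x →L[ℝ] TangentSpace (𝓡 d) x →L[ℝ] ℝ
  symm (x : N) (u v : TangentSpace (𝓡 d) x) : inner x u v = inner x v u
  nondegenerate (x : N) (u : TangentSpace (𝓡 d) x) (hu : ∀ v, inner x u v = 0) : u = 0
  contMDiff : ContMDiff (𝓡 d) ((𝓡 d).prod 𝓘(ℝ, Coord d →L[ℝ] Coord d →L[ℝ] ℝ)) ∞
    (fun x ↦ TotalSpace.mk' (Coord d →L[ℝ] Coord d →L[ℝ] ℝ) x (inner x))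

/-- The coordinates, in the preferred chart at `p`, of a tangent vector `w` at the point `q`. -/
def coords (p q : N) (w : TangentSpace (𝓡 d) q) : Coord d :=
  (trivializationAt (Coord d) (TangentSpace (𝓡 d) : N → Type _) p).continuousLinearMapAt ℝ q w

/-- The tangent vector at `q` with given coordinates in the preferred chart at `p`. -/
def ofCoords (p q : N) (a : Coord d) : TangentSpace (𝓡 d) q :=
  (trivializationAt (Coord d) (TangentSpace (𝓡 d) : N → Type _) p).symmL ℝ q a

/-- The coordinate frame `∂₁, …, ∂_d` at `q` of the preferred chart at `p`. -/
def coordFrame (p q : N) (i : Fin d) : TangentSpace (𝓡 d) q :=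
  ofCoords p q (EuclideanSpace.single i 1)

/-- The coordinate frame at `x` of the preferred chart at `x` itself; a basis of the tangent
space at `x`. -/
def frame (x : N) (i : Fin d) : TangentSpace (𝓡 d) x := coordFrame x x i

/-- Partial derivative of a function of `d` real variables. -/
def partialDeriv (i : Fin d) (F : Coord d → ℝ) (y : Coord d) : ℝ :=
  fderiv ℝ F y (EuclideanSpace.single i 1)

/-- The matrix `g_{ij}` of the metric in the preferred chart at `p`, as a function of the chart
variable `y`. -/
def gramMatrix (g : SemiRiemannianMetric d N) (p : N) (y : Coord d) : Matrix (Fin d) (Fin d) ℝ :=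
  Matrix.of fun i j ↦ g.inner ((extChartAt (𝓡 d) p).symm y)
    (coordFrame p ((extChartAt (𝓡 d) p).symm y) i) (coordFrame p ((extChartAt (𝓡 d) p).symm y) j)

/-- The inverse `g^{ij}` of the matrix of the metric at `x` with respect to `frame x`. -/
def inverseMetric (g : SemiRiemannianMetric d N) (x : N) : Matrix (Fin d) (Fin d) ℝ :=
  (Matrix.of fun i j ↦ g.inner x (frame x i) (frame x j))⁻¹

/-- The vector `ℓ^♯` with `⟨ℓ^♯, v⟩ = ℓ v` for all `v`, that is `∑ g^{ij} ℓ(e_j) e_i`. -/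
def sharp (g : SemiRiemannianMetric d N) (x : N) (l : TangentSpace (𝓡 d) x → ℝ) :
    TangentSpace (𝓡 d) x :=
  ∑ i, ∑ j, (inverseMetric g x i j * l (frame x j)) • frame x i

/-- The gradient of a function. -/
def gradient (g : SemiRiemannianMetric d N) (f : N → ℝ) (x : N) : TangentSpace (𝓡 d) x :=
  sharp g x (fun v ↦ mvfderiv (𝓡 d) f x v)

/-! ### Levi-Civita connection and curvature -/

/-- The Christoffel symbols
`Γ^k_{ij} = ½ ∑_l g^{kl} (∂_i g_{jl} + ∂_j g_{il} - ∂_l g_{ij})` in the preferred chart at `p`, as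
functions of the chart variable `y`. -/
def christoffel (g : SemiRiemannianMetric d N) (p : N) (k i j : Fin d) (y : Coord d) : ℝ :=
  (1 / 2) * ∑ l, (gramMatrix g p y)⁻¹ k l *
    (partialDeriv i (fun z ↦ gramMatrix g p z j l) y
      + partialDeriv j (fun z ↦ gramMatrix g p z i l) y
      - partialDeriv l (fun z ↦ gramMatrix g p z i j) y)

/-- The components `R^l_{kij}` at `p`, in the preferred chart at `p`, of the curvature tensor:
`R(∂_i, ∂_j) ∂_k = ∑_l R^l_{kij} ∂_l`, where `R(u, v) = [∇_u, ∇_v] - ∇_{[u, v]}`. -/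
def curvatureComponent (g : SemiRiemannianMetric d N) (p : N) (l k i j : Fin d) : ℝ :=
  partialDeriv i (christoffel g p l j k) (extChartAt (𝓡 d) p p)
    - partialDeriv j (christoffel g p l i k) (extChartAt (𝓡 d) p p)
    + ∑ s, (christoffel g p l i s (extChartAt (𝓡 d) p p)
              * christoffel g p s j k (extChartAt (𝓡 d) p p)
          - christoffel g p l j s (extChartAt (𝓡 d) p p)
              * christoffel g p s i k (extChartAt (𝓡 d) p p))

/-- The curvature tensor `R(u, v) w`. -/
def curvature (g : SemiRiemannianMetric d N) (p : N) (u v w : TangentSpace (𝓡 d) p) :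
    TangentSpace (𝓡 d) p :=
  ∑ l, (∑ k, ∑ i, ∑ j, curvatureComponent g p l k i j *
    coords p p u i * coords p p v j * coords p p w k) • frame p l

/-- `⟨u, u⟩⟨v, v⟩ - ⟨u, v⟩²`; nonzero exactly when `u` and `v` span a nondegenerate plane. -/
def planeArea (g : SemiRiemannianMetric d N) (p : N) (u v : TangentSpace (𝓡 d) p) : ℝ :=
  g.inner p u u * g.inner p v v - g.inner p u v ^ 2

/-- The sectional curvature of the plane spanned by `u` and `v`, meaningful when that plane is
nondegenerate. -/
def sectionalCurvature (g : SemiRiemannianMetric d N) (p : N) (u v : TangentSpace (𝓡 d) p) : ℝ :=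
  g.inner p (curvature g p u v v) u / planeArea g p u v

/-- The metric has constant (sectional) curvature. -/
def HasConstantCurvature (g : SemiRiemannianMetric d N) : Prop :=
  ∃ c : ℝ, ∀ (p : N) (u v : TangentSpace (𝓡 d) p),
    planeArea g p u v ≠ 0 → sectionalCurvature g p u v = c

/-- The Ricci curvature `Ric(v, w)`, the trace of `u ↦ R(u, v) w`. -/
def ricci (g : SemiRiemannianMetric d N) (p : N) (v w : TangentSpace (𝓡 d) p) : ℝ :=
  ∑ i, coords p p (curvature g p (frame p i) v w) i

/-- The metric is Einstein: `Ric = c g` for a constant `c`. -/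
def IsEinstein (g : SemiRiemannianMetric d N) : Prop :=
  ∃ c : ℝ, ∀ (p : N) (v w : TangentSpace (𝓡 d) p), ricci g p v w = c * g.inner p v w

/-! ### The volume measure -/

/-- The measure `√|det g_{ij}| dy` of the domain of the preferred chart at `p`, as a measure on the
manifold that is carried by this domain. -/
def chartVolume [MeasurableSpace N] (g : SemiRiemannianMetric d N) (p : N) : Measure N :=
  (((volume : Measure (Coord d)).restrict (extChartAt (𝓡 d) p).target).withDensity
    (fun y ↦ ENNReal.ofReal (Real.sqrt |(gramMatrix g p y).det|))).map (extChartAt (𝓡 d) p).symm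

/-- The volume measure of a semi-Riemannian metric, as the least measure above all
`chartVolume g p`. By the change of variables formula the chart measures agree on the overlaps of
the charts, so the restriction of this measure to the domain of the chart at `p` is
`chartVolume g p`. -/
def volumeMeasure [MeasurableSpace N] (g : SemiRiemannianMetric d N) : Measure N :=
  ⨆ p : N, chartVolume g p

end Metric

/-- The generalized Kronecker symbol `ε^{i₁ … i_k}_{j₁ … j_k}`: it is `0` if the `i`s or the `j`s
have a repetition or if they differ as sets, and otherwise the sign of the permutation that takes
one list to the other. -/
def kronecker {m k : ℕ} (I J : Fin k → Fin m) : ℝ :=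
  Matrix.det (Matrix.of fun a b : Fin k ↦ if I a = J b then (1 : ℝ) else 0)

/-! ### Isometric immersions -/

section Immersion

variable {m n : ℕ}
  {S : Type*} [TopologicalSpace S] [ChartedSpace (Coord m) S] [IsManifold (𝓡 m) ∞ S]
  {M : Type*} [TopologicalSpace M] [ChartedSpace (Coord n) M] [IsManifold (𝓡 n) ∞ M]

/-- `φ` is an isometric immersion of `(S, h)` into `(M, g)`. -/
structure IsIsometricImmersion (h : SemiRiemannianMetric m S) (g : SemiRiemannianMetric n M)
    (φ : S → M) : Prop where
  contMDiff : ContMDiff (𝓡 m) (𝓡 n) ∞ φ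
  injective (x : S) : Function.Injective (mfderiv (𝓡 m) (𝓡 n) φ x)
  isometric (x : S) (u v : TangentSpace (𝓡 m) x) :
    g.inner (φ x) (mfderiv (𝓡 m) (𝓡 n) φ x u) (mfderiv (𝓡 m) (𝓡 n) φ x v) = h.inner x u v

/-- `X` is a smooth section of the pullback bundle `φ^*(TM)`. -/
def IsSmoothAlong (m : ℕ) [ChartedSpace (Coord m) S] (φ : S → M) (X : ∀ x : S, TangentSpace (𝓡 n) (φ x)) : Prop :=
  ContMDiff (𝓡 m) (𝓡 n).tangent ∞ (fun x ↦ (⟨φ x, X x⟩ : TangentBundle (𝓡 n) M))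

/-- The covariant derivative along `φ`, with respect to the Levi-Civita connection of `g`, of a
vector field `X` along `φ` in the direction `v`: in the preferred chart at `φ x`, its `k`-th
component is `v(X^k) + ∑_{i,j} Γ^k_{ij} (dφ v)^i X^j`. -/
def covDerivAlong (g : SemiRiemannianMetric n M) (φ : S → M)
    (X : ∀ x : S, TangentSpace (𝓡 n) (φ x)) (x : S) (v : TangentSpace (𝓡 m) x) :
    TangentSpace (𝓡 n) (φ x) :=
  ∑ k, (mvfderiv (𝓡 m) (fun x' ↦ coords (φ x) (φ x') (X x') k) x v
    + ∑ i, ∑ j, christoffel g (φ x) k i j (extChartAt (𝓡 n) (φ x) (φ x))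
        * coords (φ x) (φ x) (mfderiv (𝓡 m) (𝓡 n) φ x v) i
        * coords (φ x) (φ x) (X x) j) • frame (φ x) k

/-- `X` is conformal along `φ` with factor `α`:
`∇̄_u X · v + ∇̄_v X · u = 2 α ⟨u, v⟩` for all vectors `u`, `v` tangent to `S`. -/
def IsConformalAlong (h : SemiRiemannianMetric m S) (g : SemiRiemannianMetric n M) (φ : S → M)
    (X : ∀ x : S, TangentSpace (𝓡 n) (φ x)) (α : S → ℝ) : Prop :=
  ∀ (x : S) (u v : TangentSpace (𝓡 m) x),
    g.inner (φ x) (covDerivAlong g φ X x u) (mfderiv (𝓡 m) (𝓡 n) φ x v)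
      + g.inner (φ x) (covDerivAlong g φ X x v) (mfderiv (𝓡 m) (𝓡 n) φ x u)
    = 2 * α x * h.inner x u v

/-- The tangential component `w^T` of `w ∈ T_{φ x} M`, as a vector tangent to `S`. -/
def tangentialPart (h : SemiRiemannianMetric m S) (g : SemiRiemannianMetric n M) (φ : S → M)
    (x : S) (w : TangentSpace (𝓡 n) (φ x)) : TangentSpace (𝓡 m) x :=
  sharp h x (fun v ↦ g.inner (φ x) w (mfderiv (𝓡 m) (𝓡 n) φ x v))

/-- The normal component `w^⊥` of `w ∈ T_{φ x} M`. -/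
def normalPart (h : SemiRiemannianMetric m S) (g : SemiRiemannianMetric n M) (φ : S → M)
    (x : S) (w : TangentSpace (𝓡 n) (φ x)) : TangentSpace (𝓡 n) (φ x) :=
  w - mfderiv (𝓡 m) (𝓡 n) φ x (tangentialPart h g φ x w)

/-- The normal-valued second fundamental form `A(u, v) = -(∇̄_u V)^⊥`. The tangent vector `v` is
extended to the local vector field `V` with constant coordinates in the preferred chart at `x`;
the value does not depend on the extension. -/
def secondFundamentalForm (h : SemiRiemannianMetric m S) (g : SemiRiemannianMetric n M)
    (φ : S → M) (x : S) (u v : TangentSpace (𝓡 m) x) : TangentSpace (𝓡 n) (φ x) :=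
  -normalPart h g φ x
    (covDerivAlong g φ
      (fun x' ↦ mfderiv (𝓡 m) (𝓡 n) φ x' (ofCoords x x' (coords x x v))) x u)

/-- The mixed components `A_i^j = ∑_l h^{jl} A(e_i, e_l)` of the second fundamental form in the
frame `e = frame x`. In an orthonormal frame with `⟨e_j, e_j⟩ = μ_j` this is `μ_j A(e_i, e_j)`. -/
def mixedA (h : SemiRiemannianMetric m S) (g : SemiRiemannianMetric n M) (φ : S → M) (x : S)
    (i j : Fin m) : TangentSpace (𝓡 n) (φ x) :=
  ∑ l, inverseMetric h x j l • secondFundamentalForm h g φ x (frame x i) (frame x l)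

/-- The product `(A_{i₁}^{j₁} · A_{i₂}^{j₂}) ⋯ (A_{i_{2r-1}}^{j_{2r-1}} · A_{i_{2r}}^{j_{2r}})`
taken over the first `2r` entries of the index lists. -/
def pairProduct (h : SemiRiemannianMetric m S) (g : SemiRiemannianMetric n M) (φ : S → M) (x : S)
    (r : ℕ) {k : ℕ} (hk : 2 * r ≤ k) (I J : Fin k → Fin m) : ℝ :=
  ∏ a : Fin r, g.inner (φ x)
    (mixedA h g φ x (I ⟨2 * a.val, by omega⟩) (J ⟨2 * a.val, by omega⟩))
    (mixedA h g φ x (I ⟨2 * a.val + 1, by omega⟩) (J ⟨2 * a.val + 1, by omega⟩))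

/-- The (scalar) mean curvature `H_k` of even order `k = 2r`. -/
def evenH (h : SemiRiemannianMetric m S) (g : SemiRiemannianMetric n M) (φ : S → M) (r : ℕ)
    (x : S) : ℝ :=
  (1 / ((2 * r).factorial : ℝ)) * ∑ I : Fin (2 * r) → Fin m, ∑ J : Fin (2 * r) → Fin m,
    kronecker I J * pairProduct h g φ x r le_rfl I J

/-- The (normal vector valued) mean curvature `H_k` of odd order `k = 2r + 1`. -/
def oddH (h : SemiRiemannianMetric m S) (g : SemiRiemannianMetric n M) (φ : S → M) (r : ℕ)
    (x : S) : TangentSpace (𝓡 n) (φ x) :=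
  (1 / ((2 * r + 1).factorial : ℝ)) •
    ∑ I : Fin (2 * r + 1) → Fin m, ∑ J : Fin (2 * r + 1) → Fin m,
      (kronecker I J * pairProduct h g φ x r (Nat.le_succ _) I J) •
        mixedA h g φ x (I (Fin.last _)) (J (Fin.last _))

/-- The normalized mean curvature `σ_k = H_k / binom(m, k)`, `k = 2r`. -/
def evenSigma (h : SemiRiemannianMetric m S) (g : SemiRiemannianMetric n M) (φ : S → M) (r : ℕ)
    (x : S) : ℝ :=
  evenH h g φ r x / (m.choose (2 * r) : ℝ)

/-- The normalized mean curvature vector `σ_k = H_k / binom(m, k)`, `k = 2r + 1`. -/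
def oddSigma (h : SemiRiemannianMetric m S) (g : SemiRiemannianMetric n M) (φ : S → M) (r : ℕ)
    (x : S) : TangentSpace (𝓡 n) (φ x) :=
  (1 / (m.choose (2 * r + 1) : ℝ)) • oddH h g φ r x

/-- The Newton transformation `T_k`, `k = 2r`, as an endomorphism of the tangent space:
`T_k(e_j) = ∑_i (T_k)_j^i e_i`. -/
def evenNewton (h : SemiRiemannianMetric m S) (g : SemiRiemannianMetric n M) (φ : S → M) (r : ℕ)
    (x : S) (v : TangentSpace (𝓡 m) x) : TangentSpace (𝓡 m) x :=
  ∑ i, ∑ j, ((1 / ((2 * r).factorial : ℝ)) *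
    (∑ I : Fin (2 * r) → Fin m, ∑ J : Fin (2 * r) → Fin m,
      kronecker (Fin.cons i I : Fin (2 * r + 1) → Fin m) (Fin.cons j J) *
        pairProduct h g φ x r le_rfl I J) * coords x x v j) • frame x i

/-! ### Hypersurfaces -/

/-- `ν` is a smooth unit normal vector field along `φ`, with `ν · ν = 1` or `ν · ν = -1`. -/
structure IsUnitNormal (m : ℕ) [ChartedSpace (Coord m) S] (g : SemiRiemannianMetric n M) (φ : S → M)
    (ν : ∀ x : S, TangentSpace (𝓡 n) (φ x)) : Prop where
  smooth : IsSmoothAlong m φ ν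
  unit (x : S) : g.inner (φ x) (ν x) (ν x) = 1 ∨ g.inner (φ x) (ν x) (ν x) = -1
  normal (x : S) (v : TangentSpace (𝓡 m) x) :
    g.inner (φ x) (ν x) (mfderiv (𝓡 m) (𝓡 n) φ x v) = 0

/-- The components `B_i^j` of the shape operator `B` of a hypersurface with unit normal `ν`, given
by `A(u, v) = ⟨B u, v⟩ ν`, that is `⟨B u, v⟩ = (ν · ν) (A(u, v) · ν)`. -/
def shapeOperator (h : SemiRiemannianMetric m S) (g : SemiRiemannianMetric n M) (φ : S → M)
    (ν : ∀ x : S, TangentSpace (𝓡 n) (φ x)) (x : S) (i j : Fin m) : ℝ :=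
  g.inner (φ x) (ν x) (ν x) * g.inner (φ x) (mixedA h g φ x i j) (ν x)

/-- The scalar `k`-th mean curvature of a hypersurface, the `k`-th elementary symmetric function
of the principal curvatures (the eigenvalues of the shape operator). -/
def hyperH (h : SemiRiemannianMetric m S) (g : SemiRiemannianMetric n M) (φ : S → M)
    (ν : ∀ x : S, TangentSpace (𝓡 n) (φ x)) (k : ℕ) (x : S) : ℝ :=
  (1 / (k.factorial : ℝ)) * ∑ I : Fin k → Fin m, ∑ J : Fin k → Fin m,
    kronecker I J * ∏ a, shapeOperator h g φ ν x (I a) (J a)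

/-- The normalized scalar `k`-th mean curvature of a hypersurface. -/
def hyperSigma (h : SemiRiemannianMetric m S) (g : SemiRiemannianMetric n M) (φ : S → M)
    (ν : ∀ x : S, TangentSpace (𝓡 n) (φ x)) (k : ℕ) (x : S) : ℝ :=
  hyperH h g φ ν k x / (m.choose k : ℝ)

/-- The Newton transformation `T_k` of a hypersurface, as an endomorphism of the tangent space. -/
def hyperNewton (h : SemiRiemannianMetric m S) (g : SemiRiemannianMetric n M) (φ : S → M)
    (ν : ∀ x : S, TangentSpace (𝓡 n) (φ x)) (k : ℕ) (x : S) (v : TangentSpace (𝓡 m) x) :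
    TangentSpace (𝓡 m) x :=
  ∑ i, ∑ j, ((1 / (k.factorial : ℝ)) *
    (∑ I : Fin k → Fin m, ∑ J : Fin k → Fin m,
      kronecker (Fin.cons i I : Fin (k + 1) → Fin m) (Fin.cons j J) *
        ∏ a, shapeOperator h g φ ν x (I a) (J a)) * coords x x v j) • frame x i

/-! ### The integral formulas -/

/-- `∫ α f σ_k = ∫ f σ_{k+1} · X - 1 / ((m - k) binom(m, k)) ∫ ⟨T_k(∇f), X^T⟩` for `k = 2r` in
arbitrary codimension, together with the integrability of the three integrands. -/
def EvenFormula [MeasurableSpace S] (h : SemiRiemannianMetric m S) (g : SemiRiemannianMetric n M)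
    (φ : S → M) (X : ∀ x : S, TangentSpace (𝓡 n) (φ x)) (α f : S → ℝ) (r : ℕ) : Prop :=
  Integrable (fun x ↦ α x * f x * evenSigma h g φ r x) (volumeMeasure h) ∧
  Integrable (fun x ↦ f x * g.inner (φ x) (oddSigma h g φ r x) (X x)) (volumeMeasure h) ∧
  Integrable (fun x ↦ h.inner x (evenNewton h g φ r x (gradient h f x))
    (tangentialPart h g φ x (X x))) (volumeMeasure h) ∧
  ∫ x, α x * f x * evenSigma h g φ r x ∂(volumeMeasure h)
    = ∫ x, f x * g.inner (φ x) (oddSigma h g φ r x) (X x) ∂(volumeMeasure h)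
      - 1 / (((m : ℝ) - 2 * r) * (m.choose (2 * r) : ℝ))
        * ∫ x, h.inner x (evenNewton h g φ r x (gradient h f x))
            (tangentialPart h g φ x (X x)) ∂(volumeMeasure h)

/-- `∫ α f σ_k = ∫ f σ_{k+1} ν · X - 1 / ((m - k) binom(m, k)) ∫ ⟨T_k(∇f), X^T⟩` for hypersurfaces
with unit normal `ν`, together with the integrability of the three integrands. -/
def HypersurfaceFormula [MeasurableSpace S] (h : SemiRiemannianMetric m S)
    (g : SemiRiemannianMetric n M) (φ : S → M) (ν X : ∀ x : S, TangentSpace (𝓡 n) (φ x))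
    (α f : S → ℝ) (k : ℕ) : Prop :=
  Integrable (fun x ↦ α x * f x * hyperSigma h g φ ν k x) (volumeMeasure h) ∧
  Integrable (fun x ↦ f x * hyperSigma h g φ ν (k + 1) x * g.inner (φ x) (ν x) (X x))
    (volumeMeasure h) ∧
  Integrable (fun x ↦ h.inner x (hyperNewton h g φ ν k x (gradient h f x))
    (tangentialPart h g φ x (X x))) (volumeMeasure h) ∧
  ∫ x, α x * f x * hyperSigma h g φ ν k x ∂(volumeMeasure h)
    = ∫ x, f x * hyperSigma h g φ ν (k + 1) x * g.inner (φ x) (ν x) (X x) ∂(volumeMeasure h)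
      - 1 / (((m : ℝ) - k) * (m.choose k : ℝ))
        * ∫ x, h.inner x (hyperNewton h g φ ν k x (gradient h f x))
            (tangentialPart h g φ x (X x)) ∂(volumeMeasure h)

end Immersion

end HsiungMinkowski

end

/-!
The integral formulas come from the divergence theorem for the vector field `f T(X^T)`, where `T` is
the Newton transformation. Its divergence consists of a term with `∇f`, a term with the symmetric
part of the tangential derivative of `X`, which the conformal Killing equation turns into
`α f tr T` (`frameContract_conformal`), a term with the second fundamental form, which comes from
`∇(X^T) = (∇X)^T - X · A` and is a multiple of `f H_{k+1} · X`, and a term with the divergence of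
`T`, which has to vanish (`divergence_newtonField`, `integral_frameContract`).

Both kinds of mean curvatures are treated at once. For a field `μ` of multilinear forms of degree `k`
on the spaces `T_{φ(x)} M` and a bilinear form `C` on `T_x S`, `frameContract` is the contraction
`∑ ε^{i i₁ … i_k}_{j j₁ … j_k} C_i^j μ(A_{i₁}^{j₁}, …, A_{i_k}^{j_k})`. The products of pairings
`A · A` correspond to `μ = pairForm`, the powers of the shape operator to `μ = shapeForm`. The
metric, `X · A` and `df ⊗ X` in place of `C` give `H_k`, `H_{k+1} · X` and `⟨T_k(∇f), X^T⟩`, up to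
factors (`frameContract_metric`, `sum_kronecker_cons_mixedA`, `inner_newton_gradient`).

The Newton tensor is divergence free if the antisymmetrized derivative of `μ(A, …, A)` contracts to
zero (`IsCodazziForm`). The metric pairing and the square of the unit normal are parallel, so only
the normal part of `∇A` enters. By the Codazzi equation (`codazzi`) its antisymmetrization is the
normal part of the ambient curvature, which vanishes in constant curvature; then the Kronecker symbol
kills the sum (`sum_det_cons_eq_zero`). For a hypersurface and `k = 1` only the Ricci curvature
`Ric(e_i, ν)` is left, which is zero for an Einstein metric
(`IsUnitNormal.sum_inverseMetric_curv`), and for `k = 0` there is nothing to differentiate.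

All differential geometry is done in coordinates, with frames that are parallel at a point
(`parFrame`) in place of covariant derivatives of tensors. The covariant derivative along a map is
independent of the charts (`coords_covDerivAlong`), which gives the coordinate expressions of the
second fundamental form and of the divergence. The divergence theorem (`integral_divergence`) follows
from `div V = ρ⁻¹ ∑ ∂_i (ρ V^i)` with the volume density `ρ`, and a partition of unity. Constant
sectional curvature is a condition on nondegenerate planes only; it determines the curvature tensor
by polarization and density (`IsCurvatureTensor.eq_zero_of_nondegenerate`).
-/

noncomputable section

set_option linter.unusedSectionVars false

namespace HsiungMinkowski

open scoped Matrix

/-! ### Contractions of tensors with minors -/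

section Contraction

variable {m k : ℕ}

/-- The full contraction `∑ det (q^{i_a l_b}) Ψ_{i₁ … i_k, l₁ … l_k}` of an array `Ψ` with the
antisymmetrization of `q ⊗ ⋯ ⊗ q`. For `q` the inverse of a metric and `Ψ` a covariant tensor this
is the contraction of the mixed tensor `Ψ` with the generalized Kronecker symbol. -/
def contract (q : Matrix (Fin m) (Fin m) ℝ) (Ψ : (Fin k → Fin m) → (Fin k → Fin m) → ℝ) : ℝ :=
  ∑ I, ∑ L, (q.submatrix I L).det * Ψ I L

/-- The array obtained from `Ψ` by applying `P` to each index of the first group and `R` to each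
index of the second group. -/
def transform (P R : Matrix (Fin m) (Fin m) ℝ) (Ψ : (Fin k → Fin m) → (Fin k → Fin m) → ℝ)
    (I L : Fin k → Fin m) : ℝ :=
  ∑ K, ∑ N, (∏ a, P (I a) (K a)) * (∏ a, R (L a) (N a)) * Ψ K N

/-- The tensor product of an array `C` with one index in each group and an array `Ψ`. -/
def consTensor (C : Fin m → Fin m → ℝ) (Ψ : (Fin k → Fin m) → (Fin k → Fin m) → ℝ)
    (I L : Fin (k + 1) → Fin m) : ℝ :=
  C (I 0) (L 0) * Ψ (Fin.tail I) (Fin.tail L)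

lemma kronecker_eq_det (I J : Fin k → Fin m) :
    kronecker I J = ((1 : Matrix (Fin m) (Fin m) ℝ).submatrix I J).det := by
  unfold kronecker
  congr 1

/-- Multilinearity of the minors of `q` in the rows. -/
lemma sum_prod_mul_det (P q : Matrix (Fin m) (Fin m) ℝ) (K L : Fin k → Fin m) :
    ∑ I : Fin k → Fin m, (∏ a, P (I a) (K a)) * (q.submatrix I L).det
      = ((Pᵀ * q).submatrix K L).det := by
  have h1 : ((Pᵀ * q).submatrix K L).det
      = Matrix.detRowAlternating.toMultilinearMap
        (fun a ↦ ∑ s : Fin m, P s (K a) • (fun b ↦ q s (L b))) := by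
    change Matrix.det _ = Matrix.det _
    congr 1
    ext a b
    simp [Matrix.mul_apply, Finset.sum_apply]
  rw [h1, MultilinearMap.map_sum]
  refine Finset.sum_congr rfl fun I _ ↦ ?_
  rw [MultilinearMap.map_smul_univ]
  rfl

/-- Multilinearity of the minors of `q` in the columns. -/
lemma sum_prod_mul_det' (q R : Matrix (Fin m) (Fin m) ℝ) (I N : Fin k → Fin m) :
    ∑ L : Fin k → Fin m, (∏ a, R (L a) (N a)) * (q.submatrix I L).det
      = ((q * R).submatrix I N).det := by
  have := sum_prod_mul_det R qᵀ N I
  rw [← Matrix.transpose_mul, ← Matrix.transpose_submatrix, Matrix.det_transpose] at this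
  rw [← this]
  refine Finset.sum_congr rfl fun L _ ↦ ?_
  rw [← Matrix.transpose_submatrix, Matrix.det_transpose]

lemma sum_comm_pairs {ι κ α : Type*} [Fintype ι] [Fintype κ] [AddCommMonoid α]
    (F : ι → ι → κ → κ → α) :
    ∑ i, ∑ l, ∑ k, ∑ n, F i l k n = ∑ k, ∑ n, ∑ i, ∑ l, F i l k n := by
  calc ∑ i, ∑ l, ∑ k, ∑ n, F i l k n = ∑ i, ∑ k, ∑ l, ∑ n, F i l k n :=
        Finset.sum_congr rfl fun i _ ↦ Finset.sum_comm
    _ = ∑ k, ∑ i, ∑ n, ∑ l, F i l k n := by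
        rw [Finset.sum_comm]
        exact Finset.sum_congr rfl fun k _ ↦ Finset.sum_congr rfl fun i _ ↦ Finset.sum_comm
    _ = _ := Finset.sum_congr rfl fun k _ ↦ Finset.sum_comm

/-- Naturality of `contract`: an array can be transformed on either side of the pairing. -/
lemma contract_transform (q P R : Matrix (Fin m) (Fin m) ℝ)
    (Ψ : (Fin k → Fin m) → (Fin k → Fin m) → ℝ) :
    contract q (transform P R Ψ) = contract (Pᵀ * q * R) Ψ := by
  have h1 : ∀ K N : Fin k → Fin m, ((Pᵀ * q * R).submatrix K N).det
      = ∑ I : Fin k → Fin m, ∑ L : Fin k → Fin m,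
        (∏ a, P (I a) (K a)) * (∏ a, R (L a) (N a)) * (q.submatrix I L).det := by
    intro K N
    rw [← sum_prod_mul_det']
    simp_rw [← sum_prod_mul_det, Finset.mul_sum]
    rw [Finset.sum_comm]
    exact Finset.sum_congr rfl fun I _ ↦ Finset.sum_congr rfl fun L _ ↦ by ring
  unfold contract transform
  simp_rw [h1, Finset.mul_sum, Finset.sum_mul]
  rw [sum_comm_pairs]
  refine Finset.sum_congr rfl fun K _ ↦ Finset.sum_congr rfl fun N _ ↦
    Finset.sum_congr rfl fun I _ ↦ Finset.sum_congr rfl fun L _ ↦ by ring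

lemma sum_fin_cons {α : Type*} [AddCommMonoid α] (F : (Fin (k + 1) → Fin m) → α) :
    ∑ I, F I = ∑ i, ∑ I : Fin k → Fin m, F (Fin.cons i I) := by
  rw [← (Fin.consEquiv (fun _ : Fin (k + 1) ↦ Fin m)).sum_comp, Fintype.sum_prod_type]
  rfl

lemma sum_fin_snoc {α : Type*} [AddCommMonoid α] (F : (Fin (k + 1) → Fin m) → α) :
    ∑ I, F I = ∑ i, ∑ I : Fin k → Fin m, F (Fin.snoc (α := fun _ ↦ Fin m) I i) := by
  rw [← (Fin.snocEquiv (fun _ : Fin (k + 1) ↦ Fin m)).sum_comp, Fintype.sum_prod_type]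
  rfl

/-- Separation of the first pair of indices of a contraction. -/
lemma contract_consTensor (q : Matrix (Fin m) (Fin m) ℝ) (C : Fin m → Fin m → ℝ)
    (Ψ : (Fin k → Fin m) → (Fin k → Fin m) → ℝ) :
    contract q (consTensor C Ψ) = ∑ i, ∑ l, C i l *
      ∑ I : Fin k → Fin m, ∑ L : Fin k → Fin m,
        (q.submatrix (Fin.cons i I : Fin (k + 1) → Fin m) (Fin.cons l L)).det * Ψ I L := by
  unfold contract consTensor
  rw [sum_fin_cons]
  refine Finset.sum_congr rfl fun i _ ↦ ?_
  simp_rw [sum_fin_cons (k := k), Fin.cons_zero, Fin.tail_cons]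
  rw [Finset.sum_comm]
  refine Finset.sum_congr rfl fun l _ ↦ ?_
  rw [Finset.mul_sum]
  refine Finset.sum_congr rfl fun I _ ↦ ?_
  rw [Finset.mul_sum]
  exact Finset.sum_congr rfl fun L _ ↦ by ring

/-- A change of frame acts on each tensor factor. -/
lemma transform_consTensor (P R : Matrix (Fin m) (Fin m) ℝ) (C : Fin m → Fin m → ℝ)
    (Ψ : (Fin k → Fin m) → (Fin k → Fin m) → ℝ) :
    consTensor (fun i l ↦ ∑ s, ∑ t, P i s * R l t * C s t) (transform P R Ψ)
      = transform P R (consTensor C Ψ) := by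
  ext I L
  unfold transform
  simp_rw [sum_fin_cons (α := ℝ) (m := m) (k := k)]
  simp only [consTensor, Fin.prod_univ_succ, Fin.cons_zero, Fin.cons_succ, Fin.tail_cons]
  simp only [Finset.sum_mul, Finset.mul_sum]
  conv_rhs => rw [Finset.sum_comm]
  refine Finset.sum_congr rfl fun K _ ↦ ?_
  rw [Finset.sum_comm]
  refine Finset.sum_congr rfl fun s _ ↦ ?_
  rw [Finset.sum_comm]
  refine Finset.sum_congr rfl fun t _ ↦ Finset.sum_congr rfl fun N _ ↦ ?_
  simp only [Fin.tail]
  ring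

/-- The effect of a change of frame on the array `Ψ` obtained from a multilinear form and
vector-valued components `A`. -/
lemma multilinear_transform {W : Type*} [AddCommGroup W] [Module ℝ W]
    (μ : MultilinearMap ℝ (fun _ : Fin k ↦ W) ℝ) (P R : Matrix (Fin m) (Fin m) ℝ)
    (A : Fin m → Fin m → W) :
    (fun I L : Fin k → Fin m ↦ μ fun a ↦ ∑ s, ∑ t, (P (I a) s * R (L a) t) • A s t)
      = transform P R (fun I L ↦ μ fun a ↦ A (I a) (L a)) := by
  ext I L
  have h1 : (fun a ↦ ∑ s, ∑ t, (P (I a) s * R (L a) t) • A s t)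
      = fun a : Fin k ↦ ∑ st : Fin m × Fin m, (P (I a) st.1 * R (L a) st.2) • A st.1 st.2 := by
    ext a
    rw [Fintype.sum_prod_type]
  rw [h1, MultilinearMap.map_sum]
  simp_rw [MultilinearMap.map_smul_univ]
  rw [← (Equiv.arrowProdEquivProdArrow (Fin k) (fun _ ↦ Fin m) (fun _ ↦ Fin m)).symm.sum_comp,
    Fintype.sum_prod_type]
  unfold transform
  refine Finset.sum_congr rfl fun K _ ↦ Finset.sum_congr rfl fun N _ ↦ ?_
  rw [← Finset.prod_mul_distrib]
  rfl

/-- An array that is symmetric in two indices of the first group contracts to zero, since the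
minors are skew in the rows. -/
lemma contract_swap_eq_zero (q : Matrix (Fin m) (Fin m) ℝ) {k : ℕ} {a b : Fin k} (hab : a ≠ b)
    (Ψ : (Fin k → Fin m) → (Fin k → Fin m) → ℝ)
    (hΨ : ∀ I L, Ψ (I ∘ Equiv.swap a b) L = Ψ I L) : contract q Ψ = 0 := by
  have h1 : contract q Ψ = - contract q Ψ := by
    conv_lhs => unfold contract
    rw [← (Equiv.arrowCongr (Equiv.swap a b) (Equiv.refl (Fin m))).sum_comp]
    unfold contract
    rw [← Finset.sum_neg_distrib]
    refine Finset.sum_congr rfl fun I _ ↦ ?_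
    rw [← Finset.sum_neg_distrib]
    refine Finset.sum_congr rfl fun L _ ↦ ?_
    have e : (Equiv.arrowCongr (Equiv.swap a b) (Equiv.refl (Fin m))) I
        = I ∘ Equiv.swap a b := by
      ext c; simp [Equiv.arrowCongr]
    rw [e, hΨ]
    have := Matrix.det_permute (Equiv.swap a b) (q.submatrix I L)
    rw [Matrix.submatrix_submatrix, Equiv.Perm.sign_swap hab] at this
    simp only [Function.comp_id] at this
    change (q.submatrix (I ∘ Equiv.swap a b) (L ∘ id)).det * _ = _
    simp only [Function.comp_id]
    rw [this]
    simp
  linarith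

/-- Symmetry of the minors of a symmetric matrix. -/
lemma det_submatrix_comm {q : Matrix (Fin m) (Fin m) ℝ} (hq : qᵀ = q) (I L : Fin k → Fin m) :
    (q.submatrix I L).det = (q.submatrix L I).det := by
  conv_lhs => rw [← hq]
  rw [← Matrix.transpose_submatrix, Matrix.det_transpose]

/-- Contraction of a pair of indices of the generalized Kronecker symbol. -/
lemma sum_kronecker_cons (I J : Fin k → Fin m) :
    ∑ i, kronecker (Fin.cons i I : Fin (k + 1) → Fin m) (Fin.cons i J)
      = ((m : ℝ) - k) * kronecker I J := by
  cases k with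
  | zero => simp [kronecker]
  | succ k =>
  -- Laplace expansion along the row of the index `i`
  have h1 : ∀ i, kronecker (Fin.cons i I : Fin (k + 1 + 1) → Fin m) (Fin.cons i J)
      = kronecker I J + ∑ b : Fin (k + 1), (-1 : ℝ) ^ (b.succ : ℕ)
        * (if i = J b then (1 : ℝ) else 0) * kronecker I (Fin.cons i (J ∘ b.succAbove)) := by
    intro i
    conv_lhs => unfold kronecker
    rw [Matrix.det_succ_row_zero, Fin.sum_univ_succ]
    congr 1
    · simp only [Fin.val_zero, pow_zero, Matrix.of_apply, Fin.cons_zero, if_true, one_mul]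
      rfl
    · refine Finset.sum_congr rfl fun b _ ↦ ?_
      simp only [Matrix.of_apply, Fin.cons_zero, Fin.cons_succ]
      congr 1
      unfold kronecker
      congr 1
      ext a c
      refine Fin.cases ?_ (fun c ↦ ?_) c
      · simp
      · simp
  -- the remaining minors differ from the full symbol by a cyclic permutation of the columns
  have h2 : ∀ b : Fin (k + 1), kronecker I (Fin.cons (J b) (J ∘ b.succAbove))
      = (-1 : ℝ) ^ (b : ℕ) * kronecker I J := by
    intro b
    have e : (Fin.cons (J b) (J ∘ b.succAbove) : Fin (k + 1) → Fin m) = J ∘ b.cycleRange.symm := by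
      ext c
      refine Fin.cases ?_ (fun c ↦ ?_) c
      · simp
      · simp
    rw [e, kronecker_eq_det, kronecker_eq_det]
    have := Matrix.det_permute' b.cycleRange.symm ((1 : Matrix (Fin m) (Fin m) ℝ).submatrix I J)
    rw [Matrix.submatrix_submatrix] at this
    simp only [Function.comp_id] at this
    rw [this, Equiv.Perm.sign_symm, Fin.sign_cycleRange]
    simp
  simp_rw [h1]
  rw [Finset.sum_add_distrib, Finset.sum_comm]
  have h3 : ∀ b : Fin (k + 1), ∑ i, (-1 : ℝ) ^ (b.succ : ℕ) * (if i = J b then (1 : ℝ) else 0)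
        * kronecker I (Fin.cons i (J ∘ b.succAbove)) = - kronecker I J := by
    intro b
    simp only [mul_ite, ite_mul, mul_one, mul_zero, zero_mul, Finset.sum_ite_eq',
      Finset.mem_univ, if_true, h2]
    rw [← mul_assoc, ← pow_add, Fin.val_succ, Odd.neg_one_pow ⟨b, by ring⟩]
    ring
  simp only [h3, Finset.sum_const, Finset.card_univ, Fintype.card_fin, nsmul_eq_mul]
  push_cast
  ring

end Contraction

/-! ### Levi-Civita calculus in coordinates -/

section Coordinates

open Filter Topology

variable {E : Type*} [NormedAddCommGroup E] [NormedSpace ℝ E]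
  {E' : Type*} [NormedAddCommGroup E'] [NormedSpace ℝ E']

/-- The bilinear map `Γ y` is the Levi-Civita connection form of the metric `G` at `y`: it satisfies
the Koszul formula for constant vector fields. -/
def IsLeviCivitaAt (G : E → E →L[ℝ] E →L[ℝ] ℝ) (Γ : E → E →L[ℝ] E →L[ℝ] E) (y : E) : Prop :=
  ∀ u v w, G y (Γ y u v) w
    = (1 / 2) * (fderiv ℝ G y u v w + fderiv ℝ G y v u w - fderiv ℝ G y w u v)

/-- The covariant derivative in direction `u` of a vector field `X` along a map `F`. -/
def cov (Γ : E → E →L[ℝ] E →L[ℝ] E) (F X : E' → E) (y u : E') : E :=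
  fderiv ℝ X y u + Γ (F y) (fderiv ℝ F y u) (X y)

/-- The curvature tensor `R(u, v) w` of the connection form `Γ`. -/
def curv (Γ : E → E →L[ℝ] E →L[ℝ] E) (y u v w : E) : E :=
  fderiv ℝ Γ y u v w - fderiv ℝ Γ y v u w + Γ y u (Γ y v w) - Γ y v (Γ y u w)

/-- The second fundamental form of a map `F` between spaces with connection forms `Γ'`, `Γ`, with
the sign convention `-(∇_u dF(v) - dF(∇_u v))`. -/
def secondForm (Γ : E → E →L[ℝ] E →L[ℝ] E) (Γ' : E' → E' →L[ℝ] E' →L[ℝ] E') (F : E' → E)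
    (y u v : E') : E :=
  -(fderiv ℝ (fderiv ℝ F) y u v + Γ (F y) (fderiv ℝ F y u) (fderiv ℝ F y v)
    - fderiv ℝ F y (Γ' y u v))

/-- The vector field with value `v` and vanishing covariant derivative at `y₀`. -/
def parallelAt (Γ' : E' → E' →L[ℝ] E' →L[ℝ] E') (y₀ v y : E') : E' := v - Γ' y₀ (y - y₀) v

set_option synthInstance.maxHeartbeats 200000 in
/-- The product rule for `B(F(z))(a(z), b(z))`. -/
lemma fderiv_bilin_apply {E₁ E₂ E₃ : Type*} [NormedAddCommGroup E₁] [NormedSpace ℝ E₁]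
    [NormedAddCommGroup E₂] [NormedSpace ℝ E₂] [NormedAddCommGroup E₃] [NormedSpace ℝ E₃]
    {B : E → E₁ →L[ℝ] E₂ →L[ℝ] E₃} {F : E' → E} {a : E' → E₁} {b : E' → E₂} {y : E'}
    (hB : DifferentiableAt ℝ B (F y)) (hF : DifferentiableAt ℝ F y) (ha : DifferentiableAt ℝ a y)
    (hb : DifferentiableAt ℝ b y) (u : E') :
    DifferentiableAt ℝ (fun y ↦ B (F y) (a y) (b y)) y ∧
    fderiv ℝ (fun y ↦ B (F y) (a y) (b y)) y u
      = fderiv ℝ B (F y) (fderiv ℝ F y u) (a y) (b y) + B (F y) (fderiv ℝ a y u) (b y)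
        + B (F y) (a y) (fderiv ℝ b y u) := by
  have h1 : HasFDerivAt (fun y ↦ B (F y)) ((fderiv ℝ B (F y)).comp (fderiv ℝ F y)) y :=
    HasFDerivAt.comp (g := B) y hB.hasFDerivAt hF.hasFDerivAt
  have h2 := h1.clm_apply ha.hasFDerivAt
  have h3 := h2.clm_apply hb.hasFDerivAt
  refine ⟨h3.differentiableAt, ?_⟩
  rw [h3.fderiv]
  simp
  abel

/-- The product rule for `L(z)(a(z))`. -/
lemma fderiv_lin_apply {E₁ E₂ : Type*} [NormedAddCommGroup E₁] [NormedSpace ℝ E₁]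
    [NormedAddCommGroup E₂] [NormedSpace ℝ E₂]
    {L : E' → E₁ →L[ℝ] E₂} {a : E' → E₁} {y : E'}
    (hL : DifferentiableAt ℝ L y) (ha : DifferentiableAt ℝ a y) (u : E') :
    DifferentiableAt ℝ (fun y ↦ L y (a y)) y ∧
    fderiv ℝ (fun y ↦ L y (a y)) y u = fderiv ℝ L y u (a y) + L y (fderiv ℝ a y u) := by
  have h2 := hL.hasFDerivAt.clm_apply ha.hasFDerivAt
  refine ⟨h2.differentiableAt, ?_⟩
  rw [h2.fderiv]
  simp
  abel

variable {G : E → E →L[ℝ] E →L[ℝ] ℝ} {Γ : E → E →L[ℝ] E →L[ℝ] E}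
  {G' : E' → E' →L[ℝ] E' →L[ℝ] ℝ} {Γ' : E' → E' →L[ℝ] E' →L[ℝ] E'} {F : E' → E}

lemma fderiv_metric_symm {y : E} (hG : DifferentiableAt ℝ G y)
    (hs : ∀ᶠ z in 𝓝 y, ∀ u v, G z u v = G z v u) (u v w : E) :
    fderiv ℝ G y u v w = fderiv ℝ G y u w v := by
  have h1 : ∀ v w, fderiv ℝ (fun z ↦ G z v w) y u = fderiv ℝ G y u v w := by
    intro v w
    have := (fderiv_bilin_apply (B := G) (F := id) (a := fun _ ↦ v) (b := fun _ ↦ w) (y := y) hG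
      differentiableAt_id (by simp) (by simp) u).2
    simpa using this
  rw [← h1, ← h1]
  have : (fun z ↦ G z v w) =ᶠ[𝓝 y] fun z ↦ G z w v := hs.mono fun z hz ↦ hz v w
  rw [this.fderiv_eq]

/-- The Levi-Civita connection is metric. -/
lemma IsLeviCivitaAt.metric {y : E} (h : IsLeviCivitaAt G Γ y) (hG : DifferentiableAt ℝ G y)
    (hs : ∀ᶠ z in 𝓝 y, ∀ u v, G z u v = G z v u) (u v w : E) :
    fderiv ℝ G y u v w = G y (Γ y u v) w + G y v (Γ y u w) := by
  rw [hs.self_of_nhds v, h, h]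
  have h1 := fderiv_metric_symm hG hs
  rw [h1 u w v, h1 v u w, h1 w u v]
  ring

/-- The Levi-Civita connection is torsion-free. -/
lemma IsLeviCivitaAt.symm {y : E} (h : IsLeviCivitaAt G Γ y) (hG : DifferentiableAt ℝ G y)
    (hs : ∀ᶠ z in 𝓝 y, ∀ u v, G z u v = G z v u) (hn : ∀ u, (∀ v, G y u v = 0) → u = 0)
    (u v : E) : Γ y u v = Γ y v u := by
  rw [← sub_eq_zero]
  refine hn _ fun w ↦ ?_
  have h1 := fderiv_metric_symm hG hs
  rw [map_sub, sub_apply, h, h, h1 w u v]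
  ring

/-- The product rule along `F` for the Levi-Civita connection. -/
lemma fderiv_inner_cov {y : E'} (h : IsLeviCivitaAt G Γ (F y)) (hG : DifferentiableAt ℝ G (F y))
    (hs : ∀ᶠ z in 𝓝 (F y), ∀ u v, G z u v = G z v u) (hF : DifferentiableAt ℝ F y)
    {X Y : E' → E} (hX : DifferentiableAt ℝ X y) (hY : DifferentiableAt ℝ Y y) (u : E') :
    fderiv ℝ (fun z ↦ G (F z) (X z) (Y z)) y u
      = G (F y) (cov Γ F X y u) (Y y) + G (F y) (X y) (cov Γ F Y y u) := by
  rw [(fderiv_bilin_apply hG hF hX hY u).2, h.metric hG hs]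
  simp only [cov, map_add, add_apply]
  ring

/-- The Koszul formula for a pulled back metric: for a change of coordinates it is the
transformation law of the Christoffel symbols, for an immersion it is the Gauss formula. -/
lemma inner_hessian_eq {y : E'} (h : IsLeviCivitaAt G Γ (F y)) (h' : IsLeviCivitaAt G' Γ' y)
    (hG : DifferentiableAt ℝ G (F y)) (hs : ∀ᶠ z in 𝓝 (F y), ∀ u v, G z u v = G z v u)
    (hF : ContDiffAt ℝ 2 F y) (hG' : DifferentiableAt ℝ G' y)
    (hFG : ∀ᶠ z in 𝓝 y, ∀ u v, G' z u v = G (F z) (fderiv ℝ F z u) (fderiv ℝ F z v))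
    (u v w : E') :
    G (F y) (fderiv ℝ (fderiv ℝ F) y u v + Γ (F y) (fderiv ℝ F y u) (fderiv ℝ F y v))
      (fderiv ℝ F y w) = G' y (Γ' y u v) w := by
  have hF1 : DifferentiableAt ℝ F y := hF.differentiableAt (by norm_num)
  have hF2 : DifferentiableAt ℝ (fderiv ℝ F) y :=
    (hF.fderiv_right (m := 1) (by norm_num)).differentiableAt (by norm_num)
  have hsym : ∀ u v, fderiv ℝ (fderiv ℝ F) y u v = fderiv ℝ (fderiv ℝ F) y v u :=
    fun u v ↦ hF.isSymmSndFDerivAt (by simp) u v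
  have key : ∀ u v w, fderiv ℝ G' y u v w
      = fderiv ℝ G (F y) (fderiv ℝ F y u) (fderiv ℝ F y v) (fderiv ℝ F y w)
        + G (F y) (fderiv ℝ (fderiv ℝ F) y u v) (fderiv ℝ F y w)
        + G (F y) (fderiv ℝ F y v) (fderiv ℝ (fderiv ℝ F) y u w) := by
    intro u v w
    have h1 : fderiv ℝ (fun z ↦ G' z v w) y u = fderiv ℝ G' y u v w := by
      have := (fderiv_bilin_apply (B := G') (F := id) (a := fun _ ↦ v) (b := fun _ ↦ w) (y := y) hG'
        differentiableAt_id (by simp) (by simp) u).2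
      simpa using this
    have h2 : (fun z ↦ G' z v w) =ᶠ[𝓝 y] fun z ↦ G (F z) (fderiv ℝ F z v) (fderiv ℝ F z w) :=
      hFG.mono fun z hz ↦ hz v w
    have h3 : ∀ v, DifferentiableAt ℝ (fun z ↦ fderiv ℝ F z v) y ∧
        fderiv ℝ (fun z ↦ fderiv ℝ F z v) y u = fderiv ℝ (fderiv ℝ F) y u v := by
      intro v
      have := fderiv_lin_apply hF2 (a := fun _ ↦ v) (by simp) u
      simpa using this
    rw [← h1, h2.fderiv_eq, (fderiv_bilin_apply hG hF1 (h3 v).1 (h3 w).1 u).2, (h3 v).2, (h3 w).2]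
  have hs' : ∀ a b, G (F y) a b = G (F y) b a := hs.self_of_nhds
  rw [h', map_add, add_apply, h, key u v w, key v u w, key w u v,
    hsym v u, hsym w u, hsym w v, hs' _ (fderiv ℝ (fderiv ℝ F) y u w),
    hs' _ (fderiv ℝ (fderiv ℝ F) y v w)]
  ring

/-- The derivative of the covariant derivative of `X` in a constant direction, expanded into second
derivatives. -/
lemma fderiv_cov_const {y : E'} (hF : ContDiffAt ℝ 2 F y) (hΓ : DifferentiableAt ℝ Γ (F y))
    {X : E' → E} (hX : ContDiffAt ℝ 2 X y) (u v : E') :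
    DifferentiableAt ℝ (fun z ↦ cov Γ F X z v) y ∧
    fderiv ℝ (fun z ↦ cov Γ F X z v) y u
      = fderiv ℝ (fderiv ℝ X) y u v
        + (fderiv ℝ Γ (F y) (fderiv ℝ F y u) (fderiv ℝ F y v) (X y)
          + Γ (F y) (fderiv ℝ (fderiv ℝ F) y u v) (X y)
          + Γ (F y) (fderiv ℝ F y v) (fderiv ℝ X y u)) := by
  have hd : ∀ {Y : E' → E}, ContDiffAt ℝ 2 Y y → DifferentiableAt ℝ (fun z ↦ fderiv ℝ Y z v) y ∧
        fderiv ℝ (fun z ↦ fderiv ℝ Y z v) y u = fderiv ℝ (fderiv ℝ Y) y u v := by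
    intro Y hY
    have hY2 : DifferentiableAt ℝ (fderiv ℝ Y) y :=
      (hY.fderiv_right (m := 1) (by norm_num)).differentiableAt (by norm_num)
    simpa using fderiv_lin_apply hY2 (a := fun _ ↦ v) (by simp) u
  have h1 := fderiv_bilin_apply hΓ (hF.differentiableAt (by norm_num)) (hd hF).1
    (hX.differentiableAt (by norm_num)) u
  refine ⟨(hd hX).1.add h1.1, ?_⟩
  unfold cov
  rw [fderiv_fun_add (hd hX).1 h1.1, add_apply, h1.2, (hd hX).2, (hd hF).2]

/-- The curvature is the commutator of covariant derivatives along a map. -/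
lemma cov_cov_sub {y : E'} (hF : ContDiffAt ℝ 2 F y) (hΓ : DifferentiableAt ℝ Γ (F y))
    {X : E' → E} (hX : ContDiffAt ℝ 2 X y) (u v : E') :
    cov Γ F (fun z ↦ cov Γ F X z v) y u - cov Γ F (fun z ↦ cov Γ F X z u) y v
      = curv Γ (F y) (fderiv ℝ F y u) (fderiv ℝ F y v) (X y) := by
  have e : ∀ u v, cov Γ F (fun z ↦ cov Γ F X z v) y u
      = fderiv ℝ (fun z ↦ cov Γ F X z v) y u + Γ (F y) (fderiv ℝ F y u) (cov Γ F X y v) :=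
    fun u v ↦ rfl
  rw [e, e, (fderiv_cov_const hF hΓ hX u v).2, (fderiv_cov_const hF hΓ hX v u).2]
  rw [hX.isSymmSndFDerivAt (by simp) v u, hF.isSymmSndFDerivAt (by simp) v u]
  simp only [cov, curv, map_add]
  abel

/-- The curvature operators are skew-adjoint. -/
lemma inner_curv_skew {y : E} (h : ∀ᶠ z in 𝓝 y, IsLeviCivitaAt G Γ z) (hG : ContDiffAt ℝ 2 G y)
    (hs : ∀ᶠ z in 𝓝 y, ∀ u v, G z u v = G z v u) (hΓ : DifferentiableAt ℝ Γ y) (u v w z : E) :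
    G y (curv Γ y u v w) z = - G y (curv Γ y u v z) w := by
  have hs' : ∀ᶠ x in 𝓝 y, ∀ᶠ z in 𝓝 x, ∀ u v, G z u v = G z v u := hs.eventually_nhds
  have hGd : ∀ᶠ x in 𝓝 y, DifferentiableAt ℝ G x :=
    (hG.eventually (by simp)).mono fun x hx ↦ hx.differentiableAt (by norm_num)
  have hid : ContDiffAt ℝ 2 (id : E → E) y := contDiffAt_id
  have hc : ∀ w : E, ContDiffAt ℝ 2 (fun _ : E ↦ w) y := fun w ↦ contDiffAt_const
  have h1 : ∀ v : E, (fun x ↦ fderiv ℝ (fun x ↦ G x w z) x v) =ᶠ[𝓝 y] fun x ↦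
      G (id x) (cov Γ id (fun _ ↦ w) x v) z + G (id x) w (cov Γ id (fun _ ↦ z) x v) := by
    intro v
    filter_upwards [h, hs', hGd] with x hx hsx hGx
    exact fderiv_inner_cov (F := id) hx hGx hsx differentiableAt_id (by simp) (by simp) v
  have h2 : ∀ u v : E, fderiv ℝ (fderiv ℝ (fun x ↦ G x w z)) y u v
      = (G y (cov Γ id (fun x ↦ cov Γ id (fun _ ↦ w) x v) y u) z
          + G y (cov Γ id (fun _ ↦ w) y v) (cov Γ id (fun _ ↦ z) y u))
        + (G y (cov Γ id (fun _ ↦ w) y u) (cov Γ id (fun _ ↦ z) y v)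
          + G y w (cov Γ id (fun x ↦ cov Γ id (fun _ ↦ z) x v) y u)) := by
    intro u v
    have hGw : ContDiffAt ℝ 2 (fun x ↦ G x w z) y :=
      (hG.clm_apply (hc w)).clm_apply contDiffAt_const
    have hG2 : DifferentiableAt ℝ (fderiv ℝ (fun x ↦ G x w z)) y :=
      (hGw.fderiv_right (m := 1) (by norm_num)).differentiableAt (by norm_num)
    have e1 : fderiv ℝ (fun x ↦ fderiv ℝ (fun x ↦ G x w z) x v) y u
        = fderiv ℝ (fderiv ℝ (fun x ↦ G x w z)) y u v := by
      simpa using (fderiv_lin_apply hG2 (a := fun _ ↦ v) (by simp) u).2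
    have dw := (fderiv_cov_const (Γ := Γ) hid hΓ (hc w) u v).1
    have dz := (fderiv_cov_const (Γ := Γ) hid hΓ (hc z) u v).1
    have hGy : DifferentiableAt ℝ G (id y) := hGd.self_of_nhds
    rw [← e1, (h1 v).fderiv_eq, fderiv_fun_add
      (fderiv_bilin_apply hGy differentiableAt_id dw (differentiableAt_const z) u).1
      (fderiv_bilin_apply hGy differentiableAt_id (differentiableAt_const w) dz u).1,
      add_apply,
      fderiv_inner_cov (F := id) h.self_of_nhds hGy hs differentiableAt_id dw
        (differentiableAt_const z) u,
      fderiv_inner_cov (F := id) h.self_of_nhds hGy hs differentiableAt_id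
        (differentiableAt_const w) dz u]
    rfl
  have h3 : fderiv ℝ (fderiv ℝ (fun x ↦ G x w z)) y u v
      = fderiv ℝ (fderiv ℝ (fun x ↦ G x w z)) y v u :=
    ((hG.clm_apply (hc w)).clm_apply contDiffAt_const).isSymmSndFDerivAt (by simp) u v
  rw [h2, h2] at h3
  have h4 : ∀ w : E, curv Γ y u v w = cov Γ id (fun x ↦ cov Γ id (fun _ ↦ w) x v) y u
      - cov Γ id (fun x ↦ cov Γ id (fun _ ↦ w) x u) y v := by
    intro w
    rw [cov_cov_sub (Γ := Γ) hid hΓ (hc w) u v]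
    simp
  rw [h4, h4, hs.self_of_nhds _ w]
  simp only [map_sub, sub_apply]
  linarith

/-- The first Bianchi identity. -/
lemma curv_bianchi {y : E} (hs : ∀ᶠ z in 𝓝 y, ∀ u v, Γ z u v = Γ z v u)
    (hΓ : DifferentiableAt ℝ Γ y) (u v w : E) :
    curv Γ y u v w + curv Γ y v w u + curv Γ y w u v = 0 := by
  have h1 : ∀ u v w, fderiv ℝ Γ y u v w = fderiv ℝ Γ y u w v := by
    intro u v w
    have h1 : ∀ v w, fderiv ℝ (fun z ↦ Γ z v w) y u = fderiv ℝ Γ y u v w := by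
      intro v w
      simpa using (fderiv_bilin_apply (B := Γ) (F := id) (a := fun _ ↦ v) (b := fun _ ↦ w) (y := y)
        hΓ differentiableAt_id (by simp) (by simp) u).2
    rw [← h1, ← h1]
    have : (fun z ↦ Γ z v w) =ᶠ[𝓝 y] fun z ↦ Γ z w v := hs.mono fun z hz ↦ hz v w
    rw [this.fderiv_eq]
  have hs0 := hs.self_of_nhds
  simp only [curv]
  rw [h1 u w v, h1 v u w, h1 w v u, hs0 v u, hs0 w u, hs0 w v]
  abel

lemma curv_antisymm (y u v w : E) : curv Γ y u v w = - curv Γ y v u w := by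
  simp only [curv]
  abel

lemma contDiffAt_fderiv {f : E' → E} {y : E'} (hf : ContDiffAt ℝ ∞ f y) :
    ContDiffAt ℝ ∞ (fderiv ℝ f) y := hf.fderiv_right (m := ∞) (by simp)

lemma fderiv_fderiv_symm {f : E' → E} {y : E'} (hf : ContDiffAt ℝ ∞ f y) (u v : E') :
    fderiv ℝ (fderiv ℝ f) y u v = fderiv ℝ (fderiv ℝ f) y v u := by
  refine (hf.of_le (m := 2) ?_).isSymmSndFDerivAt (by simp) u v
  exact WithTop.coe_le_coe.2 le_top

lemma contDiffAt_parallelAt (Γ' : E' → E' →L[ℝ] E' →L[ℝ] E') (y₀ v y : E') :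
    ContDiffAt ℝ ∞ (parallelAt Γ' y₀ v) y := by
  unfold parallelAt
  fun_prop

lemma fderiv_parallelAt (Γ' : E' → E' →L[ℝ] E' →L[ℝ] E') (y₀ v y u : E') :
    fderiv ℝ (parallelAt Γ' y₀ v) y u = - Γ' y₀ u v := by
  have h1 : HasFDerivAt (parallelAt Γ' y₀ v) (-((Γ' y₀).flip v)) y := by
    have h2 : HasFDerivAt (fun y : E' ↦ v - (Γ' y₀).flip v (y - y₀)) (-((Γ' y₀).flip v)) y := by
      have := (((Γ' y₀).flip v).hasFDerivAt (x := y - y₀)).comp y ((hasFDerivAt_id y).sub_const y₀)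
      simpa using! this.const_sub v
    exact h2
  rw [h1.fderiv]
  simp

@[simp] lemma parallelAt_self (Γ' : E' → E' →L[ℝ] E' →L[ℝ] E') (y₀ v : E') :
    parallelAt Γ' y₀ v y₀ = v := by simp [parallelAt]

/-- The Gauss formula in coordinates: the second fundamental form is, up to sign, the covariant
derivative of the image of a vector field that is parallel at `y`. -/
lemma cov_fderiv_parallelAt {y : E'} (hF : ContDiffAt ℝ ∞ F y) (u v : E') :
    cov Γ F (fun z ↦ fderiv ℝ F z (parallelAt Γ' y v z)) y u = - secondForm Γ Γ' F y u v := by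
  have h1 := fderiv_lin_apply ((contDiffAt_fderiv hF).differentiableAt (by simp))
    ((contDiffAt_parallelAt Γ' y v y).differentiableAt (by simp)) u
  simp only [cov, secondForm]
  rw [h1.2, fderiv_parallelAt]
  simp only [parallelAt_self, map_neg]
  abel

lemma contDiffAt_secondForm {y : E'} (hF : ContDiffAt ℝ ∞ F y) (hΓ : ContDiffAt ℝ ∞ Γ (F y))
    (hΓ' : ContDiffAt ℝ ∞ Γ' y) {a b : E' → E'} (ha : ContDiffAt ℝ ∞ a y)
    (hb : ContDiffAt ℝ ∞ b y) :
    ContDiffAt ℝ ∞ (fun z ↦ secondForm Γ Γ' F z (a z) (b z)) y := by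
  have h1 := contDiffAt_fderiv hF
  have h2 := contDiffAt_fderiv h1
  have h3 : ContDiffAt ℝ ∞ (fun z ↦ Γ (F z)) y := hΓ.comp y hF
  exact ((((h2.clm_apply ha).clm_apply hb).add
    ((h3.clm_apply (h1.clm_apply ha)).clm_apply (h1.clm_apply hb))).sub
    (h1.clm_apply ((hΓ'.clm_apply ha).clm_apply hb))).neg

lemma secondForm_symm {y : E'} (hF : ContDiffAt ℝ ∞ F y)
    (hΓ : ∀ u v, Γ (F y) u v = Γ (F y) v u) (hΓ' : ∀ u v, Γ' y u v = Γ' y v u) (u v : E') :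
    secondForm Γ Γ' F y u v = secondForm Γ Γ' F y v u := by
  simp only [secondForm]
  rw [fderiv_fderiv_symm hF u v, hΓ, hΓ']

/-- The Codazzi equation: up to a tangential term, the antisymmetrized covariant derivative of the
second fundamental form is the curvature of the ambient space. -/
lemma codazzi {y : E'} (hF : ContDiffAt ℝ ∞ F y) (hΓ : ContDiffAt ℝ ∞ Γ (F y))
    (hΓ' : ContDiffAt ℝ ∞ Γ' y)
    (hs' : ∀ u v, Γ' y u v = Γ' y v u) (u v w : E') :
    ∃ ζ : E',
      cov Γ F (fun z ↦ secondForm Γ Γ' F z (parallelAt Γ' y u z) (parallelAt Γ' y v z)) y w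
      - cov Γ F (fun z ↦ secondForm Γ Γ' F z (parallelAt Γ' y w z) (parallelAt Γ' y v z)) y u
      = - curv Γ (F y) (fderiv ℝ F y w) (fderiv ℝ F y u) (fderiv ℝ F y v) + fderiv ℝ F y ζ := by
  have h1 := contDiffAt_fderiv hF
  have h2 := contDiffAt_fderiv h1
  have d0 : DifferentiableAt ℝ F y := hF.differentiableAt (by simp)
  have d1 : DifferentiableAt ℝ (fderiv ℝ F) y := h1.differentiableAt (by simp)
  have d2 : DifferentiableAt ℝ (fderiv ℝ (fderiv ℝ F)) y := h2.differentiableAt (by simp)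
  have dΓ : DifferentiableAt ℝ Γ (F y) := hΓ.differentiableAt (by simp)
  have dΓ' : DifferentiableAt ℝ Γ' (id y) := hΓ'.differentiableAt (by simp)
  have dp : ∀ v, DifferentiableAt ℝ (parallelAt Γ' y v) y :=
    fun v ↦ (contDiffAt_parallelAt Γ' y v y).differentiableAt (by simp)
  have hp : ∀ v w, fderiv ℝ (parallelAt Γ' y v) y w = - Γ' y w v :=
    fun v w ↦ fderiv_parallelAt Γ' y v y w
  -- the derivative of the second fundamental form in the frame that is parallel at `y`
  have key : ∀ u v w : E', ∃ ζ : E',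
      fderiv ℝ (fun z ↦ secondForm Γ Γ' F z (parallelAt Γ' y u z) (parallelAt Γ' y v z)) y w
      = -((fderiv ℝ (fderiv ℝ (fderiv ℝ F)) y w u v - fderiv ℝ (fderiv ℝ F) y (Γ' y w u) v
            - fderiv ℝ (fderiv ℝ F) y u (Γ' y w v))
          + (fderiv ℝ Γ (F y) (fderiv ℝ F y w) (fderiv ℝ F y u) (fderiv ℝ F y v)
            + Γ (F y) (fderiv ℝ (fderiv ℝ F) y w u - fderiv ℝ F y (Γ' y w u)) (fderiv ℝ F y v)
            + Γ (F y) (fderiv ℝ F y u) (fderiv ℝ (fderiv ℝ F) y w v - fderiv ℝ F y (Γ' y w v)))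
          - (fderiv ℝ (fderiv ℝ F) y w (Γ' y u v) + fderiv ℝ F y ζ)) := by
    intro u v w
    have t1 := fderiv_bilin_apply (B := fderiv ℝ (fderiv ℝ F)) (F := id) (y := y) d2
      differentiableAt_id (dp u) (dp v) w
    have l : ∀ v, _ := fun v ↦ fderiv_lin_apply d1 (dp v) w
    have t2 := fderiv_bilin_apply (B := Γ) dΓ d0 (l u).1 (l v).1 w
    have t3 := fderiv_bilin_apply (B := Γ') (F := id) (y := y) dΓ'
      differentiableAt_id (dp u) (dp v) w
    have t4 := fderiv_lin_apply d1 t3.1 w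
    refine ⟨fderiv ℝ (fun z ↦ Γ' (id z) (parallelAt Γ' y u z) (parallelAt Γ' y v z)) y w, ?_⟩
    have e : (fun z ↦ secondForm Γ Γ' F z (parallelAt Γ' y u z) (parallelAt Γ' y v z))
        = fun z ↦ -((fderiv ℝ (fderiv ℝ F) (id z) (parallelAt Γ' y u z) (parallelAt Γ' y v z)
          + Γ (F z) (fderiv ℝ F z (parallelAt Γ' y u z)) (fderiv ℝ F z (parallelAt Γ' y v z)))
          - fderiv ℝ F z (Γ' (id z) (parallelAt Γ' y u z) (parallelAt Γ' y v z))) := rfl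
    rw [e, fderiv_fun_neg, fderiv_fun_sub (t1.1.fun_add t2.1) t4.1, fderiv_fun_add t1.1 t2.1,
      neg_apply,
      sub_apply, add_apply, t1.2, t2.2, t4.2, (l u).2, (l v).2]
    simp only [hp, parallelAt_self, fderiv_id, id_eq, ContinuousLinearMap.id_apply, map_neg,
      neg_apply, sub_eq_add_neg]
  obtain ⟨ζ₁, h₁⟩ := key u v w
  obtain ⟨ζ₂, h₂⟩ := key w v u
  refine ⟨ζ₁ - ζ₂, ?_⟩
  simp only [cov]
  rw [h₁, h₂]
  simp only [parallelAt_self, secondForm, curv]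
  rw [fderiv_fderiv_symm hF u w, hs' u w,
    fderiv_fderiv_symm h1 u w]
  simp only [map_sub, map_add, map_neg, sub_apply]
  abel

end Coordinates

/-! ### Tangent vectors and maps in charts -/

section Charts

open Filter Topology

variable {d : ℕ} {N : Type*} [TopologicalSpace N] [ChartedSpace (Coord d) N]
  [IsManifold (𝓡 d) ∞ N]

lemma coords_ofCoords {p q : N} (hq : q ∈ (chartAt (Coord d) p).source) (a : Coord d) :
    coords p q (ofCoords p q a) = a :=
  (trivializationAt (Coord d) (TangentSpace (𝓡 d) : N → Type _) p).continuousLinearMapAt_symmL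
    (by simpa using hq) a

lemma ofCoords_coords {p q : N} (hq : q ∈ (chartAt (Coord d) p).source)
    (w : TangentSpace (𝓡 d) q) : ofCoords p q (coords p q w) = w :=
  (trivializationAt (Coord d) (TangentSpace (𝓡 d) : N → Type _) p).symmL_continuousLinearMapAt
    (by simpa using hq) w

lemma coords_add (p q : N) (v w : TangentSpace (𝓡 d) q) :
    coords p q (v + w) = coords p q v + coords p q w := by
  unfold coords; exact map_add _ v w

lemma coords_smul (p q : N) (c : ℝ) (w : TangentSpace (𝓡 d) q) :
    coords p q (c • w) = c • coords p q w := by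
  unfold coords; exact map_smul _ c w

/-- The coordinates of a tangent vector as a linear map. -/
def coordsL (p q : N) : TangentSpace (𝓡 d) q →ₗ[ℝ] Coord d where
  toFun := coords p q
  map_add' := coords_add p q
  map_smul' := coords_smul p q

lemma coords_injective {p q : N} (hq : q ∈ (chartAt (Coord d) p).source)
    {v w : TangentSpace (𝓡 d) q} (h : coords p q v = coords p q w) : v = w := by
  rw [← ofCoords_coords hq v, h, ofCoords_coords hq]

lemma coords_sum (p q : N) {ι : Type*} (s : Finset ι) (w : ι → TangentSpace (𝓡 d) q) :
    coords p q (∑ i ∈ s, w i) = ∑ i ∈ s, coords p q (w i) := map_sum (coordsL p q) w s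

lemma coords_neg (p q : N) (w : TangentSpace (𝓡 d) q) :
    coords p q (-w) = -coords p q w := map_neg (coordsL p q) w

lemma coords_frame (p : N) (i : Fin d) : coords p p (frame p i) = EuclideanSpace.single i 1 :=
  coords_ofCoords (mem_chart_source _ p) _

lemma coords_eq_mvfderiv {p q : N} (hq : q ∈ (chartAt (Coord d) p).source)
    (w : TangentSpace (𝓡 d) q) :
    coords p q w = mvfderiv (𝓡 d) (extChartAt (𝓡 d) p) q w := by
  unfold coords
  rw [TangentBundle.continuousLinearMapAt_trivializationAt hq]
  rfl

lemma mem_source_iff {p q : N} :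
    q ∈ (extChartAt (𝓡 d) p).source ↔ q ∈ (chartAt (Coord d) p).source := by
  rw [extChartAt_source]

lemma extChartAt_target_mem_nhds' {p : N} {y : Coord d} (hy : y ∈ (extChartAt (𝓡 d) p).target) :
    (extChartAt (𝓡 d) p).target ∈ 𝓝 y := (isOpen_extChartAt_target p).mem_nhds hy

/-- The differential of a vector-valued function in a chart. -/
lemma mvfderiv_eq_fderiv {V : Type*} [NormedAddCommGroup V] [NormedSpace ℝ V] {p x : N}
    (hx : x ∈ (chartAt (Coord d) p).source) {f : N → V}
    (hf : DifferentiableAt ℝ (f ∘ (extChartAt (𝓡 d) p).symm) (extChartAt (𝓡 d) p x))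
    (u : TangentSpace (𝓡 d) x) :
    mvfderiv (𝓡 d) f x u
      = fderiv ℝ (f ∘ (extChartAt (𝓡 d) p).symm) (extChartAt (𝓡 d) p x) (coords p x u) := by
  have h1 : f =ᶠ[𝓝 x] (f ∘ (extChartAt (𝓡 d) p).symm) ∘ extChartAt (𝓡 d) p := by
    filter_upwards [(chartAt (Coord d) p).open_source.mem_nhds hx] with z hz
    simp only [Function.comp_apply]
    rw [(extChartAt (𝓡 d) p).left_inv (mem_source_iff.2 hz)]
  have h2 : HasMFDerivAt (𝓡 d) 𝓘(ℝ, Coord d) (extChartAt (𝓡 d) p) x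
      (mfderiv (𝓡 d) 𝓘(ℝ, Coord d) (extChartAt (𝓡 d) p) x) :=
    (mdifferentiableAt_extChartAt hx).hasMFDerivAt
  have h3 := (HasMFDerivAt.comp x hf.hasFDerivAt.hasMFDerivAt h2).congr_of_eventuallyEq h1
  have h4 : mvfderiv (𝓡 d) f x u = mfderiv (𝓡 d) 𝓘(ℝ, V) f x u := rfl
  rw [h4, h3.mfderiv, coords_eq_mvfderiv hx]
  rfl

section Map

variable {m n : ℕ}
  {S : Type*} [TopologicalSpace S] [ChartedSpace (Coord m) S] [IsManifold (𝓡 m) ∞ S]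
  {M : Type*} [TopologicalSpace M] [ChartedSpace (Coord n) M] [IsManifold (𝓡 n) ∞ M]

/-- A map between manifolds in the preferred charts at `p` and `q`. -/
def localMap (m n : ℕ) [ChartedSpace (Coord m) S] [ChartedSpace (Coord n) M] (φ : S → M)
    (p : S) (q : M) : Coord m → Coord n :=
  extChartAt (𝓡 n) q ∘ φ ∘ (extChartAt (𝓡 m) p).symm

/-- A vector field along `φ` in the preferred charts at `p` and `q`. -/
def localField (m : ℕ) [ChartedSpace (Coord m) S] (φ : S → M)
    (X : ∀ x : S, TangentSpace (𝓡 n) (φ x)) (p : S) (q : M) (y : Coord m) : Coord n :=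
  coords q (φ ((extChartAt (𝓡 m) p).symm y)) (X ((extChartAt (𝓡 m) p).symm y))

lemma contDiffAt_localMap {φ : S → M} {p x : S} {q : M}
    (hφ : ContMDiffAt (𝓡 m) (𝓡 n) ∞ φ x) (hx : x ∈ (chartAt (Coord m) p).source)
    (hq : φ x ∈ (chartAt (Coord n) q).source) :
    ContDiffAt ℝ ∞ (localMap m n φ p q) (extChartAt (𝓡 m) p x) := by
  have h1 := (contMDiffAt_iff_of_mem_source hx hq).1 hφ
  simpa using! h1.2

lemma contDiffAt_comp_symm {V : Type*} [NormedAddCommGroup V] [NormedSpace ℝ V] {p x : S}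
    {f : S → V} (hf : ContMDiffAt (𝓡 m) 𝓘(ℝ, V) ∞ f x) (hx : x ∈ (chartAt (Coord m) p).source) :
    ContDiffAt ℝ ∞ (f ∘ (extChartAt (𝓡 m) p).symm) (extChartAt (𝓡 m) p x) := by
  have h1 := (contMDiffAt_iff_of_mem_source hx (y := f x) (by simp)).1 hf
  simpa using! h1.2

lemma contMDiffAt_of_comp_symm {V : Type*} [NormedAddCommGroup V] [NormedSpace ℝ V] {p x : S}
    {f : S → V} (hx : x ∈ (chartAt (Coord m) p).source)
    (hf : ContDiffAt ℝ ∞ (f ∘ (extChartAt (𝓡 m) p).symm) (extChartAt (𝓡 m) p x)) :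
    ContMDiffAt (𝓡 m) 𝓘(ℝ, V) ∞ f x := by
  have h1 : f =ᶠ[𝓝 x] (f ∘ (extChartAt (𝓡 m) p).symm) ∘ extChartAt (𝓡 m) p := by
    filter_upwards [(chartAt (Coord m) p).open_source.mem_nhds hx] with z hz
    simp only [Function.comp_apply]
    rw [(extChartAt (𝓡 m) p).left_inv (mem_source_iff.2 hz)]
  refine ContMDiffAt.congr_of_eventuallyEq ?_ h1
  exact hf.contMDiffAt.comp x (contMDiffAt_extChartAt' hx)

lemma coords_mfderiv {φ : S → M} {p x : S} {q : M}
    (hφ : ContMDiffAt (𝓡 m) (𝓡 n) ∞ φ x) (hx : x ∈ (chartAt (Coord m) p).source)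
    (hq : φ x ∈ (chartAt (Coord n) q).source) (u : TangentSpace (𝓡 m) x) :
    coords q (φ x) (mfderiv (𝓡 m) (𝓡 n) φ x u)
      = fderiv ℝ (localMap m n φ p q) (extChartAt (𝓡 m) p x) (coords p x u) := by
  have h1 := mvfderiv_eq_fderiv (f := extChartAt (𝓡 n) q ∘ φ) hx
    ((contDiffAt_localMap hφ hx hq).differentiableAt (by simp)) u
  rw [coords_eq_mvfderiv hq]
  refine Eq.trans ?_ h1
  exact (mfderiv_comp_apply x (mdifferentiableAt_extChartAt hq)
    (hφ.mdifferentiableAt (by simp)) u).symm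

lemma coords_eq_trivialization {q z : M} (hz : z ∈ (chartAt (Coord n) q).source)
    (w : TangentSpace (𝓡 n) z) : coords q z w =
      (trivializationAt (Coord n) (TangentSpace (𝓡 n) : M → Type _) q ⟨z, w⟩).2 := by
  unfold coords
  exact Trivialization.continuousLinearMapAt_apply_of_mem ℝ
    (trivializationAt (Coord n) (TangentSpace (𝓡 n) : M → Type _) q) (by simpa using hz) w

/-- `X` is smooth at `x` as a section of the pullback of the tangent bundle. -/
def IsSmoothAlongAt (m : ℕ) [ChartedSpace (Coord m) S] (φ : S → M)
    (X : ∀ x : S, TangentSpace (𝓡 n) (φ x)) (x : S) : Prop :=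
  ContMDiffAt (𝓡 m) (𝓡 n).tangent ∞ (fun x ↦ (⟨φ x, X x⟩ : TangentBundle (𝓡 n) M)) x

lemma isSmoothAlongAt_iff {φ : S → M} {X : ∀ x : S, TangentSpace (𝓡 n) (φ x)} {p x : S} {q : M}
    (hφ : ContMDiffAt (𝓡 m) (𝓡 n) ∞ φ x) (hx : x ∈ (chartAt (Coord m) p).source)
    (hq : φ x ∈ (chartAt (Coord n) q).source) :
    IsSmoothAlongAt m φ X x ↔ ContDiffAt ℝ ∞ (localField m φ X p q) (extChartAt (𝓡 m) p x) := by
  have h1 := (trivializationAt (Coord n) (TangentSpace (𝓡 n) : M → Type _) q).contMDiffAt_iff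
    (IM := 𝓡 m) (IB := 𝓡 n) (n := ∞) (f := fun x ↦ (⟨φ x, X x⟩ : TangentBundle (𝓡 n) M)) (x₀ := x)
    (by rw [Trivialization.mem_source]; simpa using hq)
  have h2 : (fun x ↦ (trivializationAt (Coord n) (TangentSpace (𝓡 n) : M → Type _) q
      (⟨φ x, X x⟩ : TangentBundle (𝓡 n) M)).2) =ᶠ[𝓝 x] fun x ↦ coords q (φ x) (X x) := by
    filter_upwards [hφ.continuousAt.preimage_mem_nhds
      ((chartAt (Coord n) q).open_source.mem_nhds hq)] with z hz
    rw [coords_eq_trivialization hz]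
  have h3 : IsSmoothAlongAt m φ X x ↔
      ContMDiffAt (𝓡 m) 𝓘(ℝ, Coord n) ∞ (fun x ↦ coords q (φ x) (X x)) x := by
    unfold IsSmoothAlongAt
    rw [← h2.contMDiffAt_iff]
    exact h1.trans (and_iff_right hφ)
  rw [h3]
  exact ⟨fun h ↦ contDiffAt_comp_symm h hx, fun h ↦ contMDiffAt_of_comp_symm hx h⟩

end Map

/-! ### The metric and its connection in a chart -/

section LocalMetric

/-- The metric in the preferred chart at `p`, as a field of bilinear forms. -/
def metricLoc (g : SemiRiemannianMetric d N) (p : N) (y : Coord d) :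
    Coord d →L[ℝ] Coord d →L[ℝ] ℝ :=
  ∑ i, ∑ j, gramMatrix g p y i j •
    (EuclideanSpace.proj i : Coord d →L[ℝ] ℝ).smulRight (EuclideanSpace.proj j : Coord d →L[ℝ] ℝ)

/-- The connection form `(u, v) ↦ ∑ Γ^k_{ij} u^i v^j e_k` in the preferred chart at `p`. -/
def connLoc (g : SemiRiemannianMetric d N) (p : N) (y : Coord d) :
    Coord d →L[ℝ] Coord d →L[ℝ] Coord d :=
  ∑ k, ∑ i, ∑ j, christoffel g p k i j y •
    (EuclideanSpace.proj i : Coord d →L[ℝ] ℝ).smulRight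
      ((EuclideanSpace.proj j : Coord d →L[ℝ] ℝ).smulRight
        (EuclideanSpace.single k (1 : ℝ) : Coord d))

lemma sum_smul_single (a : Coord d) :
    ∑ i, a i • (EuclideanSpace.single i (1 : ℝ) : Coord d) = a := by
  ext j
  simp [Finset.sum_apply, Pi.single_apply]

lemma metricLoc_apply (g : SemiRiemannianMetric d N) (p : N) (y a b : Coord d) :
    metricLoc g p y a b = ∑ i, ∑ j, gramMatrix g p y i j * (a i * b j) := by
  simp [metricLoc]

lemma connLoc_apply (g : SemiRiemannianMetric d N) (p : N) (y a b : Coord d) :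
    connLoc g p y a b = ∑ k, (∑ i, ∑ j, christoffel g p k i j y * a i * b j) •
      (EuclideanSpace.single k (1 : ℝ) : Coord d) := by
  simp only [connLoc, sum_apply, smul_apply, ContinuousLinearMap.smulRight_apply, Finset.sum_smul,
    smul_smul]
  rfl

lemma ofCoords_sum {p q : N} (a : Coord d) :
    ofCoords p q a = ∑ i, a i • coordFrame p q i := by
  unfold coordFrame ofCoords
  conv_lhs => rw [← sum_smul_single a]
  rw [map_sum]
  simp_rw [map_smul]

lemma inner_smul_smul (g : SemiRiemannianMetric d N) (x : N) (a b : ℝ)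
    (u v : TangentSpace (𝓡 d) x) : g.inner x (a • u) (b • v) = a * b * g.inner x u v := by
  rw [map_smul, map_smul, smul_apply, smul_eq_mul, smul_eq_mul]
  ring

lemma metricLoc_eq (g : SemiRiemannianMetric d N) (p : N) (y a b : Coord d) :
    metricLoc g p y a b = g.inner ((extChartAt (𝓡 d) p).symm y)
      (ofCoords p _ a) (ofCoords p _ b) := by
  rw [metricLoc_apply, ofCoords_sum a, map_sum, sum_apply]
  refine Finset.sum_congr rfl fun i _ ↦ ?_
  rw [ofCoords_sum b, map_sum]
  refine Finset.sum_congr rfl fun j _ ↦ ?_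
  rw [inner_smul_smul]
  change g.inner _ _ _ * _ = _
  ring

lemma metricLoc_coords (g : SemiRiemannianMetric d N) {p x : N}
    (hx : x ∈ (chartAt (Coord d) p).source) (u v : TangentSpace (𝓡 d) x) :
    metricLoc g p (extChartAt (𝓡 d) p x) (coords p x u) (coords p x v) = g.inner x u v := by
  rw [metricLoc_eq]
  have h1 := (extChartAt (𝓡 d) p).left_inv (mem_source_iff.2 hx)
  have : ∀ z : N, z = x → g.inner z (ofCoords p z (coords p x u)) (ofCoords p z (coords p x v))
      = g.inner x u v := by
    rintro z rfl
    rw [ofCoords_coords hx, ofCoords_coords hx]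
  exact this _ h1

lemma mem_source_of_target {p : N} {y : Coord d} (hy : y ∈ (extChartAt (𝓡 d) p).target) :
    (extChartAt (𝓡 d) p).symm y ∈ (chartAt (Coord d) p).source :=
  mem_source_iff.1 ((extChartAt (𝓡 d) p).map_target hy)

lemma metricLoc_symm (g : SemiRiemannianMetric d N) (p : N) (y a b : Coord d) :
    metricLoc g p y a b = metricLoc g p y b a := by
  rw [metricLoc_eq, metricLoc_eq, g.symm]

lemma metricLoc_nondegenerate (g : SemiRiemannianMetric d N) {p : N} {y : Coord d}
    (hy : y ∈ (extChartAt (𝓡 d) p).target) (a : Coord d) (ha : ∀ b, metricLoc g p y a b = 0) :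
    a = 0 := by
  have h1 := mem_source_of_target hy
  have h2 : ofCoords p ((extChartAt (𝓡 d) p).symm y) a = 0 := by
    refine g.nondegenerate _ _ fun v ↦ ?_
    rw [← ofCoords_coords h1 v, ← metricLoc_eq]
    exact ha _
  have h3 := congrArg (coords p ((extChartAt (𝓡 d) p).symm y)) h2
  rw [coords_ofCoords h1] at h3
  rw [h3]
  exact map_zero (coordsL p _)

lemma contMDiffAt_inner (g : SemiRiemannianMetric d N) {m : ℕ} {S : Type*} [TopologicalSpace S]
    [ChartedSpace (Coord m) S] [IsManifold (𝓡 m) ∞ S] {φ : S → N}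
    {X Y : ∀ x : S, TangentSpace (𝓡 d) (φ x)} {x : S} (hφ : ContMDiffAt (𝓡 m) (𝓡 d) ∞ φ x)
    (hX : IsSmoothAlongAt m φ X x) (hY : IsSmoothAlongAt m φ Y x) :
    ContMDiffAt (𝓡 m) 𝓘(ℝ, ℝ) ∞ (fun z ↦ g.inner (φ z) (X z) (Y z)) x := by
  have h1 : ContMDiffAt (𝓡 m) ((𝓡 d).prod 𝓘(ℝ, Coord d →L[ℝ] Coord d →L[ℝ] ℝ)) ∞
      (fun z ↦ TotalSpace.mk' (Coord d →L[ℝ] Coord d →L[ℝ] ℝ)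
        (E := fun x : N ↦ (TangentSpace (𝓡 d) x →L[ℝ] TangentSpace (𝓡 d) x →L[ℝ] ℝ))
        (φ z) (g.inner (φ z))) x :=
    (g.contMDiff (φ x)).comp x hφ
  have h2 := ContMDiffAt.clm_bundle_apply₂ (F₁ := Coord d) (F₂ := Coord d) (F₃ := ℝ)
    (E₃ := Bundle.Trivial N ℝ) h1 hX hY
  have h3 := (contMDiffAt_totalSpace.1 h2).2
  simpa using! h3

lemma isSmoothAlongAt_id_ofCoords {p x : N} (hx : x ∈ (chartAt (Coord d) p).source)
    {a : Coord d → Coord d} (ha : ContDiffAt ℝ ∞ a (extChartAt (𝓡 d) p x)) :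
    IsSmoothAlongAt d (id : N → N) (fun z ↦ ofCoords p z (a (extChartAt (𝓡 d) p z))) x := by
  rw [isSmoothAlongAt_iff (p := p) (q := p) contMDiffAt_id hx hx]
  refine ha.congr_of_eventuallyEq ?_
  filter_upwards [extChartAt_target_mem_nhds' ((extChartAt (𝓡 d) p).map_source
    (mem_source_iff.2 hx))] with y hy
  have h1 := coords_ofCoords (mem_source_of_target hy)
    (a (extChartAt (𝓡 d) p ((extChartAt (𝓡 d) p).symm y)))
  rw [(extChartAt (𝓡 d) p).right_inv hy] at h1
  unfold localField
  refine Eq.trans ?_ h1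
  exact congrArg (fun b ↦ coords p ((extChartAt (𝓡 d) p).symm y)
    (ofCoords p ((extChartAt (𝓡 d) p).symm y) (a b))) ((extChartAt (𝓡 d) p).right_inv hy)

lemma contDiffAt_gramMatrix (g : SemiRiemannianMetric d N) {p : N} {y : Coord d}
    (hy : y ∈ (extChartAt (𝓡 d) p).target) (i j : Fin d) :
    ContDiffAt ℝ ∞ (fun z ↦ gramMatrix g p z i j) y := by
  have h1 := mem_source_of_target hy
  have h0 := (extChartAt (𝓡 d) p).right_inv hy
  have hs : ∀ i, IsSmoothAlongAt d (id : N → N) (fun z ↦ coordFrame p z i)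
      ((extChartAt (𝓡 d) p).symm y) := fun i ↦
    isSmoothAlongAt_id_ofCoords h1 (a := fun _ ↦ EuclideanSpace.single i 1) contDiffAt_const
  have h2 := contDiffAt_comp_symm (contMDiffAt_inner g contMDiffAt_id (hs i) (hs j)) h1
  rw [h0] at h2
  exact h2

lemma contDiffAt_smul_const {V W : Type*} [NormedAddCommGroup V] [NormedSpace ℝ V]
    [NormedAddCommGroup W] [NormedSpace ℝ W] {c : V → ℝ} {y : V} (hc : ContDiffAt ℝ ∞ c y) (w : W) :
    ContDiffAt ℝ ∞ (fun z ↦ c z • w) y :=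
  hc.smul contDiffAt_const

lemma contDiffAt_metricLoc (g : SemiRiemannianMetric d N) {p : N} {y : Coord d}
    (hy : y ∈ (extChartAt (𝓡 d) p).target) : ContDiffAt ℝ ∞ (metricLoc g p) y := by
  unfold metricLoc
  exact ContDiffAt.sum fun i _ ↦ ContDiffAt.sum fun j _ ↦
    contDiffAt_smul_const (contDiffAt_gramMatrix g hy i j) _

lemma det_gramMatrix_ne_zero (g : SemiRiemannianMetric d N) {p : N} {y : Coord d}
    (hy : y ∈ (extChartAt (𝓡 d) p).target) : (gramMatrix g p y).det ≠ 0 := by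
  intro h0
  obtain ⟨v, hv, hv0⟩ := Matrix.exists_vecMul_eq_zero_iff.2 h0
  apply hv
  have h1 := metricLoc_nondegenerate g hy (WithLp.toLp 2 v) fun b ↦ by
    rw [metricLoc_apply, Finset.sum_comm]
    refine Finset.sum_eq_zero fun j _ ↦ ?_
    have := congrFun hv0 j
    simp only [Matrix.vecMul, dotProduct, Pi.zero_apply] at this
    calc ∑ i, gramMatrix g p y i j * (v i * b j)
        = (∑ i, v i * gramMatrix g p y i j) * b j := by
          rw [Finset.sum_mul]; exact Finset.sum_congr rfl fun i _ ↦ by ring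
      _ = 0 := by rw [this, zero_mul]
  ext i
  simpa using congrArg (fun w : Coord d ↦ w i) h1

lemma contDiffAt_det {V : Type*} [NormedAddCommGroup V] [NormedSpace ℝ V] {k : ℕ}
    {A : V → Matrix (Fin k) (Fin k) ℝ} {y : V} (hA : ∀ i j, ContDiffAt ℝ ∞ (fun z ↦ A z i j) y) :
    ContDiffAt ℝ ∞ (fun z ↦ (A z).det) y := by
  simp_rw [Matrix.det_apply']
  exact ContDiffAt.sum fun σ _ ↦ contDiffAt_const.mul (contDiffAt_prod fun i _ ↦ hA _ _)

lemma contDiffAt_matrix_inv {V : Type*} [NormedAddCommGroup V] [NormedSpace ℝ V] {k : ℕ}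
    {A : V → Matrix (Fin k) (Fin k) ℝ} {y : V} (hA : ∀ i j, ContDiffAt ℝ ∞ (fun z ↦ A z i j) y)
    (hdet : (A y).det ≠ 0) (i j : Fin k) : ContDiffAt ℝ ∞ (fun z ↦ (A z)⁻¹ i j) y := by
  have h1 : (fun z ↦ (A z)⁻¹ i j)
      = fun z ↦ (A z).det⁻¹ * ((A z).updateRow j (Pi.single i 1)).det := by
    ext z
    rw [Matrix.inv_def, Ring.inverse_eq_inv', Matrix.smul_apply, Matrix.adjugate_apply, smul_eq_mul]
  rw [h1]
  refine ((contDiffAt_det hA).inv hdet).mul (contDiffAt_det fun a b ↦ ?_)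
  by_cases h : a = j
  · subst h
    simpa using contDiffAt_const
  · simpa [Matrix.updateRow_ne h] using hA a b

lemma contDiffAt_christoffel (g : SemiRiemannianMetric d N) {p : N} {y : Coord d}
    (hy : y ∈ (extChartAt (𝓡 d) p).target) (k i j : Fin d) :
    ContDiffAt ℝ ∞ (christoffel g p k i j) y := by
  have h1 : ∀ i j l, ContDiffAt ℝ ∞ (partialDeriv i fun z ↦ gramMatrix g p z j l) y :=
    fun i j l ↦ (contDiffAt_fderiv (contDiffAt_gramMatrix g hy j l)).clm_apply contDiffAt_const
  unfold christoffel
  exact contDiffAt_const.mul (ContDiffAt.sum fun l _ ↦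
    (contDiffAt_matrix_inv (contDiffAt_gramMatrix g hy) (det_gramMatrix_ne_zero g hy) k l).mul
      (((h1 i j l).add (h1 j i l)).sub (h1 l i j)))

lemma contDiffAt_connLoc (g : SemiRiemannianMetric d N) {p : N} {y : Coord d}
    (hy : y ∈ (extChartAt (𝓡 d) p).target) : ContDiffAt ℝ ∞ (connLoc g p) y := by
  unfold connLoc
  exact ContDiffAt.sum fun k _ ↦ ContDiffAt.sum fun i _ ↦ ContDiffAt.sum fun j _ ↦
    contDiffAt_smul_const (contDiffAt_christoffel g hy k i j) _

lemma fderiv_eq_sum_partialDeriv (f : Coord d → ℝ) (y u : Coord d) :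
    fderiv ℝ f y u = ∑ i, u i * partialDeriv i f y := by
  conv_lhs => rw [← sum_smul_single u]
  rw [map_sum]
  simp_rw [map_smul]
  rfl

lemma fderiv_metricLoc (g : SemiRiemannianMetric d N) {p : N} {y : Coord d}
    (hy : y ∈ (extChartAt (𝓡 d) p).target) (u v w : Coord d) :
    fderiv ℝ (metricLoc g p) y u v w
      = ∑ i, ∑ j, ∑ l, u i * v j * w l * partialDeriv i (fun z ↦ gramMatrix g p z j l) y := by
  have h1 : fderiv ℝ (fun z ↦ metricLoc g p z v w) y u = fderiv ℝ (metricLoc g p) y u v w := by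
    have := (fderiv_bilin_apply (B := metricLoc g p) (F := id) (a := fun _ ↦ v) (b := fun _ ↦ w)
      (y := y) ((contDiffAt_metricLoc g hy).differentiableAt (by simp))
      differentiableAt_id (by simp) (by simp) u).2
    simpa using this
  have hd : ∀ j l, DifferentiableAt ℝ (fun z ↦ gramMatrix g p z j l) y :=
    fun j l ↦ (contDiffAt_gramMatrix g hy j l).differentiableAt (by simp)
  rw [← h1, fderiv_eq_sum_partialDeriv]
  refine Finset.sum_congr rfl fun i _ ↦ ?_
  simp_rw [metricLoc_apply, partialDeriv]
  rw [fderiv_fun_sum (fun j _ ↦ DifferentiableAt.fun_sum fun l _ ↦ (hd j l).mul_const _), sum_apply,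
    Finset.mul_sum]
  refine Finset.sum_congr rfl fun j _ ↦ ?_
  rw [fderiv_fun_sum (fun l _ ↦ (hd j l).mul_const _), sum_apply, Finset.mul_sum]
  refine Finset.sum_congr rfl fun l _ ↦ ?_
  rw [fderiv_mul_const (hd j l)]
  simp only [smul_apply, smul_eq_mul]
  ring

lemma isLeviCivitaAt_connLoc (g : SemiRiemannianMetric d N) {p : N} {y : Coord d}
    (hy : y ∈ (extChartAt (𝓡 d) p).target) : IsLeviCivitaAt (metricLoc g p) (connLoc g p) y := by
  intro u v w
  have hsym : ∀ i j, gramMatrix g p y i j = gramMatrix g p y j i := fun i j ↦ g.symm _ _ _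
  have h1 : ∀ i j l', ∑ k, gramMatrix g p y k l' * christoffel g p k i j y
      = (1 / 2) * (partialDeriv i (fun z ↦ gramMatrix g p z j l') y
      + partialDeriv j (fun z ↦ gramMatrix g p z i l') y
      - partialDeriv l' (fun z ↦ gramMatrix g p z i j) y) := by
    intro i j l'
    unfold christoffel
    simp_rw [Finset.mul_sum]
    rw [Finset.sum_comm]
    have h2 : ∀ l, ∑ k, gramMatrix g p y k l' * (gramMatrix g p y)⁻¹ k l
        = if l = l' then 1 else 0 := by
      intro l
      have := congrFun (congrFun (Matrix.mul_nonsing_inv (gramMatrix g p y)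
        (isUnit_iff_ne_zero.2 (det_gramMatrix_ne_zero g hy))) l') l
      rw [Matrix.mul_apply, Matrix.one_apply] at this
      simp_rw [hsym _ l', this, eq_comm]
    calc _ = ∑ l, (∑ k, gramMatrix g p y k l' * (gramMatrix g p y)⁻¹ k l) *
          ((1 / 2) * (partialDeriv i (fun z ↦ gramMatrix g p z j l) y
            + partialDeriv j (fun z ↦ gramMatrix g p z i l) y
            - partialDeriv l (fun z ↦ gramMatrix g p z i j) y)) := by
          refine Finset.sum_congr rfl fun l _ ↦ ?_
          rw [Finset.sum_mul]
          exact Finset.sum_congr rfl fun k _ ↦ by ring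
      _ = _ := by simp [h2]
  have h3 : metricLoc g p y (connLoc g p y u v) w
      = ∑ i, ∑ j, ∑ l, u i * v j * w l * ∑ k, gramMatrix g p y k l * christoffel g p k i j y := by
    rw [metricLoc_apply]
    have hk : ∀ k, (connLoc g p y u v) k = ∑ i, ∑ j, christoffel g p k i j y * u i * v j := by
      intro k
      rw [connLoc_apply]
      simp [Finset.sum_apply, Pi.single_apply]
    simp_rw [hk, Finset.sum_mul, Finset.mul_sum]
    rw [sum_comm_pairs]
    refine Finset.sum_congr rfl fun i _ ↦ Finset.sum_congr rfl fun j _ ↦ ?_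
    rw [Finset.sum_comm]
    exact Finset.sum_congr rfl fun l _ ↦ Finset.sum_congr rfl fun k _ ↦ by ring
  rw [h3, fderiv_metricLoc g hy, fderiv_metricLoc g hy, fderiv_metricLoc g hy]
  have e2 : ∑ i, ∑ j, ∑ l, v i * u j * w l * partialDeriv i (fun z ↦ gramMatrix g p z j l) y
      = ∑ i, ∑ j, ∑ l, u i * v j * w l * partialDeriv j (fun z ↦ gramMatrix g p z i l) y := by
    rw [Finset.sum_comm]
    exact Finset.sum_congr rfl fun i _ ↦ Finset.sum_congr rfl fun j _ ↦
      Finset.sum_congr rfl fun l _ ↦ by ring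
  have e3 : ∑ i, ∑ j, ∑ l, w i * u j * v l * partialDeriv i (fun z ↦ gramMatrix g p z j l) y
      = ∑ i, ∑ j, ∑ l, u i * v j * w l * partialDeriv l (fun z ↦ gramMatrix g p z i j) y := by
    rw [Finset.sum_comm]
    refine Finset.sum_congr rfl fun i _ ↦ ?_
    rw [Finset.sum_comm]
    exact Finset.sum_congr rfl fun j _ ↦ Finset.sum_congr rfl fun l _ ↦ by ring
  rw [e2, e3]
  simp_rw [h1, ← Finset.sum_add_distrib, ← Finset.sum_sub_distrib, Finset.mul_sum]
  exact Finset.sum_congr rfl fun i _ ↦ Finset.sum_congr rfl fun j _ ↦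
      Finset.sum_congr rfl fun l _ ↦ by ring

end LocalMetric

end Charts

/-! ### Independence of the charts -/

section ChartChange

open Filter Topology

/-- Covariant derivatives are compatible with a change of coordinates `ψ` under which the connection
forms correspond. -/
lemma cov_comp {E E₀ E' : Type*} [NormedAddCommGroup E] [NormedSpace ℝ E]
    [NormedAddCommGroup E₀] [NormedSpace ℝ E₀] [NormedAddCommGroup E'] [NormedSpace ℝ E']
    {Γ : E → E →L[ℝ] E →L[ℝ] E} {Γ₀ : E₀ → E₀ →L[ℝ] E₀ →L[ℝ] E₀} {ψ : E → E₀}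
    {F X : E' → E} {F₀ X₀ : E' → E₀} {y : E'} (hψ : ContDiffAt ℝ ∞ ψ (F y))
    (hF : DifferentiableAt ℝ F y) (hX : DifferentiableAt ℝ X y)
    (hF₀ : F₀ =ᶠ[𝓝 y] fun z ↦ ψ (F z)) (hX₀ : X₀ =ᶠ[𝓝 y] fun z ↦ fderiv ℝ ψ (F z) (X z))
    (hΓ : ∀ a b, fderiv ℝ (fderiv ℝ ψ) (F y) a b
      + Γ₀ (ψ (F y)) (fderiv ℝ ψ (F y) a) (fderiv ℝ ψ (F y) b) = fderiv ℝ ψ (F y) (Γ (F y) a b))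
    (u : E') : cov Γ₀ F₀ X₀ y u = fderiv ℝ ψ (F y) (cov Γ F X y u) := by
  have hψ1 : DifferentiableAt ℝ ψ (F y) := hψ.differentiableAt (by simp)
  have hψ2 : DifferentiableAt ℝ (fderiv ℝ ψ) (F y) :=
    (contDiffAt_fderiv hψ).differentiableAt (by simp)
  have h1 : HasFDerivAt (fun z ↦ ψ (F z)) ((fderiv ℝ ψ (F y)).comp (fderiv ℝ F y)) y :=
    HasFDerivAt.comp (g := ψ) y hψ1.hasFDerivAt hF.hasFDerivAt
  have h2 : HasFDerivAt (fun z ↦ fderiv ℝ ψ (F z))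
      ((fderiv ℝ (fderiv ℝ ψ) (F y)).comp (fderiv ℝ F y)) y :=
    HasFDerivAt.comp (g := fderiv ℝ ψ) y hψ2.hasFDerivAt hF.hasFDerivAt
  have h3 := fderiv_lin_apply h2.differentiableAt hX u
  simp only [cov]
  rw [hF₀.fderiv_eq, hX₀.fderiv_eq, h3.2, h1.fderiv, h2.fderiv, hF₀.self_of_nhds,
    hX₀.self_of_nhds]
  simp only [ContinuousLinearMap.comp_apply, map_add]
  rw [← hΓ]
  abel

variable {m n : ℕ}
  {S : Type*} [TopologicalSpace S] [ChartedSpace (Coord m) S] [IsManifold (𝓡 m) ∞ S]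
  {M : Type*} [TopologicalSpace M] [ChartedSpace (Coord n) M] [IsManifold (𝓡 n) ∞ M]

/-- With the identity as the immersion, transformation laws under a change of charts are instances
of statements on immersions. -/
lemma isIsometricImmersion_id (g : SemiRiemannianMetric n M) :
    IsIsometricImmersion g g (id : M → M) where
  contMDiff := contMDiff_id
  injective x := by rw [mfderiv_id]; exact fun u v h ↦ h
  isometric x u v := by rw [mfderiv_id]; rfl

lemma localMap_apply {φ : S → M} {p x : S} {q : M} (hx : x ∈ (chartAt (Coord m) p).source) :
    localMap m n φ p q (extChartAt (𝓡 m) p x) = extChartAt (𝓡 n) q (φ x) := by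
  simp only [localMap, Function.comp_apply]
  rw [(extChartAt (𝓡 m) p).left_inv (mem_source_iff.2 hx)]

/-- The points of the chart at `p` that `φ` maps to the chart at `q`. -/
lemma eventually_mem_charts {φ : S → M} {p x : S} {q : M} (hφ : ContinuousAt φ x)
    (hx : x ∈ (chartAt (Coord m) p).source) (hq : φ x ∈ (chartAt (Coord n) q).source) :
    ∀ᶠ y in 𝓝 (extChartAt (𝓡 m) p x), y ∈ (extChartAt (𝓡 m) p).target ∧
      φ ((extChartAt (𝓡 m) p).symm y) ∈ (chartAt (Coord n) q).source := by
  have h1 : ContinuousAt (extChartAt (𝓡 m) p).symm (extChartAt (𝓡 m) p x) :=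
    continuousAt_extChartAt_symm' (mem_source_iff.2 hx)
  have h2 := (extChartAt (𝓡 m) p).left_inv (mem_source_iff.2 hx)
  have h4 : ∀ᶠ y in 𝓝 (extChartAt (𝓡 m) p x), y ∈ (extChartAt (𝓡 m) p).target :=
    extChartAt_target_mem_nhds' ((extChartAt (𝓡 m) p).map_source (mem_source_iff.2 hx))
  refine h4.and ?_
  have h3 : ContinuousAt (φ ∘ (extChartAt (𝓡 m) p).symm) (extChartAt (𝓡 m) p x) :=
    ContinuousAt.comp (by rwa [h2]) h1
  refine h3.preimage_mem_nhds ((chartAt (Coord n) q).open_source.mem_nhds ?_)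
  rw [Function.comp_apply, h2]
  exact hq

/-- The isometry condition in coordinates. -/
lemma metricLoc_pullback {h : SemiRiemannianMetric m S} {g : SemiRiemannianMetric n M} {φ : S → M}
    (hφ : IsIsometricImmersion h g φ) {p : S} {q : M} {y : Coord m}
    (hy : y ∈ (extChartAt (𝓡 m) p).target)
    (hq : φ ((extChartAt (𝓡 m) p).symm y) ∈ (chartAt (Coord n) q).source) (u v : Coord m) :
    metricLoc h p y u v = metricLoc g q (localMap m n φ p q y)
      (fderiv ℝ (localMap m n φ p q) y u) (fderiv ℝ (localMap m n φ p q) y v) := by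
  have h1 := mem_source_of_target hy
  have h2 := (extChartAt (𝓡 m) p).right_inv hy
  have h3 : ∀ u, coords q (φ ((extChartAt (𝓡 m) p).symm y)) (mfderiv (𝓡 m) (𝓡 n) φ
      ((extChartAt (𝓡 m) p).symm y) (ofCoords p _ u)) = fderiv ℝ (localMap m n φ p q) y u := by
    intro u
    rw [coords_mfderiv (hφ.contMDiff _) h1 hq, coords_ofCoords h1, h2]
  rw [metricLoc_eq, ← hφ.isometric, ← metricLoc_coords g hq, h3, h3]
  rfl

/-- Coordinates transform with the differential of the transition map. -/
lemma coords_transition {q q₀ z : M} (hq : z ∈ (chartAt (Coord n) q).source)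
    (hq₀ : z ∈ (chartAt (Coord n) q₀).source) (w : TangentSpace (𝓡 n) z) :
    coords q₀ z w
      = fderiv ℝ (localMap n n (id : M → M) q q₀) (extChartAt (𝓡 n) q z) (coords q z w) := by
  have h1 := coords_mfderiv (φ := (id : M → M)) contMDiffAt_id hq hq₀ w
  rw [← h1, mfderiv_id]
  rfl

/-- The transformation law of the Christoffel symbols. -/
lemma connLoc_transition (g : SemiRiemannianMetric n M) {q q₀ z : M}
    (hq : z ∈ (chartAt (Coord n) q).source) (hq₀ : z ∈ (chartAt (Coord n) q₀).source)
    (a b : Coord n) :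
    fderiv ℝ (fderiv ℝ (localMap n n (id : M → M) q q₀)) (extChartAt (𝓡 n) q z) a b
      + connLoc g q₀ (extChartAt (𝓡 n) q₀ z)
          (fderiv ℝ (localMap n n (id : M → M) q q₀) (extChartAt (𝓡 n) q z) a)
          (fderiv ℝ (localMap n n (id : M → M) q q₀) (extChartAt (𝓡 n) q z) b)
      = fderiv ℝ (localMap n n (id : M → M) q q₀) (extChartAt (𝓡 n) q z)
          (connLoc g q (extChartAt (𝓡 n) q z) a b) := by
  have ht := (extChartAt (𝓡 n) q).map_source (mem_source_iff.2 hq)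
  have ht₀ := (extChartAt (𝓡 n) q₀).map_source (mem_source_iff.2 hq₀)
  have e := localMap_apply (m := n) (n := n) (φ := (id : M → M)) (q := q₀) hq
  have hψ := contDiffAt_localMap (m := n) (n := n) (φ := (id : M → M)) contMDiffAt_id hq hq₀
  have key := inner_hessian_eq (G := metricLoc g q₀) (Γ := connLoc g q₀) (G' := metricLoc g q)
    (Γ' := connLoc g q) (F := localMap n n (id : M → M) q q₀) (y := extChartAt (𝓡 n) q z)
    (by rw [e]; exact isLeviCivitaAt_connLoc g ht₀) (isLeviCivitaAt_connLoc g ht)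
    (by rw [e]; exact (contDiffAt_metricLoc g ht₀).differentiableAt (by simp))
    (Eventually.of_forall fun z u v ↦ metricLoc_symm g _ _ _ _)
    (hψ.of_le (WithTop.coe_le_coe.2 le_top))
    ((contDiffAt_metricLoc g ht).differentiableAt (by simp))
    ((eventually_mem_charts (m := n) (n := n) continuousAt_id hq hq₀).mono fun y hy u v ↦
      metricLoc_pullback (isIsometricImmersion_id g) hy.1 hy.2 u v)
  rw [e] at key
  rw [← sub_eq_zero]
  refine metricLoc_nondegenerate g ht₀ _ fun w ↦ ?_
  obtain ⟨w, rfl⟩ : ∃ w', fderiv ℝ (localMap n n (id : M → M) q q₀) (extChartAt (𝓡 n) q z) w' = w :=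
    ⟨coords q z (ofCoords q₀ z w), by rw [← coords_transition hq hq₀, coords_ofCoords hq₀]⟩
  have h2 := metricLoc_pullback (isIsometricImmersion_id g) (q := q₀) ht
    (by rw [(extChartAt (𝓡 n) q).left_inv (mem_source_iff.2 hq)]; exact hq₀)
    (connLoc g q (extChartAt (𝓡 n) q z) a b) w
  have e' : localMap n n (id : M → M) q q₀ (extChartAt (𝓡 n) q z) = extChartAt (𝓡 n) q₀ z := e
  rw [e'] at h2
  rw [map_sub, sub_apply, sub_eq_zero]
  exact (key a b w).trans h2

/-- The covariant derivative along `φ` in arbitrary charts. -/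
lemma coords_covDerivAlong (g : SemiRiemannianMetric n M) {φ : S → M}
    {X : ∀ x : S, TangentSpace (𝓡 n) (φ x)} {p x : S} {q : M}
    (hφ : ContMDiffAt (𝓡 m) (𝓡 n) ∞ φ x) (hX : IsSmoothAlongAt m φ X x)
    (hx : x ∈ (chartAt (Coord m) p).source) (hq : φ x ∈ (chartAt (Coord n) q).source)
    (v : TangentSpace (𝓡 m) x) :
    coords q (φ x) (covDerivAlong g φ X x v) = cov (connLoc g q) (localMap m n φ p q)
      (localField m φ X p q) (extChartAt (𝓡 m) p x) (coords p x v) := by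
  -- the definition uses the chart at `φ x`
  have hq₀ : φ x ∈ (chartAt (Coord n) (φ x)).source := mem_chart_source _ _
  have hX₀ := ((isSmoothAlongAt_iff hφ hx hq₀).1 hX).differentiableAt (by simp)
  have hxx := (extChartAt (𝓡 m) p).left_inv (mem_source_iff.2 hx)
  have hval : ∀ q, localField m φ X p q (extChartAt (𝓡 m) p x) = coords q (φ x) (X x) := by
    intro q
    have : ∀ z, z = x → coords q (φ z) (X z) = coords q (φ x) (X x) := by rintro z rfl; rfl
    exact this _ hxx
  have hA : coords (φ x) (φ x) (covDerivAlong g φ X x v) = cov (connLoc g (φ x))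
      (localMap m n φ p (φ x)) (localField m φ X p (φ x)) (extChartAt (𝓡 m) p x) (coords p x v) := by
    unfold covDerivAlong
    rw [coords_sum]
    simp_rw [coords_smul, coords_frame]
    have hk : ∀ k, mvfderiv (𝓡 m) (fun x' ↦ coords (φ x) (φ x') (X x') k) x v
        = (fderiv ℝ (localField m φ X p (φ x)) (extChartAt (𝓡 m) p x) (coords p x v)) k := by
      intro k
      have hd : HasFDerivAt (fun y ↦ localField m φ X p (φ x) y k)
          ((EuclideanSpace.proj k : Coord n →L[ℝ] ℝ).comp
            (fderiv ℝ (localField m φ X p (φ x)) (extChartAt (𝓡 m) p x))) (extChartAt (𝓡 m) p x) :=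
        ((EuclideanSpace.proj k : Coord n →L[ℝ] ℝ).hasFDerivAt).comp _ hX₀.hasFDerivAt
      have e : (fun x' ↦ coords (φ x) (φ x') (X x') k) ∘ (extChartAt (𝓡 m) p).symm
        = fun y ↦ localField m φ X p (φ x) y k := rfl
      rw [mvfderiv_eq_fderiv hx (by rw [e]; exact hd.differentiableAt), e, hd.fderiv]
      rfl
    simp_rw [hk, coords_mfderiv hφ hx hq₀, add_smul, Finset.sum_add_distrib, sum_smul_single]
    rw [cov, localMap_apply hx, connLoc_apply, hval]
  have hψ := contDiffAt_localMap (m := n) (n := n) (φ := (id : M → M)) contMDiffAt_id hq hq₀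
  have eF := localMap_apply (m := m) (n := n) (φ := φ) (q := q) hx
  have hev := eventually_mem_charts (m := m) (n := n) hφ.continuousAt hx hq
  have hev₀ := eventually_mem_charts (m := m) (n := n) hφ.continuousAt hx hq₀
  have key := cov_comp (Γ := connLoc g q) (Γ₀ := connLoc g (φ x))
    (ψ := localMap n n (id : M → M) q (φ x)) (F := localMap m n φ p q)
    (X := localField m φ X p q) (F₀ := localMap m n φ p (φ x)) (X₀ := localField m φ X p (φ x))
    (y := extChartAt (𝓡 m) p x) (by rw [eF]; exact hψ)
    ((contDiffAt_localMap hφ hx hq).differentiableAt (by simp))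
    (((isSmoothAlongAt_iff hφ hx hq).1 hX).differentiableAt (by simp))
    (by
      filter_upwards [hev] with y hy
      simp only [localMap, Function.comp_apply, id]
      rw [(extChartAt (𝓡 n) q).left_inv (mem_source_iff.2 hy.2)])
    (by
      filter_upwards [hev, hev₀] with y hy hy₀
      exact coords_transition hy.2 hy₀.2 _)
    (fun a b ↦ by
      rw [eF, localMap_apply (m := n) (n := n) (φ := (id : M → M)) hq]
      exact connLoc_transition g hq hq₀ a b) (coords p x v)
  rw [← hA, coords_transition hq hq₀, eF] at key
  have hinj : ∀ a b, fderiv ℝ (localMap n n (id : M → M) q (φ x)) (extChartAt (𝓡 n) q (φ x)) a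
      = fderiv ℝ (localMap n n (id : M → M) q (φ x)) (extChartAt (𝓡 n) q (φ x)) b → a = b := by
    intro a b hab
    rw [← coords_ofCoords hq a, ← coords_ofCoords hq b, ← coords_transition hq hq₀,
      ← coords_transition hq hq₀] at hab
    rw [← coords_ofCoords hq a, ← coords_ofCoords hq b, coords_injective hq₀ hab]
  exact hinj _ _ key

end ChartChange

/-! ### Tangential and normal parts, frames -/

section Frames

open Filter Topology

variable {m n : ℕ}
  {S : Type*} [TopologicalSpace S] [ChartedSpace (Coord m) S] [IsManifold (𝓡 m) ∞ S]
  {M : Type*} [TopologicalSpace M] [ChartedSpace (Coord n) M] [IsManifold (𝓡 n) ∞ M]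

/-- The Gram matrix of a family of tangent vectors. -/
def gram (h : SemiRiemannianMetric m S) (x : S) (e : Fin m → TangentSpace (𝓡 m) x) :
    Matrix (Fin m) (Fin m) ℝ := Matrix.of fun i j ↦ h.inner x (e i) (e j)

lemma gram_frame (h : SemiRiemannianMetric m S) (x : S) :
    gram h x (frame x) = gramMatrix h x (extChartAt (𝓡 m) x x) := by
  have h1 := (extChartAt (𝓡 m) x).left_inv (mem_extChartAt_source (I := 𝓡 m) x)
  have : ∀ z : S, z = x → (Matrix.of fun i j ↦ h.inner x (frame x i) (frame x j))
      = Matrix.of fun i j ↦ h.inner z (coordFrame x z i) (coordFrame x z j) := by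
    rintro z rfl; rfl
  exact this _ h1

lemma det_gram_frame (h : SemiRiemannianMetric m S) (x : S) : (gram h x (frame x)).det ≠ 0 := by
  rw [gram_frame]
  exact det_gramMatrix_ne_zero h ((extChartAt (𝓡 m) x).map_source (mem_extChartAt_source x))

lemma sum_coords_frame (x : S) (u : TangentSpace (𝓡 m) x) :
    ∑ i, coords x x u i • frame x i = u := by
  refine coords_injective (mem_chart_source (Coord m) x) ?_
  rw [coords_sum]
  simp_rw [coords_smul, coords_frame, sum_smul_single]

lemma inner_sum_left (g : SemiRiemannianMetric m S) (x : S) {ι : Type*} (s : Finset ι)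
    (w : ι → TangentSpace (𝓡 m) x) (v : TangentSpace (𝓡 m) x) :
    g.inner x (∑ i ∈ s, w i) v = ∑ i ∈ s, g.inner x (w i) v := by
  rw [map_sum, sum_apply]

lemma inner_sum_right (g : SemiRiemannianMetric m S) (x : S) {ι : Type*} (s : Finset ι)
    (w : ι → TangentSpace (𝓡 m) x) (v : TangentSpace (𝓡 m) x) :
    g.inner x v (∑ i ∈ s, w i) = ∑ i ∈ s, g.inner x v (w i) := by
  rw [map_sum]

lemma inner_smul_left (g : SemiRiemannianMetric m S) (x : S) (a : ℝ)
    (u v : TangentSpace (𝓡 m) x) : g.inner x (a • u) v = a * g.inner x u v := by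
  rw [map_smul, smul_apply, smul_eq_mul]

lemma inner_smul_right (g : SemiRiemannianMetric m S) (x : S) (a : ℝ)
    (u v : TangentSpace (𝓡 m) x) : g.inner x u (a • v) = a * g.inner x u v := by
  rw [map_smul, smul_eq_mul]

lemma inner_add_left (g : SemiRiemannianMetric m S) (x : S)
    (u v w : TangentSpace (𝓡 m) x) : g.inner x (u + v) w = g.inner x u w + g.inner x v w := by
  rw [map_add, add_apply]

lemma inner_sub_left (g : SemiRiemannianMetric m S) (x : S)
    (u v w : TangentSpace (𝓡 m) x) : g.inner x (u - v) w = g.inner x u w - g.inner x v w := by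
  rw [map_sub, sub_apply]

lemma inner_neg_left (g : SemiRiemannianMetric m S) (x : S)
    (u v : TangentSpace (𝓡 m) x) : g.inner x (-u) v = - g.inner x u v := by
  rw [map_neg, neg_apply]

/-- The defining property of `sharp`. -/
lemma inner_sharp (h : SemiRiemannianMetric m S) (x : S) (l : TangentSpace (𝓡 m) x →ₗ[ℝ] ℝ)
    (v : TangentSpace (𝓡 m) x) : h.inner x (sharp h x l) v = l v := by
  have hframe : ∀ k, h.inner x (sharp h x l) (frame x k) = l (frame x k) := by
    intro k
    unfold sharp
    simp_rw [inner_sum_left, inner_smul_left]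
    rw [Finset.sum_comm]
    have h2 : ∀ j, ∑ i, inverseMetric h x i j * h.inner x (frame x i) (frame x k)
        = if k = j then 1 else 0 := by
      intro j
      have := congrFun (congrFun (Matrix.mul_nonsing_inv (gram h x (frame x))
        (isUnit_iff_ne_zero.2 (det_gram_frame h x))) k) j
      rw [Matrix.mul_apply, Matrix.one_apply] at this
      rw [← this]
      refine Finset.sum_congr rfl fun i _ ↦ ?_
      rw [h.symm, mul_comm]
      rfl
    calc _ = ∑ j, (∑ i, inverseMetric h x i j * h.inner x (frame x i) (frame x k))
          * l (frame x j) := by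
          refine Finset.sum_congr rfl fun j _ ↦ ?_
          rw [Finset.sum_mul]
          exact Finset.sum_congr rfl fun i _ ↦ by ring
      _ = _ := by simp [h2]
  rw [← sum_coords_frame x v, inner_sum_right, map_sum]
  simp_rw [inner_smul_right, hframe, map_smul, smul_eq_mul]

lemma eq_of_inner_eq (h : SemiRiemannianMetric m S) (x : S) {u v : TangentSpace (𝓡 m) x}
    (huv : ∀ w, h.inner x u w = h.inner x v w) : u = v := by
  rw [← sub_eq_zero]
  refine h.nondegenerate x _ fun w ↦ ?_
  rw [inner_sub_left, huv, sub_self]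

/-- The linear form `v ↦ w · dφ(v)`. -/
def innerDifferential (g : SemiRiemannianMetric n M) (φ : S → M) (x : S)
    (w : TangentSpace (𝓡 n) (φ x)) : TangentSpace (𝓡 m) x →ₗ[ℝ] ℝ :=
  ((g.inner (φ x) w).comp (mfderiv (𝓡 m) (𝓡 n) φ x)).toLinearMap

lemma inner_tangentialPart (h : SemiRiemannianMetric m S) (g : SemiRiemannianMetric n M)
    (φ : S → M) (x : S) (w : TangentSpace (𝓡 n) (φ x)) (v : TangentSpace (𝓡 m) x) :
    h.inner x (tangentialPart h g φ x w) v
      = g.inner (φ x) w (mfderiv (𝓡 m) (𝓡 n) φ x v) :=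
  inner_sharp h x (innerDifferential g φ x w) v

/-- A sum of a normal vector and a tangent vector has the expected normal part. -/
lemma normalPart_add {h : SemiRiemannianMetric m S} {g : SemiRiemannianMetric n M} {φ : S → M}
    (hφ : IsIsometricImmersion h g φ) {x : S} {w : TangentSpace (𝓡 n) (φ x)}
    (hw : ∀ v, g.inner (φ x) w (mfderiv (𝓡 m) (𝓡 n) φ x v) = 0) (t : TangentSpace (𝓡 m) x) :
    normalPart h g φ x (w + mfderiv (𝓡 m) (𝓡 n) φ x t) = w := by
  have h1 : tangentialPart h g φ x (w + mfderiv (𝓡 m) (𝓡 n) φ x t) = t := by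
    refine eq_of_inner_eq h x fun v ↦ ?_
    rw [inner_tangentialPart, inner_add_left, hw, hφ.isometric, zero_add]
  unfold normalPart
  rw [h1, add_sub_cancel_right]

lemma localField_apply {φ : S → M} {X : ∀ x : S, TangentSpace (𝓡 n) (φ x)} {p x : S} {q : M}
    (hx : x ∈ (chartAt (Coord m) p).source) :
    localField m φ X p q (extChartAt (𝓡 m) p x) = coords q (φ x) (X x) := by
  have hxx := (extChartAt (𝓡 m) p).left_inv (mem_source_iff.2 hx)
  have : ∀ z, z = x → coords q (φ z) (X z) = coords q (φ x) (X x) := by rintro z rfl; rfl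
  exact this _ hxx

lemma localField_mfderiv {φ : S → M} (hφ : ContMDiff (𝓡 m) (𝓡 n) ∞ φ) {p : S} {q : M}
    (Y : ∀ x : S, TangentSpace (𝓡 m) x) {y : Coord m} (hy : y ∈ (extChartAt (𝓡 m) p).target)
    (hq : φ ((extChartAt (𝓡 m) p).symm y) ∈ (chartAt (Coord n) q).source) :
    localField m φ (fun x ↦ mfderiv (𝓡 m) (𝓡 n) φ x (Y x)) p q y
      = fderiv ℝ (localMap m n φ p q) y (localField m (id : S → S) Y p p y) := by
  unfold localField
  rw [coords_mfderiv (hφ _) (mem_source_of_target hy) hq, (extChartAt (𝓡 m) p).right_inv hy]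
  rfl

/-- The Gauss formula: `secondForm` in coordinates is normal. -/
lemma inner_secondForm {h : SemiRiemannianMetric m S} {g : SemiRiemannianMetric n M} {φ : S → M}
    (hφ : IsIsometricImmersion h g φ) {p : S} {q : M} {y : Coord m}
    (hy : y ∈ (extChartAt (𝓡 m) p).target)
    (hq : φ ((extChartAt (𝓡 m) p).symm y) ∈ (chartAt (Coord n) q).source) (u v w : Coord m) :
    metricLoc g q (localMap m n φ p q y)
      (secondForm (connLoc g q) (connLoc h p) (localMap m n φ p q) y u v)
      (fderiv ℝ (localMap m n φ p q) y w) = 0 := by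
  have hx := mem_source_of_target hy
  have hy' := (extChartAt (𝓡 m) p).right_inv hy
  have ht : localMap m n φ p q y ∈ (extChartAt (𝓡 n) q).target :=
    (extChartAt (𝓡 n) q).map_source (mem_source_iff.2 hq)
  have hF := contDiffAt_localMap (hφ.contMDiff _) hx hq
  have hev := eventually_mem_charts (m := m) (n := n) (hφ.contMDiff _).continuousAt hx hq
  rw [hy'] at hF hev
  have key := inner_hessian_eq (G := metricLoc g q) (Γ := connLoc g q) (G' := metricLoc h p)
    (Γ' := connLoc h p) (F := localMap m n φ p q) (y := y)
    (isLeviCivitaAt_connLoc g ht) (isLeviCivitaAt_connLoc h hy)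
    ((contDiffAt_metricLoc g ht).differentiableAt (by simp))
    (Eventually.of_forall fun z u v ↦ metricLoc_symm g _ _ _ _)
    (hF.of_le (WithTop.coe_le_coe.2 le_top))
    ((contDiffAt_metricLoc h hy).differentiableAt (by simp))
    (hev.mono fun y hy u v ↦ metricLoc_pullback hφ hy.1 hy.2 u v) u v w
  rw [metricLoc_pullback hφ hy hq] at key
  simp only [secondForm]
  rw [map_neg, neg_apply, map_sub, sub_apply, key, sub_self, neg_zero]

/-- The second fundamental form in arbitrary charts. -/
lemma coords_secondFundamentalForm {h : SemiRiemannianMetric m S} {g : SemiRiemannianMetric n M}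
    {φ : S → M} (hφ : IsIsometricImmersion h g φ) {p x : S} {q : M}
    (hx : x ∈ (chartAt (Coord m) p).source) (hq : φ x ∈ (chartAt (Coord n) q).source)
    (u v : TangentSpace (𝓡 m) x) :
    coords q (φ x) (secondFundamentalForm h g φ x u v)
      = secondForm (connLoc g q) (connLoc h p) (localMap m n φ p q) (extChartAt (𝓡 m) p x)
        (coords p x u) (coords p x v) := by
  have hφx := hφ.contMDiff x
  have hxx := (extChartAt (𝓡 m) p).left_inv (mem_source_iff.2 hx)
  have ht := (extChartAt (𝓡 m) p).map_source (mem_source_iff.2 hx)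
  have hq' : φ ((extChartAt (𝓡 m) p).symm (extChartAt (𝓡 m) p x)) ∈ (chartAt (Coord n) q).source := by
    rwa [hxx]
  have hev := eventually_mem_charts (m := m) (n := n) hφx.continuousAt hx hq
  have hF := contDiffAt_localMap hφx hx hq
  -- the extension of `v` to a vector field that the definition uses
  have hV : IsSmoothAlongAt m (id : S → S) (fun x' ↦ ofCoords x x' (coords x x v)) x :=
    isSmoothAlongAt_id_ofCoords (mem_chart_source _ x) (a := fun _ ↦ coords x x v) contDiffAt_const
  have hb := (isSmoothAlongAt_iff contMDiffAt_id hx hx).1 hV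
  have hbv : localField m (id : S → S) (fun x' ↦ ofCoords x x' (coords x x v)) p p
      (extChartAt (𝓡 m) p x) = coords p x v := by
    rw [localField_apply hx, ofCoords_coords (mem_chart_source _ x)]
    rfl
  have hX := hev.mono fun y hy ↦ localField_mfderiv hφ.contMDiff
    (fun x' ↦ ofCoords x x' (coords x x v)) hy.1 hy.2
  have hsm : IsSmoothAlongAt m φ
      (fun x' ↦ mfderiv (𝓡 m) (𝓡 n) φ x' (ofCoords x x' (coords x x v))) x := by
    rw [isSmoothAlongAt_iff hφx hx hq]
    exact ((contDiffAt_fderiv hF).clm_apply hb).congr_of_eventuallyEq hX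
  have h1 := coords_covDerivAlong g hφx hsm hx hq u
  have h2 := fderiv_lin_apply ((contDiffAt_fderiv hF).differentiableAt (by simp))
    (hb.differentiableAt (by simp)) (coords p x u)
  have hXe : localField m φ (fun x' ↦ mfderiv (𝓡 m) (𝓡 n) φ x' (ofCoords x x' (coords x x v))) p q
      =ᶠ[𝓝 (extChartAt (𝓡 m) p x)] _ := hX
  rw [cov, hXe.fderiv_eq, hX.self_of_nhds, h2.2, hbv] at h1
  set b' := fderiv ℝ (localField m (id : S → S) (fun x' ↦ ofCoords x x' (coords x x v)) p p)
    (extChartAt (𝓡 m) p x) (coords p x u) with hb'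
  -- the normal vector with the coordinates on the right-hand side
  set N : Coord n := secondForm (connLoc g q) (connLoc h p) (localMap m n φ p q)
    (extChartAt (𝓡 m) p x) (coords p x u) (coords p x v) with hN
  have h3 : covDerivAlong g φ
      (fun x' ↦ mfderiv (𝓡 m) (𝓡 n) φ x' (ofCoords x x' (coords x x v))) x u
      = ofCoords q (φ x) (-N) + mfderiv (𝓡 m) (𝓡 n) φ x (ofCoords p x
        (b' + connLoc h p (extChartAt (𝓡 m) p x) (coords p x u) (coords p x v))) := by
    refine coords_injective hq ?_
    rw [h1, coords_add, coords_ofCoords hq, coords_mfderiv hφx hx hq, coords_ofCoords hx, hN]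
    simp only [secondForm, map_add]
    abel
  unfold secondFundamentalForm
  rw [h3, normalPart_add hφ, coords_neg, coords_ofCoords hq, neg_neg]
  intro w
  rw [← metricLoc_coords g hq, coords_ofCoords hq, coords_mfderiv hφx hx hq, map_neg, neg_apply,
    ← localMap_apply hx, inner_secondForm hφ ht hq', neg_zero]

end Frames

/-! ### Curvature contractions and their independence of the frame -/

section FrameContract

variable {m n : ℕ}
  {S : Type*} [TopologicalSpace S] [ChartedSpace (Coord m) S] [IsManifold (𝓡 m) ∞ S]
  {M : Type*} [TopologicalSpace M] [ChartedSpace (Coord n) M] [IsManifold (𝓡 n) ∞ M]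

/-- The second fundamental form as a bilinear map. -/
def secondFormL {h : SemiRiemannianMetric m S} {g : SemiRiemannianMetric n M} {φ : S → M}
    (hφ : IsIsometricImmersion h g φ) (x : S) :
    TangentSpace (𝓡 m) x →ₗ[ℝ] TangentSpace (𝓡 m) x →ₗ[ℝ] TangentSpace (𝓡 n) (φ x) :=
  LinearMap.mk₂ ℝ (secondFundamentalForm h g φ x)
    (fun u u' v ↦ by
      refine coords_injective (mem_chart_source (Coord n) (φ x)) ?_
      simp only [coords_add, coords_secondFundamentalForm hφ (mem_chart_source (Coord m) x)
        (mem_chart_source (Coord n) (φ x)), secondForm, map_add, add_apply]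
      abel)
    (fun c u v ↦ by
      refine coords_injective (mem_chart_source (Coord n) (φ x)) ?_
      simp only [coords_smul, coords_secondFundamentalForm hφ (mem_chart_source (Coord m) x)
        (mem_chart_source (Coord n) (φ x)), secondForm, map_smul, smul_apply]
      module)
    (fun u v v' ↦ by
      refine coords_injective (mem_chart_source (Coord n) (φ x)) ?_
      simp only [coords_add, coords_secondFundamentalForm hφ (mem_chart_source (Coord m) x)
        (mem_chart_source (Coord n) (φ x)), secondForm, map_add]
      abel)
    (fun c u v ↦ by
      refine coords_injective (mem_chart_source (Coord n) (φ x)) ?_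
      simp only [coords_smul, coords_secondFundamentalForm hφ (mem_chart_source (Coord m) x)
        (mem_chart_source (Coord n) (φ x)), secondForm, map_smul]
      module)

lemma bilinear_sum_sum {V W : Type*} [AddCommGroup V] [Module ℝ V] [AddCommGroup W] [Module ℝ W]
    (B : V →ₗ[ℝ] V →ₗ[ℝ] W) (e : Fin m → V) (a b : Fin m → ℝ) :
    B (∑ s, a s • e s) (∑ t, b t • e t) = ∑ s, ∑ t, (a s * b t) • B (e s) (e t) := by
  simp only [map_sum, map_smul, LinearMap.sum_apply, LinearMap.smul_apply, Finset.smul_sum,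
    smul_smul]
  rw [Finset.sum_comm]
  exact Finset.sum_congr rfl fun s _ ↦ Finset.sum_congr rfl fun t _ ↦ by rw [mul_comm]

/-- The contraction `∑ ε^{i i₁ … i_k}_{j j₁ … j_k} C_i^j μ(A_{i₁}^{j₁}, …, A_{i_k}^{j_k})` for a
bilinear form `C` and a multilinear form `μ` on normal vectors, written in the frame `e`. -/
def frameContract (h : SemiRiemannianMetric m S) (g : SemiRiemannianMetric n M) (φ : S → M) (x : S)
    {k : ℕ} (μ : MultilinearMap ℝ (fun _ : Fin k ↦ TangentSpace (𝓡 n) (φ x)) ℝ)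
    (C : TangentSpace (𝓡 m) x → TangentSpace (𝓡 m) x → ℝ) (e : Fin m → TangentSpace (𝓡 m) x) : ℝ :=
  contract (gram h x e)⁻¹ (consTensor (fun i l ↦ C (e i) (e l))
    (fun I L ↦ μ fun a ↦ secondFundamentalForm h g φ x (e (I a)) (e (L a))))

lemma gram_eq_mul (h : SemiRiemannianMetric m S) (x : S) {e e' : Fin m → TangentSpace (𝓡 m) x}
    {P : Matrix (Fin m) (Fin m) ℝ} (he : ∀ i, e' i = ∑ s, P i s • e s) :
    gram h x e' = P * gram h x e * Pᵀ := by
  ext i j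
  simp only [gram, Matrix.of_apply, Matrix.mul_apply, Matrix.transpose_apply, he, inner_sum_left,
    inner_sum_right, inner_smul_left, inner_smul_right, Finset.sum_mul, Finset.mul_sum]
  exact Finset.sum_congr rfl fun s _ ↦ Finset.sum_congr rfl fun t _ ↦ by ring

/-- The transformation law of the inverse of the Gram matrix; in particular a family that spans
has a nonsingular Gram matrix. -/
lemma gram_inv_eq (h : SemiRiemannianMetric m S) (x : S) {e : Fin m → TangentSpace (𝓡 m) x}
    {P : Matrix (Fin m) (Fin m) ℝ} (he : ∀ i, frame x i = ∑ s, P i s • e s) :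
    Pᵀ * (gram h x (frame x))⁻¹ * P = (gram h x e)⁻¹ ∧ (gram h x e).det ≠ 0 := by
  have h1 := gram_eq_mul h x he
  have h2 := det_gram_frame h x
  rw [h1, Matrix.det_mul, Matrix.det_mul, Matrix.det_transpose] at h2
  have hP : P.det ≠ 0 := fun h0 ↦ h2 (by rw [h0, mul_zero])
  have hPu : IsUnit P.det := isUnit_iff_ne_zero.2 hP
  have hPt : IsUnit Pᵀ.det := by rwa [Matrix.det_transpose]
  refine ⟨?_, fun h0 ↦ h2 (by rw [h0]; ring)⟩
  rw [h1, Matrix.mul_inv_rev, Matrix.mul_inv_rev]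
  rw [← Matrix.mul_assoc, Matrix.mul_nonsing_inv _ hPt, Matrix.one_mul, Matrix.mul_assoc,
    Matrix.nonsing_inv_mul _ hPu, Matrix.mul_one]

/-- The contraction does not depend on the frame. -/
lemma frameContract_eq {h : SemiRiemannianMetric m S} {g : SemiRiemannianMetric n M} {φ : S → M}
    (hφ : IsIsometricImmersion h g φ) (x : S)
    {k : ℕ} (μ : MultilinearMap ℝ (fun _ : Fin k ↦ TangentSpace (𝓡 n) (φ x)) ℝ)
    (C : TangentSpace (𝓡 m) x →ₗ[ℝ] TangentSpace (𝓡 m) x →ₗ[ℝ] ℝ)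
    {e : Fin m → TangentSpace (𝓡 m) x}
    {P : Matrix (Fin m) (Fin m) ℝ} (he : ∀ i, frame x i = ∑ s, P i s • e s) :
    frameContract h g φ x μ (fun u v ↦ C u v) (frame x)
      = frameContract h g φ x μ (fun u v ↦ C u v) e := by
  have hA : ∀ i l, secondFundamentalForm h g φ x (frame x i) (frame x l)
      = ∑ s, ∑ t, (P i s * P l t) • secondFundamentalForm h g φ x (e s) (e t) := by
    intro i l
    have := bilinear_sum_sum (secondFormL hφ x) e (P i) (P l)
    rw [← he, ← he] at this
    exact this
  have hC : ∀ i l, C (frame x i) (frame x l) = ∑ s, ∑ t, P i s * P l t * C (e s) (e t) := by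
    intro i l
    have := bilinear_sum_sum C e (P i) (P l)
    rw [← he, ← he] at this
    exact this
  unfold frameContract
  simp_rw [hA, hC]
  rw [multilinear_transform μ P P fun s t ↦ secondFundamentalForm h g φ x (e s) (e t),
    transform_consTensor, contract_transform, (gram_inv_eq h x he).1]

/-- The array of mixed components arises by raising the second group of indices. -/
lemma multilinear_mixedA (h : SemiRiemannianMetric m S) (g : SemiRiemannianMetric n M)
    (φ : S → M) (x : S) {k : ℕ}
    (μ : MultilinearMap ℝ (fun _ : Fin k ↦ TangentSpace (𝓡 n) (φ x)) ℝ) :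
    (fun I J : Fin k → Fin m ↦ μ fun a ↦ mixedA h g φ x (I a) (J a))
      = transform 1 (inverseMetric h x) (fun I L ↦ μ fun a ↦
          secondFundamentalForm h g φ x (frame x (I a)) (frame x (L a))) := by
  rw [← multilinear_transform μ 1 (inverseMetric h x)
    fun s t ↦ secondFundamentalForm h g φ x (frame x s) (frame x t)]
  ext I J
  congr 1
  ext a
  simp [mixedA, Matrix.one_apply, Finset.sum_ite_eq]

/-- The contraction in terms of the mixed components and the generalized Kronecker symbol. -/
lemma sum_kronecker_cons_mixedA (h : SemiRiemannianMetric m S) (g : SemiRiemannianMetric n M)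
    (φ : S → M) (x : S) {k : ℕ}
    (μ : MultilinearMap ℝ (fun _ : Fin k ↦ TangentSpace (𝓡 n) (φ x)) ℝ)
    (C : TangentSpace (𝓡 m) x → TangentSpace (𝓡 m) x → ℝ) {C' : Fin m → Fin m → ℝ}
    (hC : ∀ i j, C' i j = ∑ l, inverseMetric h x j l * C (frame x i) (frame x l)) :
    ∑ i, ∑ j, C' i j * ∑ I : Fin k → Fin m, ∑ J : Fin k → Fin m,
      kronecker (Fin.cons i I : Fin (k + 1) → Fin m) (Fin.cons j J)
        * μ (fun a ↦ mixedA h g φ x (I a) (J a))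
      = frameContract h g φ x μ C (frame x) := by
  have h1 : C' = fun i j ↦ ∑ s, ∑ t, (1 : Matrix (Fin m) (Fin m) ℝ) i s * inverseMetric h x j t
      * C (frame x s) (frame x t) := by
    ext i j
    rw [hC]
    simp [Matrix.one_apply, Finset.sum_ite_eq]
  have h2 := contract_transform 1 1 (inverseMetric h x) (consTensor
    (fun i l ↦ C (frame x i) (frame x l)) (fun I L : Fin k → Fin m ↦ μ fun a ↦
      secondFundamentalForm h g φ x (frame x (I a)) (frame x (L a))))
  rw [← transform_consTensor, ← multilinear_mixedA, ← h1, contract_consTensor] at h2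
  simp_rw [kronecker_eq_det]
  rw [h2, Matrix.transpose_one, Matrix.one_mul, Matrix.one_mul]
  rfl

/-- The contraction with the metric: `∑ (T_k)_i^i = (m - k) H_k`, up to `k!`. -/
lemma frameContract_metric (h : SemiRiemannianMetric m S) (g : SemiRiemannianMetric n M)
    (φ : S → M) (x : S) {k : ℕ}
    (μ : MultilinearMap ℝ (fun _ : Fin k ↦ TangentSpace (𝓡 n) (φ x)) ℝ) :
    frameContract h g φ x μ (fun u v ↦ h.inner x u v) (frame x)
      = ((m : ℝ) - k) * ∑ I : Fin k → Fin m, ∑ J : Fin k → Fin m,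
        kronecker I J * μ (fun a ↦ mixedA h g φ x (I a) (J a)) := by
  rw [← sum_kronecker_cons_mixedA h g φ x μ (fun u v ↦ h.inner x u v)
    (C' := fun i j ↦ if i = j then 1 else 0)]
  · simp only [ite_mul, one_mul, zero_mul, Finset.sum_ite_eq, Finset.mem_univ, if_true]
    rw [Finset.sum_comm, Finset.mul_sum]
    refine Finset.sum_congr rfl fun I _ ↦ ?_
    rw [Finset.sum_comm, Finset.mul_sum]
    refine Finset.sum_congr rfl fun J _ ↦ ?_
    rw [← Finset.sum_mul, sum_kronecker_cons, mul_assoc]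
  · intro i j
    have := congrFun (congrFun (Matrix.nonsing_inv_mul (gram h x (frame x))
        (isUnit_iff_ne_zero.2 (det_gram_frame h x))) j) i
    rw [Matrix.mul_apply, Matrix.one_apply] at this
    simp_rw [eq_comm (a := i), ← this]
    refine Finset.sum_congr rfl fun l _ ↦ ?_
    rw [h.symm]
    rfl

end FrameContract

/-! ### Multilinear forms built from the metric -/

section Multilinear

variable {W : Type*} [AddCommGroup W] [Module ℝ W]

/-- A product of pairings is linear in each of the vectors. -/
lemma exists_linear_prod_update (b : W →ₗ[ℝ] W →ₗ[ℝ] ℝ) (r : ℕ) [DecidableEq (Fin (2 * r))]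
    (w : Fin (2 * r) → W) (c : Fin (2 * r)) : ∃ L : W →ₗ[ℝ] ℝ, ∀ x,
      ∏ a : Fin r, b (Function.update w c x ⟨2 * a.val, by omega⟩)
        (Function.update w c x ⟨2 * a.val + 1, by omega⟩) = L x := by
  have hc := c.2
  let a₀ : Fin r := ⟨c / 2, by omega⟩
  have h1 : ∀ x, ∏ a ∈ Finset.univ.erase a₀, b (Function.update w c x ⟨2 * a.val, by omega⟩)
        (Function.update w c x ⟨2 * a.val + 1, by omega⟩)
      = ∏ a ∈ Finset.univ.erase a₀, b (w ⟨2 * a.val, by omega⟩) (w ⟨2 * a.val + 1, by omega⟩) := by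
    intro x
    refine Finset.prod_congr rfl fun a ha ↦ ?_
    have ha' : a.val ≠ c / 2 := fun h ↦ (Finset.mem_erase.1 ha).1 (Fin.ext h)
    rw [Function.update_of_ne, Function.update_of_ne]
    · intro h; have := congrArg Fin.val h; simp only at this; omega
    · intro h; have := congrArg Fin.val h; simp only at this; omega
  rcases Nat.even_or_odd' c.val with ⟨j, hj | hj⟩
  · refine ⟨(∏ a ∈ Finset.univ.erase a₀, b (w ⟨2 * a.val, by omega⟩) (w ⟨2 * a.val + 1, by omega⟩))
      • b.flip (w ⟨2 * a₀.val + 1, by simp only [a₀]; omega⟩), fun x ↦ ?_⟩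
    rw [← Finset.mul_prod_erase _ _ (Finset.mem_univ a₀), h1]
    have e0 : (⟨2 * a₀.val, by simp only [a₀]; omega⟩ : Fin (2 * r)) = c := by
      ext; simp only [a₀]; omega
    have e1 : (⟨2 * a₀.val + 1, by simp only [a₀]; omega⟩ : Fin (2 * r)) ≠ c := by
      intro h; have := congrArg Fin.val h; simp only [a₀] at this; omega
    rw [e0, Function.update_self, Function.update_of_ne e1]
    simp [mul_comm]
  · refine ⟨(∏ a ∈ Finset.univ.erase a₀, b (w ⟨2 * a.val, by omega⟩) (w ⟨2 * a.val + 1, by omega⟩))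
      • b (w ⟨2 * a₀.val, by simp only [a₀]; omega⟩), fun x ↦ ?_⟩
    rw [← Finset.mul_prod_erase _ _ (Finset.mem_univ a₀), h1]
    have e0 : (⟨2 * a₀.val + 1, by simp only [a₀]; omega⟩ : Fin (2 * r)) = c := by
      ext; simp only [a₀]; omega
    have e1 : (⟨2 * a₀.val, by simp only [a₀]; omega⟩ : Fin (2 * r)) ≠ c := by
      intro h; have := congrArg Fin.val h; simp only [a₀] at this; omega
    rw [e0, Function.update_self, Function.update_of_ne e1]
    simp [mul_comm]

/-- The multilinear form `(w₁, …, w_{2r}) ↦ b(w₁, w₂) ⋯ b(w_{2r-1}, w_{2r})`. -/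
def pairForm (b : W →ₗ[ℝ] W →ₗ[ℝ] ℝ) (r : ℕ) : MultilinearMap ℝ (fun _ : Fin (2 * r) ↦ W) ℝ where
  toFun w := ∏ a : Fin r, b (w ⟨2 * a.val, by omega⟩) (w ⟨2 * a.val + 1, by omega⟩)
  map_update_add' w c x y := by
    obtain ⟨L, hL⟩ := exists_linear_prod_update b r w c
    rw [hL, hL, hL, map_add]
  map_update_smul' w c t x := by
    obtain ⟨L, hL⟩ := exists_linear_prod_update b r w c
    rw [hL, hL, map_smul]

lemma pairForm_apply (b : W →ₗ[ℝ] W →ₗ[ℝ] ℝ) (r : ℕ) (w : Fin (2 * r) → W) :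
    pairForm b r w = ∏ a : Fin r, b (w ⟨2 * a.val, by omega⟩) (w ⟨2 * a.val + 1, by omega⟩) := rfl

/-- The multilinear form `(w₁, …, w_k) ↦ ℓ(w₁) ⋯ ℓ(w_k)`. -/
def powerForm (l : W →ₗ[ℝ] ℝ) (k : ℕ) : MultilinearMap ℝ (fun _ : Fin k ↦ W) ℝ :=
  (MultilinearMap.mkPiAlgebra ℝ (Fin k) ℝ).compLinearMap fun _ ↦ l

end Multilinear

/-! ### The volume measure in a chart -/

section Volume

open Filter Topology Set

variable {d : ℕ} {N : Type*} [TopologicalSpace N] [ChartedSpace (Coord d) N]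
  [IsManifold (𝓡 d) ∞ N]

/-- The density `√|det g_{ij}|` of the volume in the preferred chart at `p`. -/
def volumeDensity (g : SemiRiemannianMetric d N) (p : N) (y : Coord d) : ℝ :=
  Real.sqrt |(gramMatrix g p y).det|

lemma volumeDensity_pos (g : SemiRiemannianMetric d N) {p : N} {y : Coord d}
    (hy : y ∈ (extChartAt (𝓡 d) p).target) : 0 < volumeDensity g p y :=
  Real.sqrt_pos.2 (abs_pos.2 (det_gramMatrix_ne_zero g hy))

lemma contDiffAt_volumeDensity (g : SemiRiemannianMetric d N) {p : N} {y : Coord d}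
    (hy : y ∈ (extChartAt (𝓡 d) p).target) : ContDiffAt ℝ ∞ (volumeDensity g p) y := by
  have h1 : ContDiffAt ℝ ∞ (fun z ↦ (gramMatrix g p z).det) y :=
    contDiffAt_det fun i j ↦ contDiffAt_gramMatrix g hy i j
  have h0 := det_gramMatrix_ne_zero g hy
  exact (h1.abs h0).sqrt (abs_ne_zero.2 h0)

lemma continuousOn_volumeDensity (g : SemiRiemannianMetric d N) (p : N) :
    ContinuousOn (volumeDensity g p) (extChartAt (𝓡 d) p).target :=
  fun _ hy ↦ (contDiffAt_volumeDensity g hy).continuousAt.continuousWithinAt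

/-- Change of variables for the density of the volume. -/
lemma volumeDensity_transition (g : SemiRiemannianMetric d N) {p q z : N}
    (hp : z ∈ (chartAt (Coord d) p).source) (hq : z ∈ (chartAt (Coord d) q).source) :
    volumeDensity g p (extChartAt (𝓡 d) p z)
      = |(fderiv ℝ (localMap d d (id : N → N) p q) (extChartAt (𝓡 d) p z)).det|
        * volumeDensity g q (extChartAt (𝓡 d) q z) := by
  set D := fderiv ℝ (localMap d d (id : N → N) p q) (extChartAt (𝓡 d) p z) with hD
  set b := (EuclideanSpace.basisFun (Fin d) ℝ).toBasis
  set J := LinearMap.toMatrix b b (D : Coord d →ₗ[ℝ] Coord d) with hJ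
  have hJa : ∀ i j, J i j = D (EuclideanSpace.single j 1) i := by
    intro i j
    simp [J, b, LinearMap.toMatrix_apply]
  have hdet : D.det = J.det := (LinearMap.det_toMatrix b _).symm
  have hz : (extChartAt (𝓡 d) p).symm (extChartAt (𝓡 d) p z) = z :=
    (extChartAt (𝓡 d) p).left_inv (mem_source_iff.2 hp)
  have hy : extChartAt (𝓡 d) p z ∈ (extChartAt (𝓡 d) p).target :=
    (extChartAt (𝓡 d) p).map_source (mem_source_iff.2 hp)
  have hgram : gramMatrix g p (extChartAt (𝓡 d) p z)
      = Jᵀ * gramMatrix g q (extChartAt (𝓡 d) q z) * J := by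
    ext i j
    have h1 := metricLoc_pullback (isIsometricImmersion_id g) (q := q) hy
      (by rw [hz]; exact hq) (EuclideanSpace.single i 1) (EuclideanSpace.single j 1)
    rw [localMap_apply hp, ← hD] at h1
    simp only [id] at h1
    rw [metricLoc_apply, metricLoc_apply] at h1
    simp only [Matrix.mul_apply, Matrix.transpose_apply, hJa, Finset.sum_mul]
    rw [Finset.sum_comm]
    calc _ = _ := by
          simp
      _ = _ := h1
      _ = _ := Finset.sum_congr rfl fun s _ ↦ Finset.sum_congr rfl fun t _ ↦ by ring
  rw [volumeDensity, volumeDensity, hgram, Matrix.det_mul, Matrix.det_mul, Matrix.det_transpose,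
    hdet, ← Real.sqrt_sq_eq_abs J.det, ← Real.sqrt_mul (sq_nonneg _)]
  congr 1
  rw [abs_mul, abs_mul, sq, ← abs_mul_abs_self J.det]
  ring

variable [MeasurableSpace N] [BorelSpace N]

lemma measurableSet_target (p : N) : MeasurableSet (extChartAt (𝓡 d) p).target :=
  (isOpen_extChartAt_target p).measurableSet

lemma measurableSet_source (p : N) : MeasurableSet (chartAt (Coord d) p).source :=
  (chartAt (Coord d) p).open_source.measurableSet

lemma measurableSet_target_inter (p : N) {A : Set N} (hA : MeasurableSet A) :
    MeasurableSet ((extChartAt (𝓡 d) p).target ∩ (extChartAt (𝓡 d) p).symm ⁻¹' A) := by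
  have h1 := (continuousOn_iff_continuous_domRestrict.1
    (continuousOn_extChartAt_symm (I := 𝓡 d) p)).measurable hA
  have h2 := (MeasurableEmbedding.subtype_coe (measurableSet_target (d := d) p)).measurableSet_image'
    h1
  convert h2 using 1
  ext y
  simp [and_comm]

lemma aemeasurable_symm (p : N) (ν : Measure (Coord d)) :
    AEMeasurable (extChartAt (𝓡 d) p).symm (ν.restrict (extChartAt (𝓡 d) p).target) :=
  (continuousOn_extChartAt_symm p).aemeasurable (measurableSet_target p)

lemma aemeasurable_density (g : SemiRiemannianMetric d N) (p : N) (ν : Measure (Coord d)) :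
    AEMeasurable (fun y ↦ ENNReal.ofReal (volumeDensity g p y))
      (ν.restrict (extChartAt (𝓡 d) p).target) :=
  ((continuousOn_volumeDensity g p).aemeasurable (measurableSet_target p)).ennreal_ofReal

lemma aemeasurable_symm_withDensity (g : SemiRiemannianMetric d N) (p : N) :
    AEMeasurable (extChartAt (𝓡 d) p).symm
      (((volume : Measure (Coord d)).restrict (extChartAt (𝓡 d) p).target).withDensity
        (fun y ↦ ENNReal.ofReal (volumeDensity g p y))) :=
  (aemeasurable_symm p volume).mono_ac (withDensity_absolutelyContinuous _ _)

lemma chartVolume_apply (g : SemiRiemannianMetric d N) (p : N) {A : Set N} (hA : MeasurableSet A) :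
    chartVolume g p A = ∫⁻ y in (extChartAt (𝓡 d) p).target ∩ (extChartAt (𝓡 d) p).symm ⁻¹' A,
      ENNReal.ofReal (volumeDensity g p y) := by
  have h1 : chartVolume g p A = (((volume : Measure (Coord d)).restrict
      (extChartAt (𝓡 d) p).target).withDensity
        (fun y ↦ ENNReal.ofReal (volumeDensity g p y))) ((extChartAt (𝓡 d) p).symm ⁻¹' A) :=
    Measure.map_apply_of_aemeasurable (aemeasurable_symm_withDensity g p) hA
  rw [h1, withDensity_apply', Measure.restrict_restrict' (measurableSet_target p), inter_comm]

/-- The chart measures agree on the overlap of two charts. -/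
lemma chartVolume_eq (g : SemiRiemannianMetric d N) {p q : N} {A : Set N} (hA : MeasurableSet A)
    (hp : A ⊆ (chartAt (Coord d) p).source) (hq : A ⊆ (chartAt (Coord d) q).source) :
    chartVolume g p A = chartVolume g q A := by
  rw [chartVolume_apply g p hA, chartVolume_apply g q hA]
  set s := (extChartAt (𝓡 d) p).target ∩ (extChartAt (𝓡 d) p).symm ⁻¹' A with hs
  set ψ := localMap d d (id : N → N) p q with hψ
  have hsx : ∀ y ∈ s, ∃ z, z ∈ A ∧ extChartAt (𝓡 d) p z = y ∧ ψ y = extChartAt (𝓡 d) q z := by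
    intro y hy
    exact ⟨_, hy.2, (extChartAt (𝓡 d) p).right_inv hy.1, rfl⟩
  have himage : (extChartAt (𝓡 d) q).target ∩ (extChartAt (𝓡 d) q).symm ⁻¹' A = ψ '' s := by
    ext w
    constructor
    · rintro ⟨hw, hwA⟩
      refine ⟨extChartAt (𝓡 d) p ((extChartAt (𝓡 d) q).symm w), ⟨?_, ?_⟩, ?_⟩
      · exact (extChartAt (𝓡 d) p).map_source (mem_source_iff.2 (hp hwA))
      · rw [mem_preimage, (extChartAt (𝓡 d) p).left_inv (mem_source_iff.2 (hp hwA))]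
        exact hwA
      · rw [hψ, localMap_apply (hp hwA)]
        exact (extChartAt (𝓡 d) q).right_inv hw
    · rintro ⟨y, hy, rfl⟩
      obtain ⟨z, hz, rfl, h2⟩ := hsx y hy
      rw [h2]
      refine ⟨(extChartAt (𝓡 d) q).map_source (mem_source_iff.2 (hq hz)), ?_⟩
      rw [mem_preimage, (extChartAt (𝓡 d) q).left_inv (mem_source_iff.2 (hq hz))]
      exact hz
  have hder : ∀ y ∈ s, HasFDerivWithinAt ψ (fderiv ℝ ψ y) s y := by
    intro y hy
    obtain ⟨z, hz, rfl, -⟩ := hsx y hy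
    exact ((contDiffAt_localMap (m := d) (n := d) contMDiffAt_id (hp hz) (hq hz)).differentiableAt
      (by simp)).hasFDerivAt.hasFDerivWithinAt
  have hinj : InjOn ψ s := by
    intro y hy y' hy' h
    obtain ⟨z, hz, rfl, h1⟩ := hsx y hy
    obtain ⟨z', hz', rfl, h2⟩ := hsx y' hy'
    rw [h1, h2] at h
    rw [(extChartAt (𝓡 d) q).injOn (mem_source_iff.2 (hq hz)) (mem_source_iff.2 (hq hz')) h]
  rw [himage, lintegral_image_eq_lintegral_abs_det_fderiv_mul volume
    (measurableSet_target_inter p hA) hder hinj]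
  refine setLIntegral_congr_fun (measurableSet_target_inter p hA) fun y hy ↦ ?_
  obtain ⟨z, hz, rfl, h2⟩ := hsx y hy
  rw [h2, volumeDensity_transition g (hp hz) (hq hz), ENNReal.ofReal_mul (abs_nonneg _)]

/-- The chart measure is carried by the domain of the chart. -/
lemma chartVolume_compl_source (g : SemiRiemannianMetric d N) (p : N) :
    chartVolume g p (chartAt (Coord d) p).sourceᶜ = 0 := by
  rw [chartVolume_apply g p (measurableSet_source p).compl]
  have : (extChartAt (𝓡 d) p).target ∩ (extChartAt (𝓡 d) p).symm ⁻¹' (chartAt (Coord d) p).sourceᶜ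
      = ∅ := by
    ext y
    simp only [mem_inter_iff, mem_preimage, mem_compl_iff, mem_empty_iff_false, iff_false, not_and,
      not_not]
    exact fun hy ↦ mem_source_of_target hy
  rw [this]
  simp

/-- In the domain of the chart at `p` the volume measure is the chart measure. -/
lemma volumeMeasure_restrict (g : SemiRiemannianMetric d N) (p : N) :
    (volumeMeasure g).restrict (chartAt (Coord d) p).source = chartVolume g p := by
  have hU := measurableSet_source (d := d) p
  have hle : chartVolume g p ≤ volumeMeasure g := le_iSup (chartVolume g) p
  refine le_antisymm ?_ ?_
  · have h1 : volumeMeasure g ≤ chartVolume g p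
        + (volumeMeasure g).restrict (chartAt (Coord d) p).sourceᶜ := by
      -- inside the chart at `p` the measure of another chart is at most the one of `p`, outside it
      -- is at most the volume
      refine iSup_le fun q ↦ ?_
      have hq : chartVolume g q ≤ volumeMeasure g := le_iSup (chartVolume g) q
      rw [← Measure.restrict_add_restrict_compl (μ := chartVolume g q) hU]
      refine add_le_add ?_ (Measure.restrict_mono le_rfl hq)
      refine Measure.le_iff.2 fun A hA ↦ ?_
      rw [Measure.restrict_apply hA, ← measure_inter_add_sdiff _ (measurableSet_source (d := d) q),
        chartVolume_eq g (q := p) ((hA.inter hU).inter (measurableSet_source q)) inter_subset_right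
          (inter_subset_left.trans inter_subset_right),
        measure_mono_null (fun x hx ↦ hx.2) (chartVolume_compl_source g q), add_zero]
      exact measure_mono (inter_subset_left.trans inter_subset_left)
    have h2 := Measure.restrict_mono (s := (chartAt (Coord d) p).source) le_rfl h1
    refine h2.trans ?_
    rw [Measure.restrict_add, Measure.restrict_restrict hU, inter_compl_self,
      Measure.restrict_empty, add_zero]
    exact Measure.restrict_le_self
  · refine Measure.le_iff.2 fun A hA ↦ ?_
    rw [Measure.restrict_apply hA, ← measure_inter_add_sdiff A hU,
      measure_mono_null (s := A \ _) (fun x hx ↦ hx.2) (chartVolume_compl_source g p), add_zero]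
    exact hle _

lemma isLocallyFiniteMeasure_volumeMeasure (g : SemiRiemannianMetric d N) :
    IsLocallyFiniteMeasure (volumeMeasure g) := by
  refine ⟨fun x ↦ ?_⟩
  have hx := mem_chart_source (Coord d) x
  have hy : extChartAt (𝓡 d) x x ∈ (extChartAt (𝓡 d) x).target := mem_extChartAt_target x
  obtain ⟨ε, hε, hball⟩ := Metric.mem_nhds_iff.1 (Filter.inter_mem
    (extChartAt_target_mem_nhds' hy) ((contDiffAt_volumeDensity g hy).continuousAt.eventually
      (gt_mem_nhds (lt_add_one _))))
  set B := Metric.ball (extChartAt (𝓡 d) x x) ε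
  refine ⟨(chartAt (Coord d) x).source ∩ extChartAt (𝓡 d) x ⁻¹' B, Filter.inter_mem
    ((chartAt (Coord d) x).open_source.mem_nhds hx)
    ((continuousAt_extChartAt x).preimage_mem_nhds (Metric.ball_mem_nhds _ hε)), ?_⟩
  have hopen : IsOpen ((chartAt (Coord d) x).source ∩ extChartAt (𝓡 d) x ⁻¹' B) := by
    have := isOpen_extChartAt_preimage' (I := 𝓡 d) x (s := B) Metric.isOpen_ball
    rwa [extChartAt_source] at this
  rw [inter_comm, ← Measure.restrict_apply' (measurableSet_source x), volumeMeasure_restrict,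
    ← measure_inter_add_sdiff _ (measurableSet_source (d := d) x),
    measure_mono_null (s := _ \ _) (fun x hx ↦ hx.2) (chartVolume_compl_source g x), add_zero,
    inter_comm,
    chartVolume_apply g x hopen.measurableSet]
  have hsub : (extChartAt (𝓡 d) x).target ∩ (extChartAt (𝓡 d) x).symm ⁻¹'
      ((chartAt (Coord d) x).source ∩ extChartAt (𝓡 d) x ⁻¹' B) ⊆ B := by
    rintro y ⟨hy1, -, hy2⟩
    rwa [mem_preimage, (extChartAt (𝓡 d) x).right_inv hy1] at hy2
  calc _ ≤ ∫⁻ y in B, ENNReal.ofReal (volumeDensity g x y) := lintegral_mono_set hsub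
    _ ≤ ∫⁻ y in B, ENNReal.ofReal (volumeDensity g x (extChartAt (𝓡 d) x x) + 1) :=
        setLIntegral_mono' Metric.isOpen_ball.measurableSet fun y hy ↦
          ENNReal.ofReal_le_ofReal (hball hy).2.le
    _ < ⊤ := by
        rw [setLIntegral_const]
        exact ENNReal.mul_lt_top ENNReal.ofReal_lt_top Metric.isBounded_ball.measure_lt_top

/-- The integral of a function carried by the domain of a chart, in coordinates. -/
lemma integral_volumeMeasure (g : SemiRiemannianMetric d N) {p : N} {F : N → ℝ}
    (hF : Continuous F) (hsupp : ∀ x ∉ (chartAt (Coord d) p).source, F x = 0) :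
    ∫ x, F x ∂(volumeMeasure g) = ∫ y in (extChartAt (𝓡 d) p).target,
      volumeDensity g p y * F ((extChartAt (𝓡 d) p).symm y) := by
  rw [← setIntegral_eq_integral_of_forall_compl_eq_zero hsupp, volumeMeasure_restrict]
  have h1 : ∫ x, F x ∂(chartVolume g p) = ∫ y, F ((extChartAt (𝓡 d) p).symm y)
      ∂(((volume : Measure (Coord d)).restrict (extChartAt (𝓡 d) p).target).withDensity
        (fun y ↦ ENNReal.ofReal (volumeDensity g p y))) :=
    integral_map (aemeasurable_symm_withDensity g p) hF.aestronglyMeasurable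
  rw [h1, integral_withDensity_eq_integral_toReal_smul₀ (aemeasurable_density g p volume)
    (Filter.Eventually.of_forall fun _ ↦ ENNReal.ofReal_lt_top)]
  refine integral_congr_ae (Filter.Eventually.of_forall fun y ↦ ?_)
  simp only [smul_eq_mul]
  rw [ENNReal.toReal_ofReal (show 0 ≤ volumeDensity g p y from Real.sqrt_nonneg _)]

end Volume

/-! ### The divergence theorem -/

section Divergence

open Filter Topology Set

/-- Jacobi's formula for the derivative of a determinant. -/
lemma fderiv_det {V : Type*} [NormedAddCommGroup V] [NormedSpace ℝ V] {k : ℕ}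
    {A : V → Matrix (Fin k) (Fin k) ℝ} {y : V}
    (hA : ∀ i j, DifferentiableAt ℝ (fun z ↦ A z i j) y) (u : V) :
    fderiv ℝ (fun z ↦ (A z).det) y u
      = ((A y).adjugate * Matrix.of fun i j ↦ fderiv ℝ (fun z ↦ A z i j) y u).trace := by
  have h1 : HasFDerivAt (fun z ↦ (A z).det) (∑ σ : Equiv.Perm (Fin k),
      ((Equiv.Perm.sign σ : ℤ) : ℝ) • ∑ i, (∏ j ∈ Finset.univ.erase i, A y (σ j) j) •
        fderiv ℝ (fun z ↦ A z (σ i) i) y) y := by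
    simp_rw [Matrix.det_apply']
    exact HasFDerivAt.fun_sum fun σ _ ↦ (HasFDerivAt.finsetProd fun i _ ↦
      (hA (σ i) i).hasFDerivAt).const_mul _
  rw [h1.fderiv]
  have h2 : ∀ i, ((A y).adjugate * Matrix.of fun i j ↦ fderiv ℝ (fun z ↦ A z i j) y u) i i
      = ((A y).updateCol i fun s ↦ fderiv ℝ (fun z ↦ A z s i) y u).det := by
    intro i
    rw [← Matrix.cramer_apply, Matrix.cramer_eq_adjugate_mulVec]
    rfl
  simp only [Matrix.trace, Matrix.diag_apply, h2, Matrix.det_apply']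
  rw [Finset.sum_comm]
  simp only [sum_apply, smul_apply, smul_eq_mul, Finset.mul_sum]
  refine Finset.sum_congr rfl fun σ _ ↦ Finset.sum_congr rfl fun i _ ↦ ?_
  rw [← Finset.mul_prod_erase _ _ (Finset.mem_univ i), Matrix.updateCol_self, mul_comm (∏ j ∈ _, _)]
  congr 2
  refine Finset.prod_congr rfl fun j hj ↦ ?_
  rw [Matrix.updateCol_ne (Finset.ne_of_mem_erase hj)]

lemma trace_eq_sum_apply_single {d : ℕ} (T : Coord d →ₗ[ℝ] Coord d) :
    LinearMap.trace ℝ (Coord d) T = ∑ i, T (EuclideanSpace.single i 1) i := by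
  rw [LinearMap.trace_eq_matrix_trace ℝ (EuclideanSpace.basisFun (Fin d) ℝ).toBasis, Matrix.trace]
  exact Finset.sum_congr rfl fun i _ ↦ by simp [LinearMap.toMatrix_apply]

variable {m : ℕ}
  {S : Type*} [TopologicalSpace S] [ChartedSpace (Coord m) S] [IsManifold (𝓡 m) ∞ S]

/-- Coordinates in a chart as a linear equivalence. -/
def coordsEquiv {p x : S} (hx : x ∈ (chartAt (Coord m) p).source) :
    TangentSpace (𝓡 m) x ≃ₗ[ℝ] Coord m where
  toLinearMap := coordsL p x
  invFun := ofCoords p x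
  left_inv := ofCoords_coords hx
  right_inv := coords_ofCoords hx

/-- The divergence of a vector field, the trace of its covariant derivative. -/
def divergence (h : SemiRiemannianMetric m S) (V : ∀ x : S, TangentSpace (𝓡 m) x) (x : S) : ℝ :=
  ∑ i, coords x x (covDerivAlong h (id : S → S) V x (frame x i)) i

/-- The covariant derivative in coordinates as a linear map in the direction. -/
def covL (h : SemiRiemannianMetric m S) (V : ∀ x : S, TangentSpace (𝓡 m) x) (p : S) (y : Coord m) :
    Coord m →ₗ[ℝ] Coord m where
  toFun u := cov (connLoc h p) (localMap m m (id : S → S) p p)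
    (localField m (id : S → S) V p p) y u
  map_add' u v := by simp only [cov, map_add, add_apply]; abel
  map_smul' c u := by simp only [cov, map_smul, smul_apply, RingHom.id_apply, smul_add]

lemma divergence_eq_trace (h : SemiRiemannianMetric m S) {V : ∀ x : S, TangentSpace (𝓡 m) x}
    {p x : S} (hx : x ∈ (chartAt (Coord m) p).source)
    (hV : IsSmoothAlongAt m (id : S → S) V x) :
    divergence h V x = LinearMap.trace ℝ _ (covL h V p (extChartAt (𝓡 m) p x)) := by
  have hxx := mem_chart_source (Coord m) x
  have h1 : ∀ {q : S} (_ : x ∈ (chartAt (Coord m) q).source) (v : TangentSpace (𝓡 m) x),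
      coords q x (covDerivAlong h (id : S → S) V x v)
        = covL h V q (extChartAt (𝓡 m) q x) (coords q x v) :=
    fun hq v ↦ coords_covDerivAlong h contMDiffAt_id hV hq hq v
  have h2 : covL h V x (extChartAt (𝓡 m) x x)
      = ((coordsEquiv hx).symm.trans (coordsEquiv hxx)).conj
        (covL h V p (extChartAt (𝓡 m) p x)) := by
    refine LinearMap.ext fun a ↦ ?_
    have h3 : a = coords x x (ofCoords x x a) := (coords_ofCoords hxx a).symm
    have h4 : covL h V p (extChartAt (𝓡 m) p x) (coords p x (ofCoords x x a))
      = coords p x (covDerivAlong h (id : S → S) V x (ofCoords x x a)) := (h1 hx _).symm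
    calc _ = coords x x (covDerivAlong h (id : S → S) V x (ofCoords x x a)) := by
          rw [h1 hxx, ← h3]
      _ = coords x x (ofCoords p x (covL h V p (extChartAt (𝓡 m) p x)
            (coords p x (ofCoords x x a)))) := by
          rw [h4]
          exact congrArg _ (ofCoords_coords hx _).symm
      _ = _ := rfl
  rw [← LinearMap.trace_conj' _ ((coordsEquiv hx).symm.trans (coordsEquiv hxx)), ← h2,
    trace_eq_sum_apply_single, divergence]
  refine Finset.sum_congr rfl fun i _ ↦ ?_
  rw [h1 hxx, coords_frame]

/-- The derivative of the density of the volume is the trace of the Christoffel symbols. -/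
lemma fderiv_volumeDensity (h : SemiRiemannianMetric m S) {p : S} {y : Coord m}
    (hy : y ∈ (extChartAt (𝓡 m) p).target) (u : Coord m) :
    fderiv ℝ (volumeDensity h p) y u
      = volumeDensity h p y * ∑ i, connLoc h p y u (EuclideanSpace.single i 1) i := by
  set A := gramMatrix h p with hA
  have hA1 : ∀ i j, DifferentiableAt ℝ (fun z ↦ A z i j) y := fun i j ↦
    (contDiffAt_gramMatrix h hy i j).differentiableAt (by simp)
  set C : Matrix (Fin m) (Fin m) ℝ :=
    Matrix.of fun k i ↦ connLoc h p y u (EuclideanSpace.single i 1) k with hC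
  have hAij : ∀ z i j, A z i j
      = metricLoc h p z (EuclideanSpace.single i 1) (EuclideanSpace.single j 1) := by
    intro z i j
    rw [metricLoc_apply]
    simp
    rfl
  have hG := contDiffAt_metricLoc h hy
  have hGd : DifferentiableAt ℝ (metricLoc h p) y := hG.differentiableAt (by simp)
  have hd : (Matrix.of fun i j ↦ fderiv ℝ (fun z ↦ A z i j) y u) = Cᵀ * A y + A y * C := by
    ext i j
    have h1 : fderiv ℝ (fun z ↦ A z i j) y u = fderiv ℝ (metricLoc h p) y u
        (EuclideanSpace.single i 1) (EuclideanSpace.single j 1) := by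
      simp_rw [hAij]
      have := (fderiv_bilin_apply (F := fun z : Coord m ↦ z) hGd differentiableAt_id
        (differentiableAt_const (EuclideanSpace.single i (1 : ℝ) : Coord m))
        (differentiableAt_const (EuclideanSpace.single j (1 : ℝ) : Coord m)) u).2
      simpa using this
    have h2 := (isLeviCivitaAt_connLoc h hy).metric hGd
      (Filter.Eventually.of_forall fun z u v ↦ metricLoc_symm h p z u v) u
      (EuclideanSpace.single i 1) (EuclideanSpace.single j 1)
    rw [Matrix.of_apply, h1, h2]
    rw [metricLoc_apply, metricLoc_apply]
    simp only [Matrix.add_apply, Matrix.mul_apply, Matrix.transpose_apply, hC, Matrix.of_apply]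
    congr 1
    · refine Finset.sum_congr rfl fun k _ ↦ ?_
      simp [mul_comm, hA]
    · rw [Finset.sum_comm]
      refine Finset.sum_congr rfl fun k _ ↦ ?_
      simp [hA]
  have hdet : fderiv ℝ (fun z ↦ (A z).det) y u = 2 * (A y).det * C.trace := by
    rw [fderiv_det hA1, hd, Matrix.mul_add, Matrix.trace_add, ← Matrix.mul_assoc (A y).adjugate (A y),
      Matrix.trace_mul_comm (A y).adjugate, Matrix.mul_assoc, Matrix.mul_adjugate,
      Matrix.adjugate_mul, Matrix.mul_smul, Matrix.mul_one,
      Matrix.smul_mul, Matrix.one_mul, Matrix.trace_smul,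
      Matrix.trace_smul, Matrix.trace_transpose, smul_eq_mul]
    ring
  have h0 : (A y).det ≠ 0 := det_gramMatrix_ne_zero h hy
  have hdd : DifferentiableAt ℝ (fun z ↦ (A z).det) y :=
    (contDiffAt_det fun i j ↦ contDiffAt_gramMatrix h hy i j).differentiableAt (by simp)
  have hvd : DifferentiableAt ℝ (volumeDensity h p) y :=
    (contDiffAt_volumeDensity h hy).differentiableAt (by simp)
  -- differentiate `density ^ 4 = det ^ 2`, which avoids the absolute value
  have hsq : (fun z ↦ volumeDensity h p z ^ 4) = fun z ↦ (A z).det ^ 2 := by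
    ext z
    rw [volumeDensity, show (4 : ℕ) = 2 * 2 from rfl, pow_mul, Real.sq_sqrt (abs_nonneg _), sq_abs]
  have h4 : 4 * volumeDensity h p y ^ 3 * fderiv ℝ (volumeDensity h p) y u
      = 2 * (A y).det * fderiv ℝ (fun z ↦ (A z).det) y u := by
    have e1 := fderiv_fun_pow 4 hvd
    have e2 := fderiv_fun_pow 2 hdd
    rw [hsq, e2] at e1
    simpa [mul_assoc] using (congrArg (fun L : Coord m →L[ℝ] ℝ ↦ L u) e1).symm
  have h5 : volumeDensity h p y ^ 4 = (A y).det ^ 2 := congrFun hsq y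
  have hpos := volumeDensity_pos h hy
  have h6 : 4 * volumeDensity h p y ^ 3 ≠ 0 := by positivity
  refine mul_left_cancel₀ h6 ?_
  rw [h4, hdet]
  change _ = 4 * volumeDensity h p y ^ 3 * (volumeDensity h p y * C.trace)
  linear_combination (-4 * C.trace) * h5

/-- The coordinate expression of the divergence. -/
lemma sum_fderiv_density_mul (h : SemiRiemannianMetric m S) {V : ∀ x : S, TangentSpace (𝓡 m) x}
    {p x : S} (hx : x ∈ (chartAt (Coord m) p).source)
    (hV : IsSmoothAlongAt m (id : S → S) V x) :
    ∑ i, fderiv ℝ (fun y ↦ volumeDensity h p y * localField m (id : S → S) V p p y i)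
        (extChartAt (𝓡 m) p x) (EuclideanSpace.single i 1)
      = volumeDensity h p (extChartAt (𝓡 m) p x) * divergence h V x := by
  set y := extChartAt (𝓡 m) p x with hy'
  have hy : y ∈ (extChartAt (𝓡 m) p).target :=
    (extChartAt (𝓡 m) p).map_source (mem_source_iff.2 hx)
  set W := localField m (id : S → S) V p p with hW
  have hWs : ContDiffAt ℝ ∞ W y := (isSmoothAlongAt_iff contMDiffAt_id hx hx).1 hV
  have hWd : DifferentiableAt ℝ W y := hWs.differentiableAt (by simp)
  have hvd : DifferentiableAt ℝ (volumeDensity h p) y :=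
    (contDiffAt_volumeDensity h hy).differentiableAt (by simp)
  have hcomp : ∀ i u, DifferentiableAt ℝ (fun z ↦ W z i) y ∧
      fderiv ℝ (fun z ↦ W z i) y u = fderiv ℝ W y u i := by
    intro i u
    have := (EuclideanSpace.proj i : Coord m →L[ℝ] ℝ).hasFDerivAt.comp y hWd.hasFDerivAt
    exact ⟨this.differentiableAt, congrArg (fun L ↦ L u) this.fderiv⟩
  have hid : fderiv ℝ (localMap m m (id : S → S) p p) y = ContinuousLinearMap.id ℝ _ := by
    have : localMap m m (id : S → S) p p =ᶠ[𝓝 y] id := by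
      filter_upwards [extChartAt_target_mem_nhds' hy] with z hz
      exact (extChartAt (𝓡 m) p).right_inv hz
    rw [this.fderiv_eq, fderiv_id]
  have hGd : DifferentiableAt ℝ (metricLoc h p) y :=
    (contDiffAt_metricLoc h hy).differentiableAt (by simp)
  have hsymm : ∀ u v, connLoc h p y u v = connLoc h p y v u :=
    (isLeviCivitaAt_connLoc h hy).symm hGd
      (Filter.Eventually.of_forall fun z u v ↦ metricLoc_symm h p z u v)
      (metricLoc_nondegenerate h hy)
  have hlm : localMap m m (id : S → S) p p y = y := by rw [hy', localMap_apply hx]; rfl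
  have hdiv : divergence h V x = ∑ i, (fderiv ℝ W y (EuclideanSpace.single i 1) i
      + connLoc h p y (W y) (EuclideanSpace.single i 1) i) := by
    rw [divergence_eq_trace h hx hV, trace_eq_sum_apply_single]
    refine Finset.sum_congr rfl fun i _ ↦ ?_
    change (cov _ _ _ _ _ : Coord m) i = _
    rw [cov, ← hy', hid, hlm, ← hW, hsymm]
    rfl
  have hexp : ∑ i, W y i * fderiv ℝ (volumeDensity h p) y (EuclideanSpace.single i 1)
      = fderiv ℝ (volumeDensity h p) y (W y) := by
    conv_rhs => rw [← sum_smul_single (W y)]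
    simp [map_sum]
  rw [hdiv, Finset.sum_add_distrib, mul_add, ← fderiv_volumeDensity h hy, ← hexp, Finset.mul_sum,
    ← Finset.sum_add_distrib]
  refine Finset.sum_congr rfl fun i _ ↦ ?_
  rw [fderiv_fun_mul hvd (hcomp i 0).1]
  simp only [add_apply, smul_apply, smul_eq_mul]
  rw [(hcomp i _).2]

lemma continuousAt_divergence (h : SemiRiemannianMetric m S) {V : ∀ x : S, TangentSpace (𝓡 m) x}
    {x : S} (hV : ∀ᶠ z in 𝓝 x, IsSmoothAlongAt m (id : S → S) V z) :
    ContinuousAt (divergence h V) x := by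
  have hx := mem_chart_source (Coord m) x
  have hy := mem_extChartAt_target (I := 𝓡 m) x
  have hWs : ContDiffAt ℝ ∞ (localField m (id : S → S) V x x) (extChartAt (𝓡 m) x x) :=
    (isSmoothAlongAt_iff contMDiffAt_id hx hx).1 hV.self_of_nhds
  have hc : ContinuousAt (fun y ↦ (∑ i, fderiv ℝ (fun y ↦ volumeDensity h x y
      * localField m (id : S → S) V x x y i) y (EuclideanSpace.single i 1)) / volumeDensity h x y)
      (extChartAt (𝓡 m) x x) := by
    refine ContinuousAt.div (tendsto_finsetSum _ fun i _ ↦ ?_)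
      (contDiffAt_volumeDensity h hy).continuousAt (volumeDensity_pos h hy).ne'
    have h1 : ContDiffAt ℝ ∞ (fun y ↦ localField m (id : S → S) V x x y i)
        (extChartAt (𝓡 m) x x) :=
      (EuclideanSpace.proj i : Coord m →L[ℝ] ℝ).contDiff.contDiffAt.comp _ hWs
    have h2 := contDiffAt_fderiv ((contDiffAt_volumeDensity h hy).mul h1)
    exact h2.continuousAt.clm_apply continuousAt_const
  have h3 := hc.comp_of_eq (continuousAt_extChartAt (I := 𝓡 m) x) rfl
  refine h3.congr ?_
  filter_upwards [hV, (chartAt (Coord m) x).open_source.mem_nhds hx] with z hz hzx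
  simp only [Function.comp_apply]
  rw [sum_fderiv_density_mul h hzx hz]
  exact mul_div_cancel_left₀ _ (volumeDensity_pos h
    ((extChartAt (𝓡 m) x).map_source (mem_source_iff.2 hzx))).ne'

/-- The derivative of a compactly supported function in a fixed direction has vanishing integral. -/
lemma integral_fderiv_eq_zero {w : Coord m → ℝ} (hw : ContDiff ℝ ∞ w) (hc : HasCompactSupport w)
    (u : Coord m) :
    Integrable (fun y ↦ fderiv ℝ w y u) ∧ ∫ y, fderiv ℝ w y u = 0 := by
  have h1 : Continuous fun y ↦ fderiv ℝ w y u :=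
    (hw.continuous_fderiv (by simp)).clm_apply continuous_const
  have h2 : HasCompactSupport fun y ↦ fderiv ℝ w y u :=
    (hc.fderiv (𝕜 := ℝ)).comp_left (g := fun L : Coord m →L[ℝ] ℝ ↦ L u) rfl
  have h3 : Integrable fun y ↦ fderiv ℝ w y u := h1.integrable_of_hasCompactSupport h2
  refine ⟨h3, ?_⟩
  have h4 := integral_mul_fderiv_eq_neg_fderiv_mul_of_integrable (μ := volume) (v := u)
    (f := fun _ : Coord m ↦ (1 : ℝ)) (g := w) (by simp) (by simpa using h3)
    (by simpa using hw.continuous.integrable_of_hasCompactSupport hc)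
    (fun _ _ ↦ differentiableAt_const _) (fun y _ ↦ hw.differentiable (by simp) y)
  simpa using h4

variable [MeasurableSpace S] [BorelSpace S]

/-- The divergence theorem for a vector field supported in the domain of a chart. -/
lemma integral_divergence_of_support [T2Space S] (h : SemiRiemannianMetric m S)
    {V : ∀ x : S, TangentSpace (𝓡 m) x} (hV : ∀ x, IsSmoothAlongAt m (id : S → S) V x) {p : S}
    {K : Set S} (hK : IsCompact K) (hKp : K ⊆ (chartAt (Coord m) p).source)
    (hVK : ∀ x ∉ K, V x = 0) : ∫ x, divergence h V x ∂(volumeMeasure h) = 0 := by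
  set c := extChartAt (𝓡 m) p with hc
  set W := localField m (id : S → S) V p p with hW
  set w : Fin m → Coord m → ℝ := fun i ↦
    c.target.indicator fun y ↦ volumeDensity h p y * W y i with hw
  have hWz : ∀ y ∈ c.target, c.symm y ∉ K → W y = 0 := by
    intro y hy hyK
    simp only [hW, localField]
    rw [hVK _ hyK]
    exact map_zero (coordsL p _)
  have hcK : IsCompact (c '' K) := hK.image_of_continuousOn
    ((continuousOn_extChartAt p).mono fun x hx ↦ mem_source_iff.2 (hKp hx))
  have hw0 : ∀ i, ∀ y ∉ c '' K, w i y = 0 := by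
    intro i y hy
    by_cases hyt : y ∈ c.target
    · simp only [hw, indicator_of_mem hyt]
      rw [hWz y hyt fun hK' ↦ hy ⟨_, hK', c.right_inv hyt⟩]
      simp
    · exact indicator_of_notMem hyt _
  have hws : ∀ i, ContDiff ℝ ∞ (w i) := by
    intro i
    refine contDiff_iff_contDiffAt.2 fun y ↦ ?_
    by_cases hyt : y ∈ c.target
    · have hWs : ContDiffAt ℝ ∞ W y := by
        have := (isSmoothAlongAt_iff (q := p) contMDiffAt_id (mem_source_of_target hyt)
          (mem_source_of_target hyt)).1 (hV (c.symm y))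
        rwa [c.right_inv hyt] at this
      have h1 : ContDiffAt ℝ ∞ (fun y ↦ W y i) y :=
        (EuclideanSpace.proj i : Coord m →L[ℝ] ℝ).contDiff.contDiffAt.comp _ hWs
      refine ((contDiffAt_volumeDensity h hyt).mul h1).congr_of_eventuallyEq ?_
      filter_upwards [extChartAt_target_mem_nhds' hyt] with z hz
      exact indicator_of_mem hz _
    · have : w i =ᶠ[𝓝 y] fun _ ↦ 0 := by
        have hn : y ∉ c '' K := by
          rintro ⟨x, hx, rfl⟩
          exact hyt (c.map_source (mem_source_iff.2 (hKp hx)))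
        filter_upwards [hcK.isClosed.isOpen_compl.mem_nhds hn] with z hz
        exact hw0 i z hz
      exact contDiffAt_const.congr_of_eventuallyEq this
  have hwc : ∀ i, HasCompactSupport (w i) := fun i ↦ HasCompactSupport.intro hcK (hw0 i)
  have hdiv0 : ∀ x ∉ (chartAt (Coord m) p).source, divergence h V x = 0 := by
    intro x hx
    have hxK : x ∉ K := fun hxK ↦ hx (hKp hxK)
    have h1 : localField m (id : S → S) V x x =ᶠ[𝓝 (extChartAt (𝓡 m) x x)] fun _ ↦ 0 := by
      have h2 := (continuousAt_extChartAt_symm (I := 𝓡 m) x).preimage_mem_nhds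
        (t := Kᶜ) (by rw [extChartAt_to_inv]; exact hK.isClosed.isOpen_compl.mem_nhds hxK)
      filter_upwards [h2] with z hz
      simp only [localField]
      rw [hVK _ hz]
      exact map_zero (coordsL x _)
    rw [divergence_eq_trace h (mem_chart_source (Coord m) x) (hV x)]
    have : covL h V x (extChartAt (𝓡 m) x x) = 0 := by
      refine LinearMap.ext fun u ↦ ?_
      change cov _ _ _ _ _ = _
      rw [cov, h1.fderiv_eq, h1.self_of_nhds]
      simp
    rw [this, map_zero]
  have hcont : Continuous (divergence h V) := continuous_iff_continuousAt.2 fun x ↦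
    continuousAt_divergence h (Filter.Eventually.of_forall hV)
  rw [integral_volumeMeasure h hcont hdiv0,
    ← integral_indicator (measurableSet_target p)]
  have heq : (c.target.indicator fun y ↦ volumeDensity h p y * divergence h V (c.symm y))
      = fun y ↦ ∑ i, fderiv ℝ (w i) y (EuclideanSpace.single i 1) := by
    ext y
    by_cases hyt : y ∈ c.target
    · rw [indicator_of_mem hyt]
      have h1 := sum_fderiv_density_mul h (mem_source_of_target hyt) (hV (c.symm y))
      rw [← hc, c.right_inv hyt] at h1
      rw [← h1]
      refine Finset.sum_congr rfl fun i _ ↦ ?_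
      have : w i =ᶠ[𝓝 y] fun y ↦ volumeDensity h p y * W y i := by
        filter_upwards [extChartAt_target_mem_nhds' hyt] with z hz
        exact indicator_of_mem hz _
      rw [this.fderiv_eq]
    · rw [indicator_of_notMem hyt]
      refine (Finset.sum_eq_zero fun i _ ↦ ?_).symm
      have : w i =ᶠ[𝓝 y] fun _ ↦ 0 := by
        have hn : y ∉ c '' K := by
          rintro ⟨x, hx, rfl⟩
          exact hyt (c.map_source (mem_source_iff.2 (hKp hx)))
        filter_upwards [hcK.isClosed.isOpen_compl.mem_nhds hn] with z hz
        exact hw0 i z hz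
      rw [this.fderiv_eq]
      simp
  rw [heq, integral_finsetSum _ fun i _ ↦ (integral_fderiv_eq_zero (hws i) (hwc i) _).1]
  exact Finset.sum_eq_zero fun i _ ↦ (integral_fderiv_eq_zero (hws i) (hwc i) _).2

variable [T2Space S] [CompactSpace S]

lemma integrable_of_continuous (h : SemiRiemannianMetric m S) {F : S → ℝ} (hF : Continuous F) :
    Integrable F (volumeMeasure h) := by
  have := isLocallyFiniteMeasure_volumeMeasure h
  exact hF.integrable_of_hasCompactSupport (HasCompactSupport.of_compactSpace F)

/-- The divergence theorem on a closed semi-Riemannian manifold. -/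
theorem integral_divergence (h : SemiRiemannianMetric m S)
    {V : ∀ x : S, TangentSpace (𝓡 m) x} (hV : ∀ x, IsSmoothAlongAt m (id : S → S) V x) :
    Continuous (divergence h V) ∧ ∫ x, divergence h V x ∂(volumeMeasure h) = 0 := by
  have hcontV : ∀ {V : ∀ x : S, TangentSpace (𝓡 m) x},
      (∀ x, IsSmoothAlongAt m (id : S → S) V x) → Continuous (divergence h V) := fun hV ↦
    continuous_iff_continuousAt.2 fun x ↦ continuousAt_divergence h (Filter.Eventually.of_forall hV)
  refine ⟨hcontV hV, ?_⟩
  obtain ⟨t, ht⟩ := isCompact_univ.elim_finite_subcover (fun p : S ↦ (chartAt (Coord m) p).source)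
    (fun p ↦ (chartAt (Coord m) p).open_source)
    (fun x _ ↦ mem_iUnion.2 ⟨x, mem_chart_source (Coord m) x⟩)
  -- a partition of unity reduces to fields supported in charts
  obtain ⟨ρ, hρ⟩ := SmoothPartitionOfUnity.exists_isSubordinate (𝓡 m) (isClosed_univ (X := S))
    (fun p : {p // p ∈ t} ↦ (chartAt (Coord m) p.1).source)
    (fun p ↦ (chartAt (Coord m) p.1).open_source)
    (fun x _ ↦ by
      obtain ⟨p, hp, hx⟩ := mem_iUnion₂.1 (ht (mem_univ x))
      exact mem_iUnion.2 ⟨⟨p, hp⟩, hx⟩)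
  have hsum : ∀ x, ∑ j, ρ j x = 1 := by
    intro x
    rw [← finsum_eq_sum_of_fintype]
    exact ρ.sum_eq_one (mem_univ x)
  have hlf : ∀ j (p : S), localField m (id : S → S) (fun x ↦ ρ j x • V x) p p
      = fun y ↦ ρ j ((extChartAt (𝓡 m) p).symm y) • localField m (id : S → S) V p p y := by
    intro j p
    ext1 y
    exact coords_smul p _ _ _
  have hρV : ∀ j x, IsSmoothAlongAt m (id : S → S) (fun x ↦ ρ j x • V x) x := by
    intro j x
    have hx := mem_chart_source (Coord m) x
    refine (isSmoothAlongAt_iff contMDiffAt_id hx hx).2 ?_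
    rw [hlf]
    exact (contDiffAt_comp_symm (ρ j).contMDiff.contMDiffAt hx).smul
      ((isSmoothAlongAt_iff contMDiffAt_id hx hx).1 (hV x))
  have hdiv : divergence h V = fun x ↦ ∑ j, divergence h (fun x ↦ ρ j x • V x) x := by
    ext x
    have hx := mem_chart_source (Coord m) x
    rw [divergence_eq_trace h hx (hV x)]
    simp_rw [divergence_eq_trace h hx (hρV _ x)]
    rw [← map_sum]
    congr 1
    refine LinearMap.ext fun u ↦ ?_
    rw [LinearMap.sum_apply]
    change cov _ _ _ _ _ = ∑ j, cov _ _ _ _ _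
    have h1 : localField m (id : S → S) V x x = fun y ↦ ∑ j,
        localField m (id : S → S) (fun x ↦ ρ j x • V x) x x y := by
      ext1 y
      simp_rw [hlf]
      rw [← Finset.sum_smul, hsum, one_smul]
    simp only [cov]
    rw [Finset.sum_add_distrib, ← map_sum, h1, fderiv_fun_sum, sum_apply]
    exact fun j _ ↦ ((isSmoothAlongAt_iff contMDiffAt_id hx hx).1 (hρV j x)).differentiableAt
      (by simp)
  rw [hdiv, integral_finsetSum _ fun j _ ↦ integrable_of_continuous h (hcontV (hρV j))]
  refine Finset.sum_eq_zero fun j _ ↦ ?_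
  refine integral_divergence_of_support h (hρV j) (p := j.1) (K := tsupport (ρ j))
    (isClosed_tsupport _).isCompact (hρ j) fun x hx ↦ ?_
  rw [image_eq_zero_of_notMem_tsupport hx, zero_smul]

end Divergence

/-! ### Frames that are parallel at a point -/

section ParallelFrame

open Filter Topology Set

variable {m : ℕ}
  {S : Type*} [TopologicalSpace S] [ChartedSpace (Coord m) S] [IsManifold (𝓡 m) ∞ S]

/-- The `s`-th vector of a frame near `p` that is parallel at `p`, in coordinates. -/
def parVec (h : SemiRiemannianMetric m S) (p : S) (s : Fin m) (y : Coord m) : Coord m :=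
  parallelAt (connLoc h p) (extChartAt (𝓡 m) p p) (EuclideanSpace.single s 1) y

/-- The frame with coordinates `parVec`, at the point with coordinates `y`. -/
def parFrame (h : SemiRiemannianMetric m S) (p : S) (y : Coord m) (s : Fin m) :
    TangentSpace (𝓡 m) ((extChartAt (𝓡 m) p).symm y) :=
  ofCoords p _ (parVec h p s y)

/-- The inverse of the Gram matrix of `parFrame`. -/
def parInv (h : SemiRiemannianMetric m S) (p : S) (y : Coord m) : Matrix (Fin m) (Fin m) ℝ :=
  (gram h _ (parFrame h p y))⁻¹

lemma contDiff_parVec (h : SemiRiemannianMetric m S) (p : S) (s : Fin m) (y : Coord m) :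
    ContDiffAt ℝ ∞ (parVec h p s) y :=
  contDiffAt_parallelAt _ _ _ _

lemma parVec_self (h : SemiRiemannianMetric m S) (p : S) (s : Fin m) :
    parVec h p s (extChartAt (𝓡 m) p p) = EuclideanSpace.single s 1 :=
  parallelAt_self _ _ _

lemma coords_parFrame (h : SemiRiemannianMetric m S) {p : S} {y : Coord m}
    (hy : y ∈ (extChartAt (𝓡 m) p).target) (s : Fin m) :
    coords p _ (parFrame h p y s) = parVec h p s y :=
  coords_ofCoords (mem_source_of_target hy) _

lemma gram_parFrame (h : SemiRiemannianMetric m S) {p : S} {y : Coord m}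
    (s t : Fin m) :
    gram h _ (parFrame h p y) s t = metricLoc h p y (parVec h p s y) (parVec h p t y) := by
  rw [metricLoc_eq]
  rfl

lemma gram_parFrame_self (h : SemiRiemannianMetric m S) (p : S) :
    gram h _ (parFrame h p (extChartAt (𝓡 m) p p)) = gram h p (frame p) := by
  ext s t
  rw [gram_parFrame, parVec_self, parVec_self, ← coords_frame p s, ← coords_frame p t,
    metricLoc_coords h (mem_chart_source _ p)]
  rfl

lemma parInv_self (h : SemiRiemannianMetric m S) (p : S) :
    parInv h p (extChartAt (𝓡 m) p p) = inverseMetric h p := by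
  rw [parInv, gram_parFrame_self]
  rfl

lemma contDiffAt_gram_parFrame (h : SemiRiemannianMetric m S) (p : S) (s t : Fin m) :
    ContDiffAt ℝ ∞ (fun y ↦ gram h _ (parFrame h p y) s t) (extChartAt (𝓡 m) p p) := by
  simp_rw [gram_parFrame]
  exact ((contDiffAt_metricLoc h (mem_extChartAt_target p)).clm_apply
    (contDiff_parVec h p s _)).clm_apply (contDiff_parVec h p t _)

lemma cov_parVec (h : SemiRiemannianMetric m S) (p : S) (s : Fin m) (u : Coord m) :
    cov (connLoc h p) (fun y ↦ y) (parVec h p s) (extChartAt (𝓡 m) p p) u = 0 := by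
  have h1 : fderiv ℝ (parVec h p s) (extChartAt (𝓡 m) p p) u = _ := fderiv_parallelAt _ _ _ _ u
  rw [cov, h1, parVec_self, fderiv_fun_id]
  simp

/-- The Gram matrix of a frame that is parallel at `p` has vanishing derivative at `p`. -/
lemma fderiv_gram_parFrame (h : SemiRiemannianMetric m S) (p : S) (s t : Fin m) (u : Coord m) :
    fderiv ℝ (fun y ↦ gram h _ (parFrame h p y) s t) (extChartAt (𝓡 m) p p) u = 0 := by
  simp_rw [gram_parFrame]
  have hy := mem_extChartAt_target (I := 𝓡 m) p
  rw [fderiv_inner_cov (F := fun y : Coord m ↦ y) (isLeviCivitaAt_connLoc h hy)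
    ((contDiffAt_metricLoc h hy).differentiableAt (by simp))
    (Filter.Eventually.of_forall fun z u v ↦ metricLoc_symm h p z u v) differentiableAt_id
    ((contDiff_parVec h p s _).differentiableAt (by simp))
    ((contDiff_parVec h p t _).differentiableAt (by simp)), cov_parVec, cov_parVec]
  simp

lemma det_gram_parFrame_self (h : SemiRiemannianMetric m S) (p : S) :
    (gram h _ (parFrame h p (extChartAt (𝓡 m) p p))).det ≠ 0 := by
  rw [gram_parFrame_self]
  exact det_gram_frame h p

lemma contDiffAt_parInv (h : SemiRiemannianMetric m S) (p : S) (s t : Fin m) :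
    ContDiffAt ℝ ∞ (fun y ↦ parInv h p y s t) (extChartAt (𝓡 m) p p) :=
  contDiffAt_matrix_inv (A := fun y ↦ gram h _ (parFrame h p y))
    (fun i j ↦ contDiffAt_gram_parFrame h p i j) (det_gram_parFrame_self h p) s t

lemma fderiv_parInv (h : SemiRiemannianMetric m S) (p : S) (s t : Fin m) (u : Coord m) :
    fderiv ℝ (fun y ↦ parInv h p y s t) (extChartAt (𝓡 m) p p) u = 0 := by
  set y₀ := extChartAt (𝓡 m) p p
  set A : Coord m → Matrix (Fin m) (Fin m) ℝ := fun y ↦ gram h _ (parFrame h p y)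
  have hQ : ∀ i j, DifferentiableAt ℝ (fun y ↦ parInv h p y i j) y₀ := fun i j ↦
    (contDiffAt_parInv h p i j).differentiableAt (by simp)
  have hA : ∀ i j, DifferentiableAt ℝ (fun y ↦ A y i j) y₀ := fun i j ↦
    (contDiffAt_gram_parFrame h p i j).differentiableAt (by simp)
  have hdet : ∀ᶠ y in 𝓝 y₀, (A y).det ≠ 0 :=
    (contDiffAt_det fun i j ↦ contDiffAt_gram_parFrame h p i j).continuousAt.eventually_ne
      (det_gram_parFrame_self h p)
  have h0 : (Matrix.of fun i j ↦ fderiv ℝ (fun y ↦ parInv h p y i j) y₀ u) * A y₀ = 0 := by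
    ext i j
    have h1 : (fun y ↦ ∑ k, parInv h p y i k * A y k j)
        =ᶠ[𝓝 y₀] fun _ ↦ (1 : Matrix (Fin m) (Fin m) ℝ) i j := by
      filter_upwards [hdet] with y hy
      rw [← Matrix.nonsing_inv_mul (A y) (isUnit_iff_ne_zero.2 hy)]
      rfl
    have h2 := congrArg (fun L : Coord m →L[ℝ] ℝ ↦ L u) h1.fderiv_eq
    simp only [fderiv_const_apply, zero_apply] at h2
    rw [fderiv_fun_sum fun k _ ↦ (hQ i k).fun_mul (hA k j), sum_apply] at h2
    rw [Matrix.mul_apply, Matrix.zero_apply, ← h2]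
    refine Finset.sum_congr rfl fun k _ ↦ ?_
    rw [fderiv_fun_mul (hQ i k) (hA k j)]
    simp only [add_apply, smul_apply, smul_eq_mul, Matrix.of_apply]
    rw [fderiv_gram_parFrame]
    ring
  have h3 : (Matrix.of fun i j ↦ fderiv ℝ (fun y ↦ parInv h p y i j) y₀ u) = 0 := by
    have := congrArg (· * (A y₀)⁻¹) h0
    simpa [Matrix.mul_assoc, Matrix.mul_nonsing_inv (A y₀)
      (isUnit_iff_ne_zero.2 (det_gram_parFrame_self h p))] using this
  exact congrFun (congrFun h3 s) t

lemma contDiffAt_minor_parInv (h : SemiRiemannianMetric m S) (p : S) {k : ℕ} (I L : Fin k → Fin m) :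
    ContDiffAt ℝ ∞ (fun y ↦ ((parInv h p y).submatrix I L).det) (extChartAt (𝓡 m) p p) :=
  contDiffAt_det fun i j ↦ contDiffAt_parInv h p (I i) (L j)

lemma fderiv_minor_parInv (h : SemiRiemannianMetric m S) (p : S) {k : ℕ} (I L : Fin k → Fin m)
    (u : Coord m) :
    fderiv ℝ (fun y ↦ ((parInv h p y).submatrix I L).det) (extChartAt (𝓡 m) p p) u = 0 := by
  rw [fderiv_det (A := fun y ↦ (parInv h p y).submatrix I L) fun i j ↦
    (contDiffAt_parInv h p (I i) (L j)).differentiableAt (by simp)]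
  have : (Matrix.of fun i j ↦ fderiv ℝ (fun z ↦ (parInv h p z).submatrix I L i j)
      (extChartAt (𝓡 m) p p) u) = 0 := by
    ext i j
    exact fderiv_parInv h p (I i) (L j) u
  rw [this, Matrix.mul_zero, Matrix.trace_zero]

/-- Near `p` every vector is a combination of the vectors of `parFrame`. -/
lemma eventually_exists_parFrame (h : SemiRiemannianMetric m S) (p : S) :
    ∀ᶠ y in 𝓝 (extChartAt (𝓡 m) p p), y ∈ (extChartAt (𝓡 m) p).target ∧
      ∃ P : Matrix (Fin m) (Fin m) ℝ, ∀ i,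
        frame ((extChartAt (𝓡 m) p).symm y) i = ∑ s, P i s • parFrame h p y s := by
  set E : Coord m → Matrix (Fin m) (Fin m) ℝ := fun y ↦ Matrix.of fun s t ↦ parVec h p s y t
  have hE : ∀ i j, ContDiffAt ℝ ∞ (fun y ↦ E y i j) (extChartAt (𝓡 m) p p) := fun i j ↦
    (EuclideanSpace.proj j : Coord m →L[ℝ] ℝ).contDiff.contDiffAt.comp _ (contDiff_parVec h p i _)
  have h0 : E (extChartAt (𝓡 m) p p) = 1 := by
    ext i j
    change parVec h p i _ j = _
    rw [parVec_self, Matrix.one_apply]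
    simp [eq_comm]
  have hdet : ∀ᶠ y in 𝓝 (extChartAt (𝓡 m) p p), (E y).det ≠ 0 :=
    (contDiffAt_det hE).continuousAt.eventually_ne (by rw [h0, Matrix.det_one]; exact one_ne_zero)
  filter_upwards [hdet, extChartAt_target_mem_nhds' (mem_extChartAt_target p)] with y hy hyt
  refine ⟨hyt, (Matrix.of fun i t ↦ coords p _ (frame ((extChartAt (𝓡 m) p).symm y) i) t) * (E y)⁻¹,
    fun i ↦ coords_injective (mem_source_of_target hyt) ?_⟩
  rw [coords_sum]
  simp_rw [coords_smul, coords_parFrame h hyt]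
  ext t
  have h1 := congrFun (congrFun (Matrix.nonsing_inv_mul_cancel_right (E y)
    (Matrix.of fun i t ↦ coords p _ (frame ((extChartAt (𝓡 m) p).symm y) i) t)
    (isUnit_iff_ne_zero.2 hy)) i) t
  rw [Matrix.mul_apply] at h1
  simp only [Matrix.of_apply, E] at h1
  rw [← h1]
  simp [E]

end ParallelFrame

/-! ### Newton coefficients -/

section Newton

open Filter Topology Set

variable {m n : ℕ}
  {S : Type*} [TopologicalSpace S] [ChartedSpace (Coord m) S] [IsManifold (𝓡 m) ∞ S]
  {M : Type*} [TopologicalSpace M] [ChartedSpace (Coord n) M] [IsManifold (𝓡 n) ∞ M]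
  {h : SemiRiemannianMetric m S} {g : SemiRiemannianMetric n M} {φ : S → M}

/-- The components `T^{il}`, up to the factor `k!`, of the Newton tensor built from the second
fundamental form and the multilinear form `μ`, in the frame `e`. -/
def newtonCoeff (h : SemiRiemannianMetric m S) (g : SemiRiemannianMetric n M) (φ : S → M) (x : S)
    {k : ℕ} (μ : MultilinearMap ℝ (fun _ : Fin k ↦ TangentSpace (𝓡 n) (φ x)) ℝ)
    (e : Fin m → TangentSpace (𝓡 m) x) (i l : Fin m) : ℝ :=
  ∑ I : Fin k → Fin m, ∑ L : Fin k → Fin m,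
    ((gram h x e)⁻¹.submatrix (Fin.cons i I : Fin (k + 1) → Fin m) (Fin.cons l L)).det
      * μ fun a ↦ secondFundamentalForm h g φ x (e (I a)) (e (L a))

lemma frameContract_eq_sum (x : S)
    {k : ℕ} (μ : MultilinearMap ℝ (fun _ : Fin k ↦ TangentSpace (𝓡 n) (φ x)) ℝ)
    (C : TangentSpace (𝓡 m) x → TangentSpace (𝓡 m) x → ℝ) (e : Fin m → TangentSpace (𝓡 m) x) :
    frameContract h g φ x μ C e = ∑ i, ∑ l, C (e i) (e l) * newtonCoeff h g φ x μ e i l :=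
  contract_consTensor _ _ _

lemma secondFundamentalForm_symm (hφ : IsIsometricImmersion h g φ) (x : S)
    (u v : TangentSpace (𝓡 m) x) :
    secondFundamentalForm h g φ x u v = secondFundamentalForm h g φ x v u := by
  have hx := mem_chart_source (Coord m) x
  have hq := mem_chart_source (Coord n) (φ x)
  refine coords_injective hq ?_
  rw [coords_secondFundamentalForm hφ hx hq, coords_secondFundamentalForm hφ hx hq]
  have hyt := mem_extChartAt_target (I := 𝓡 m) x
  have hqt := mem_extChartAt_target (I := 𝓡 n) (φ x)
  refine secondForm_symm (contDiffAt_localMap (hφ.contMDiff _) hx hq) ?_ ?_ _ _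
  · rw [localMap_apply hx]
    exact (isLeviCivitaAt_connLoc g hqt).symm
      ((contDiffAt_metricLoc g hqt).differentiableAt (by simp))
      (Filter.Eventually.of_forall fun z u v ↦ metricLoc_symm g _ z u v)
      (metricLoc_nondegenerate g hqt)
  · exact (isLeviCivitaAt_connLoc h hyt).symm
      ((contDiffAt_metricLoc h hyt).differentiableAt (by simp))
      (Filter.Eventually.of_forall fun z u v ↦ metricLoc_symm h _ z u v)
      (metricLoc_nondegenerate h hyt)

/-- The Newton tensor is symmetric, since the metric and the second fundamental form are. -/
lemma newtonCoeff_symm (hφ : IsIsometricImmersion h g φ) (x : S)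
    {k : ℕ} (μ : MultilinearMap ℝ (fun _ : Fin k ↦ TangentSpace (𝓡 n) (φ x)) ℝ)
    (e : Fin m → TangentSpace (𝓡 m) x) (i l : Fin m) :
    newtonCoeff h g φ x μ e i l = newtonCoeff h g φ x μ e l i := by
  have hsymm : ((gram h x e)⁻¹)ᵀ = (gram h x e)⁻¹ := by
    rw [Matrix.transpose_nonsing_inv]
    congr 1
    ext s t
    exact h.symm x _ _
  rw [newtonCoeff, Finset.sum_comm]
  refine Finset.sum_congr rfl fun L _ ↦ Finset.sum_congr rfl fun I _ ↦ ?_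
  rw [det_submatrix_comm hsymm]
  congr 2
  ext a
  exact secondFundamentalForm_symm hφ x _ _

/-- Only the symmetric part of `C` enters in the contraction. -/
lemma frameContract_flip (hφ : IsIsometricImmersion h g φ) (x : S)
    {k : ℕ} (μ : MultilinearMap ℝ (fun _ : Fin k ↦ TangentSpace (𝓡 n) (φ x)) ℝ)
    (C : TangentSpace (𝓡 m) x → TangentSpace (𝓡 m) x → ℝ) (e : Fin m → TangentSpace (𝓡 m) x) :
    frameContract h g φ x μ (fun u v ↦ C v u) e = frameContract h g φ x μ C e := by
  rw [frameContract_eq_sum, frameContract_eq_sum, Finset.sum_comm]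
  refine Finset.sum_congr rfl fun i _ ↦ Finset.sum_congr rfl fun l _ ↦ ?_
  rw [newtonCoeff_symm hφ]

/-- Consequence of the conformal Killing equation: only the symmetric part of `∇X` enters. -/
lemma frameContract_conformal (hφ : IsIsometricImmersion h g φ)
    {X : ∀ x : S, TangentSpace (𝓡 n) (φ x)} {α : S → ℝ} (hα : IsConformalAlong h g φ X α) (x : S)
    {k : ℕ} (μ : MultilinearMap ℝ (fun _ : Fin k ↦ TangentSpace (𝓡 n) (φ x)) ℝ)
    (e : Fin m → TangentSpace (𝓡 m) x) :
    frameContract h g φ x μ (fun u v ↦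
        g.inner (φ x) (covDerivAlong g φ X x u) (mfderiv (𝓡 m) (𝓡 n) φ x v)) e
      = α x * frameContract h g φ x μ (fun u v ↦ h.inner x u v) e := by
  set C : TangentSpace (𝓡 m) x → TangentSpace (𝓡 m) x → ℝ := fun u v ↦
    g.inner (φ x) (covDerivAlong g φ X x u) (mfderiv (𝓡 m) (𝓡 n) φ x v)
  have h1 := frameContract_flip hφ x μ C e
  have h2 : frameContract h g φ x μ C e + frameContract h g φ x μ (fun u v ↦ C v u) e
      = 2 * α x * frameContract h g φ x μ (fun u v ↦ h.inner x u v) e := by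
    simp only [frameContract_eq_sum, Finset.mul_sum, ← Finset.sum_add_distrib]
    refine Finset.sum_congr rfl fun i _ ↦ Finset.sum_congr rfl fun l _ ↦ ?_
    rw [← add_mul, hα x (e i) (e l)]
    ring
  linarith

end Newton

/-! ### The divergence of the Newton field -/

section NewtonField

open Filter Topology Set

variable {m n : ℕ}
  {S : Type*} [TopologicalSpace S] [ChartedSpace (Coord m) S] [IsManifold (𝓡 m) ∞ S]
  {M : Type*} [TopologicalSpace M] [ChartedSpace (Coord n) M] [IsManifold (𝓡 n) ∞ M]
  {h : SemiRiemannianMetric m S} {g : SemiRiemannianMetric n M} {φ : S → M}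

/-- The tensor `μ(A(e_{i₁}, e_{l₁}), …, A(e_{i_k}, e_{l_k}))` in the frame `parFrame`. -/
def localTensor (h : SemiRiemannianMetric m S) (g : SemiRiemannianMetric n M) (φ : S → M) {k : ℕ}
    (μ : ∀ x, MultilinearMap ℝ (fun _ : Fin k ↦ TangentSpace (𝓡 n) (φ x)) ℝ) (p : S)
    (I L : Fin k → Fin m) (y : Coord m) : ℝ :=
  μ ((extChartAt (𝓡 m) p).symm y) fun a ↦ secondFundamentalForm h g φ _
    (parFrame h p y (I a)) (parFrame h p y (L a))

/-- The condition on a field `μ` of multilinear forms that makes the Newton tensor built from it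
smooth and divergence free. -/
structure IsCodazziForm (h : SemiRiemannianMetric m S) (g : SemiRiemannianMetric n M) (φ : S → M)
    {k : ℕ} (μ : ∀ x, MultilinearMap ℝ (fun _ : Fin k ↦ TangentSpace (𝓡 n) (φ x)) ℝ) : Prop where
  smooth (p : S) (I L : Fin k → Fin m) :
    ContDiffAt ℝ ∞ (localTensor h g φ μ p I L) (extChartAt (𝓡 m) p p)
  divergence_free (p : S) (l : Fin m) :
    ∑ i, ∑ I : Fin k → Fin m, ∑ L : Fin k → Fin m, ((inverseMetric h p).submatrix
        (Fin.cons i I : Fin (k + 1) → Fin m) (Fin.cons l L)).det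
      * fderiv ℝ (localTensor h g φ μ p I L) (extChartAt (𝓡 m) p p) (EuclideanSpace.single i 1) = 0

/-- The vector field `f T(X^T)`, up to the factor `k!`. -/
def newtonField (h : SemiRiemannianMetric m S) (g : SemiRiemannianMetric n M) (φ : S → M) {k : ℕ}
    (μ : ∀ x, MultilinearMap ℝ (fun _ : Fin k ↦ TangentSpace (𝓡 n) (φ x)) ℝ) (f : S → ℝ)
    (X : ∀ x : S, TangentSpace (𝓡 n) (φ x)) (x : S) : TangentSpace (𝓡 m) x :=
  ∑ i, (f x * ∑ l, g.inner (φ x) (X x) (mfderiv (𝓡 m) (𝓡 n) φ x (frame x l))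
    * newtonCoeff h g φ x (μ x) (frame x) i l) • frame x i

variable {k : ℕ} {μ : ∀ x, MultilinearMap ℝ (fun _ : Fin k ↦ TangentSpace (𝓡 n) (φ x)) ℝ}
  {f : S → ℝ} {X : ∀ x : S, TangentSpace (𝓡 n) (φ x)}

lemma newtonField_eq (hφ : IsIsometricImmersion h g φ) (x : S) {e : Fin m → TangentSpace (𝓡 m) x}
    {P : Matrix (Fin m) (Fin m) ℝ} (he : ∀ i, frame x i = ∑ s, P i s • e s) :
    newtonField h g φ μ f X x = ∑ i, (f x * ∑ l, g.inner (φ x) (X x)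
      (mfderiv (𝓡 m) (𝓡 n) φ x (e l)) * newtonCoeff h g φ x (μ x) e i l) • e i := by
  refine eq_of_inner_eq h x fun w ↦ ?_
  have key : ∀ e' : Fin m → TangentSpace (𝓡 m) x, h.inner x (∑ i, (f x * ∑ l, g.inner (φ x) (X x)
      (mfderiv (𝓡 m) (𝓡 n) φ x (e' l)) * newtonCoeff h g φ x (μ x) e' i l) • e' i) w
      = f x * frameContract h g φ x (μ x) (fun u v ↦ ((h.inner x w).toLinearMap.smulRight
        (innerDifferential g φ x (X x))) u v) e' := by
    intro e'
    rw [frameContract_eq_sum, inner_sum_left, Finset.mul_sum]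
    refine Finset.sum_congr rfl fun i _ ↦ ?_
    rw [inner_smul_left, mul_assoc, Finset.sum_mul]
    congr 1
    refine Finset.sum_congr rfl fun l _ ↦ ?_
    change _ = h.inner x w (e' i) * g.inner (φ x) (X x) (mfderiv (𝓡 m) (𝓡 n) φ x (e' l)) * _
    rw [h.symm]
    ring
  rw [newtonField, key, key, frameContract_eq hφ x (μ x) _ he]

lemma newtonCoeff_parFrame (p : S) (y : Coord m) (i l : Fin m) :
    newtonCoeff h g φ _ (μ _) (parFrame h p y) i l = ∑ I : Fin k → Fin m, ∑ L : Fin k → Fin m,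
      ((parInv h p y).submatrix (Fin.cons i I : Fin (k + 1) → Fin m) (Fin.cons l L)).det
        * localTensor h g φ μ p I L y := rfl

lemma newtonCoeff_parFrame_self (p : S) (i l : Fin m) :
    newtonCoeff h g φ _ (μ _) (parFrame h p (extChartAt (𝓡 m) p p)) i l
      = newtonCoeff h g φ p (μ p) (frame p) i l := by
  have h1 : parFrame h p (extChartAt (𝓡 m) p p)
      = fun s ↦ ofCoords p _ (EuclideanSpace.single s 1) := by
    ext1 s
    rw [parFrame, parVec_self]
  rw [h1]
  have h2 : ∀ z, z = p → newtonCoeff h g φ z (μ z)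
      (fun s ↦ ofCoords p z (EuclideanSpace.single s 1)) i l
      = newtonCoeff h g φ p (μ p) (frame p) i l := by
    rintro z rfl
    rfl
  exact h2 _ (extChartAt_to_inv p)

lemma contDiffAt_newtonCoeff (hμ : IsCodazziForm h g φ μ) (p : S) (i l : Fin m) :
    ContDiffAt ℝ ∞ (fun y ↦ newtonCoeff h g φ _ (μ _) (parFrame h p y) i l)
      (extChartAt (𝓡 m) p p) := by
  simp_rw [newtonCoeff_parFrame]
  exact ContDiffAt.sum fun I _ ↦ ContDiffAt.sum fun L _ ↦
    (contDiffAt_minor_parInv h p _ _).mul (hμ.smooth p I L)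

/-- The divergence of the Newton tensor: the coefficients built from the metric have vanishing
derivative, and what remains is the condition on `μ`. -/
lemma sum_fderiv_newtonCoeff (hμ : IsCodazziForm h g φ μ) (p : S) (l : Fin m) :
    ∑ i, fderiv ℝ (fun y ↦ newtonCoeff h g φ _ (μ _) (parFrame h p y) i l)
      (extChartAt (𝓡 m) p p) (EuclideanSpace.single i 1) = 0 := by
  rw [← hμ.divergence_free p l]
  refine Finset.sum_congr rfl fun i _ ↦ ?_
  simp_rw [newtonCoeff_parFrame]
  have hQ : ∀ I L : Fin k → Fin m, DifferentiableAt ℝ (fun y ↦ ((parInv h p y).submatrix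
      (Fin.cons i I : Fin (k + 1) → Fin m) (Fin.cons l L)).det) (extChartAt (𝓡 m) p p) :=
    fun I L ↦ (contDiffAt_minor_parInv h p _ _).differentiableAt (by simp)
  have hT : ∀ I L, DifferentiableAt ℝ (localTensor h g φ μ p I L) (extChartAt (𝓡 m) p p) :=
    fun I L ↦ (hμ.smooth p I L).differentiableAt (by simp)
  rw [fderiv_fun_sum fun I _ ↦ DifferentiableAt.fun_sum fun L _ ↦ (hQ I L).fun_mul (hT I L),
    sum_apply]
  refine Finset.sum_congr rfl fun I _ ↦ ?_
  rw [fderiv_fun_sum fun L _ ↦ (hQ I L).fun_mul (hT I L), sum_apply]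
  refine Finset.sum_congr rfl fun L _ ↦ ?_
  rw [fderiv_fun_mul (hQ I L) (hT I L)]
  simp only [add_apply, smul_apply, smul_eq_mul]
  rw [fderiv_minor_parInv, parInv_self]
  ring

/-- The function `X · dφ(e_l)` for the vectors `e_l` of `parFrame`, in coordinates. -/
lemma eventually_inner_parFrame (hφ : IsIsometricImmersion h g φ) (p : S)
    {X : ∀ x : S, TangentSpace (𝓡 n) (φ x)} :
    ∀ᶠ y in 𝓝 (extChartAt (𝓡 m) p p), ∀ l,
      g.inner (φ ((extChartAt (𝓡 m) p).symm y)) (X ((extChartAt (𝓡 m) p).symm y))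
        (mfderiv (𝓡 m) (𝓡 n) φ _ (parFrame h p y l))
      = metricLoc g (φ p) (localMap m n φ p (φ p) y) (localField m φ X p (φ p) y)
          (fderiv ℝ (localMap m n φ p (φ p)) y (parVec h p l y)) := by
  filter_upwards [eventually_mem_charts (m := m) (n := n) (q := φ p)
    (hφ.contMDiff p).continuousAt (mem_chart_source _ p) (mem_chart_source _ (φ p))]
    with y ⟨hy, hyq⟩ l
  rw [← metricLoc_coords g hyq, coords_mfderiv (hφ.contMDiff _) (mem_source_of_target hy) hyq,
    coords_parFrame h hy, (extChartAt (𝓡 m) p).right_inv hy]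
  rfl

lemma contDiffAt_inner_parVec (hφ : IsIsometricImmersion h g φ) (p : S) {Y : Coord m → Coord n}
    (hY : ContDiffAt ℝ ∞ Y (extChartAt (𝓡 m) p p)) (l : Fin m) :
    ContDiffAt ℝ ∞ (fun y ↦ metricLoc g (φ p) (localMap m n φ p (φ p) y) (Y y)
          (fderiv ℝ (localMap m n φ p (φ p)) y (parVec h p l y))) (extChartAt (𝓡 m) p p) := by
  have hF := contDiffAt_localMap (m := m) (n := n) (hφ.contMDiff p) (mem_chart_source _ p)
    (mem_chart_source _ (φ p))
  have hqt : localMap m n φ p (φ p) (extChartAt (𝓡 m) p p) ∈ (extChartAt (𝓡 n) (φ p)).target := by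
    rw [localMap_apply (mem_chart_source _ p)]
    exact mem_extChartAt_target _
  have hG : ContDiffAt ℝ ∞ (fun y ↦ metricLoc g (φ p) (localMap m n φ p (φ p) y))
    (extChartAt (𝓡 m) p p) := (contDiffAt_metricLoc g hqt).comp _ hF
  exact (hG.clm_apply hY).clm_apply ((contDiffAt_fderiv hF).clm_apply (contDiff_parVec h p l _))

/-- The derivative of `X · dφ(e_l)` at the base point. -/
lemma fderiv_inner_parVec (hφ : IsIsometricImmersion h g φ)
    (hX : ∀ x, IsSmoothAlongAt m φ X x) (p : S) (i l : Fin m) :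
    fderiv ℝ (fun y ↦ metricLoc g (φ p) (localMap m n φ p (φ p) y) (localField m φ X p (φ p) y)
          (fderiv ℝ (localMap m n φ p (φ p)) y (parVec h p l y))) (extChartAt (𝓡 m) p p)
        (EuclideanSpace.single i 1)
      = g.inner (φ p) (covDerivAlong g φ X p (frame p i)) (mfderiv (𝓡 m) (𝓡 n) φ p (frame p l))
        - g.inner (φ p) (X p) (secondFundamentalForm h g φ p (frame p i) (frame p l)) := by
  have hp := mem_chart_source (Coord m) p
  have hq := mem_chart_source (Coord n) (φ p)
  have hF := contDiffAt_localMap (m := m) (n := n) (hφ.contMDiff p) hp hq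
  have hFp : localMap m n φ p (φ p) (extChartAt (𝓡 m) p p) = extChartAt (𝓡 n) (φ p) (φ p) :=
    localMap_apply hp
  have hqt : localMap m n φ p (φ p) (extChartAt (𝓡 m) p p) ∈ (extChartAt (𝓡 n) (φ p)).target := by
    rw [hFp]
    exact mem_extChartAt_target _
  have hXs := (isSmoothAlongAt_iff (hφ.contMDiff p) hp hq).1 (hX p)
  rw [fderiv_inner_cov (isLeviCivitaAt_connLoc g hqt)
    ((contDiffAt_metricLoc g hqt).differentiableAt (by simp))
    (Filter.Eventually.of_forall fun z u v ↦ metricLoc_symm g _ z u v)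
    (hF.differentiableAt (by simp)) (hXs.differentiableAt (by simp))
    (((contDiffAt_fderiv hF).clm_apply (contDiff_parVec h p l _)).differentiableAt (by simp))]
  have h1 : cov (connLoc g (φ p)) (localMap m n φ p (φ p)) (fun y ↦ fderiv ℝ
      (localMap m n φ p (φ p)) y (parVec h p l y)) (extChartAt (𝓡 m) p p)
        (EuclideanSpace.single i 1)
      = - coords (φ p) (φ p) (secondFundamentalForm h g φ p (frame p i) (frame p l)) := by
    rw [coords_secondFundamentalForm hφ hp hq, coords_frame, coords_frame]
    exact cov_fderiv_parallelAt hF _ _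
  rw [h1, parVec_self, ← coords_frame p i, ← coords_frame p l,
    ← coords_covDerivAlong g (hφ.contMDiff p) (hX p) hp hq,
    ← coords_mfderiv (hφ.contMDiff p) hp hq, hFp, metricLoc_coords g hq, localField_apply hp,
    map_neg, metricLoc_coords g hq, sub_eq_add_neg]

/-- The Newton field in the chart, as a combination of the vectors of `parFrame`. -/
lemma localField_newtonField (hφ : IsIsometricImmersion h g φ) (p : S) :
    localField m (id : S → S) (newtonField h g φ μ f X) p p =ᶠ[𝓝 (extChartAt (𝓡 m) p p)]
      fun y ↦ ∑ i, (f ((extChartAt (𝓡 m) p).symm y) * ∑ l,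
        metricLoc g (φ p) (localMap m n φ p (φ p) y) (localField m φ X p (φ p) y)
          (fderiv ℝ (localMap m n φ p (φ p)) y (parVec h p l y))
        * newtonCoeff h g φ _ (μ _) (parFrame h p y) i l) • parVec h p i y := by
  filter_upwards [eventually_exists_parFrame h p, eventually_inner_parFrame hφ p (X := X)]
    with y ⟨hy, P, hP⟩ hy2
  simp_rw [← hy2, ← coords_parFrame h hy, ← coords_smul, ← coords_sum]
  rw [← newtonField_eq hφ _ hP]
  rfl

lemma contDiffAt_coeff_newtonField (hφ : IsIsometricImmersion h g φ) (hμ : IsCodazziForm h g φ μ)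
    (hf : ContMDiff (𝓡 m) 𝓘(ℝ, ℝ) ∞ f) (hX : ∀ x, IsSmoothAlongAt m φ X x) (p : S) (i : Fin m) :
    ContDiffAt ℝ ∞ (fun y ↦ f ((extChartAt (𝓡 m) p).symm y) * ∑ l,
        metricLoc g (φ p) (localMap m n φ p (φ p) y) (localField m φ X p (φ p) y)
          (fderiv ℝ (localMap m n φ p (φ p)) y (parVec h p l y))
        * newtonCoeff h g φ _ (μ _) (parFrame h p y) i l) (extChartAt (𝓡 m) p p) :=
  (contDiffAt_comp_symm hf.contMDiffAt (mem_chart_source _ p)).mul (ContDiffAt.sum fun l _ ↦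
    (contDiffAt_inner_parVec hφ p ((isSmoothAlongAt_iff (hφ.contMDiff p) (mem_chart_source _ p)
      (mem_chart_source _ _)).1 (hX p)) l).mul (contDiffAt_newtonCoeff hμ p i l))

lemma isSmoothAlongAt_newtonField (hφ : IsIsometricImmersion h g φ) (hμ : IsCodazziForm h g φ μ)
    (hf : ContMDiff (𝓡 m) 𝓘(ℝ, ℝ) ∞ f) (hX : ∀ x, IsSmoothAlongAt m φ X x) (p : S) :
    IsSmoothAlongAt m (id : S → S) (newtonField h g φ μ f X) p := by
  refine (isSmoothAlongAt_iff contMDiffAt_id (mem_chart_source _ p) (mem_chart_source _ p)).2 ?_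
  exact (ContDiffAt.sum fun i _ ↦ (contDiffAt_coeff_newtonField hφ hμ hf hX p i).smul
    (contDiff_parVec h p i _)).congr_of_eventuallyEq (localField_newtonField hφ p)

/-- The divergence of a combination of the vectors of `parFrame` at the base point. -/
lemma divergence_eq_sum_fderiv {V : ∀ x : S, TangentSpace (𝓡 m) x} (p : S)
    (hV : IsSmoothAlongAt m (id : S → S) V p) {a : Fin m → Coord m → ℝ}
    (ha : ∀ i, DifferentiableAt ℝ (a i) (extChartAt (𝓡 m) p p))
    (hVa : localField m (id : S → S) V p p =ᶠ[𝓝 (extChartAt (𝓡 m) p p)]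
      fun y ↦ ∑ i, a i y • parVec h p i y) :
    divergence h V p = ∑ i, fderiv ℝ (a i) (extChartAt (𝓡 m) p p) (EuclideanSpace.single i 1) := by
  set y₀ := extChartAt (𝓡 m) p p
  have hp := mem_chart_source (Coord m) p
  rw [divergence_eq_trace h hp hV, trace_eq_sum_apply_single]
  have hid : localMap m m (id : S → S) p p =ᶠ[𝓝 y₀] fun y ↦ y := by
    filter_upwards [extChartAt_target_mem_nhds' (mem_extChartAt_target p)] with z hz
    exact (extChartAt (𝓡 m) p).right_inv hz
  have hpar : ∀ i, DifferentiableAt ℝ (parVec h p i) y₀ := fun i ↦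
    (contDiff_parVec h p i _).differentiableAt (by simp)
  have h1 : ∀ u, covL h V p y₀ u = ∑ i, fderiv ℝ (a i) y₀ u • EuclideanSpace.single i (1 : ℝ) := by
    intro u
    change cov _ _ _ _ _ = _
    have h2 : ∀ i, fderiv ℝ (parVec h p i) y₀ u + connLoc h p y₀ u (EuclideanSpace.single i 1)
        = 0 := by
      intro i
      have := cov_parVec h p i u
      rw [cov, parVec_self, fderiv_fun_id] at this
      exact this
    rw [cov, hid.fderiv_eq, hid.self_of_nhds, hVa.fderiv_eq, hVa.self_of_nhds,
      fderiv_fun_sum fun i _ ↦ (ha i).fun_smul (hpar i), sum_apply, fderiv_fun_id, map_sum,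
      ← Finset.sum_add_distrib]
    refine Finset.sum_congr rfl fun i _ ↦ ?_
    rw [fderiv_fun_smul (ha i) (hpar i), parVec_self]
    simp only [add_apply, smul_apply, ContinuousLinearMap.smulRight_apply, map_smul,
      ContinuousLinearMap.id_apply]
    rw [add_right_comm, ← smul_add, h2, smul_zero, zero_add]
  refine Finset.sum_congr rfl fun i _ ↦ ?_
  rw [h1]
  simp [Pi.single_apply]

/-- The pointwise identity behind the integral formulas. -/
theorem divergence_newtonField (hφ : IsIsometricImmersion h g φ) (hμ : IsCodazziForm h g φ μ)
    (hf : ContMDiff (𝓡 m) 𝓘(ℝ, ℝ) ∞ f) (hX : ∀ x, IsSmoothAlongAt m φ X x) {α : S → ℝ}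
    (hα : IsConformalAlong h g φ X α) (p : S) :
    divergence h (newtonField h g φ μ f X) p
      = frameContract h g φ p (μ p) (fun u v ↦ mvfderiv (𝓡 m) f p u
          * g.inner (φ p) (X p) (mfderiv (𝓡 m) (𝓡 n) φ p v)) (frame p)
        + α p * f p * frameContract h g φ p (μ p) (fun u v ↦ h.inner p u v) (frame p)
        - f p * frameContract h g φ p (μ p) (fun u v ↦
          g.inner (φ p) (X p) (secondFundamentalForm h g φ p u v)) (frame p) := by
  set y₀ := extChartAt (𝓡 m) p p
  have hp := mem_chart_source (Coord m) p
  have hq := mem_chart_source (Coord n) (φ p)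
  have hXs := (isSmoothAlongAt_iff (hφ.contMDiff p) hp hq).1 (hX p)
  rw [divergence_eq_sum_fderiv p (isSmoothAlongAt_newtonField hφ hμ hf hX p)
    (fun i ↦ (contDiffAt_coeff_newtonField hφ hμ hf hX p i).differentiableAt (by simp))
    (localField_newtonField hφ p)]
  -- near `p` the field is `∑ f ξ_l T^{il} e_i` with `ξ_l = X · dφ(e_l)`
  set T : Fin m → Fin m → Coord m → ℝ := fun i l y ↦
    newtonCoeff h g φ _ (μ _) (parFrame h p y) i l with hT
  set ξ : Fin m → Coord m → ℝ := fun l y ↦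
    metricLoc g (φ p) (localMap m n φ p (φ p) y) (localField m φ X p (φ p) y)
          (fderiv ℝ (localMap m n φ p (φ p)) y (parVec h p l y)) with hξ
  have hfd : DifferentiableAt ℝ (f ∘ (extChartAt (𝓡 m) p).symm) y₀ :=
    (contDiffAt_comp_symm hf.contMDiffAt hp).differentiableAt (by simp)
  have hTd : ∀ i l, DifferentiableAt ℝ (T i l) y₀ := fun i l ↦
    (contDiffAt_newtonCoeff hμ p i l).differentiableAt (by simp)
  have hξd : ∀ l, DifferentiableAt ℝ (ξ l) y₀ := fun l ↦
    (contDiffAt_inner_parVec hφ p hXs l).differentiableAt (by simp)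
  have hξ0 : ∀ l, ξ l y₀ = g.inner (φ p) (X p) (mfderiv (𝓡 m) (𝓡 n) φ p (frame p l)) := by
    intro l
    simp only [hξ]
    rw [parVec_self, ← coords_frame p l, ← coords_mfderiv (hφ.contMDiff p) hp hq,
      localMap_apply hp, localField_apply hp, metricLoc_coords g hq]
  have hT0 : ∀ i l, T i l y₀ = newtonCoeff h g φ p (μ p) (frame p) i l :=
    newtonCoeff_parFrame_self p
  have hf0 : f ((extChartAt (𝓡 m) p).symm y₀) = f p := by rw [extChartAt_to_inv]
  have hd : ∀ i, fderiv ℝ (fun y ↦ f ((extChartAt (𝓡 m) p).symm y) * ∑ l, ξ l y * T i l y) y₀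
      (EuclideanSpace.single i 1)
      = (∑ l, mvfderiv (𝓡 m) f p (frame p i) * ξ l y₀ * T i l y₀)
        + f p * ((∑ l, fderiv ℝ (ξ l) y₀ (EuclideanSpace.single i 1) * T i l y₀)
        + ∑ l, ξ l y₀ * fderiv ℝ (T i l) y₀ (EuclideanSpace.single i 1)) := by
    intro i
    have hfd' : DifferentiableAt ℝ (fun y ↦ f ((extChartAt (𝓡 m) p).symm y)) y₀ := hfd
    rw [fderiv_fun_mul hfd' (DifferentiableAt.fun_sum fun l _ ↦ (hξd l).fun_mul (hTd i l)),
      fderiv_fun_sum fun l _ ↦ (hξd l).fun_mul (hTd i l), mvfderiv_eq_fderiv hp hfd, coords_frame]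
    simp only [add_apply, smul_apply, smul_eq_mul, sum_apply, ← Finset.sum_add_distrib]
    rw [hf0, add_comm, Finset.sum_mul]
    congr 1
    · exact Finset.sum_congr rfl fun l _ ↦ by
        rw [mul_comm, ← mul_assoc]; rfl
    · congr 1
      refine Finset.sum_congr rfl fun l _ ↦ ?_
      rw [fderiv_fun_mul (hξd l) (hTd i l)]
      simp only [add_apply, smul_apply, smul_eq_mul]
      ring
  have hdT : ∑ i, ∑ l, ξ l y₀ * fderiv ℝ (T i l) y₀ (EuclideanSpace.single i 1) = 0 := by
    rw [Finset.sum_comm]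
    refine Finset.sum_eq_zero fun l _ ↦ ?_
    rw [← Finset.mul_sum, sum_fderiv_newtonCoeff hμ p l, mul_zero]
  have hdξ : ∑ i, ∑ l, fderiv ℝ (ξ l) y₀ (EuclideanSpace.single i 1) * T i l y₀
      = α p * frameContract h g φ p (μ p) (fun u v ↦ h.inner p u v) (frame p)
        - frameContract h g φ p (μ p) (fun u v ↦
          g.inner (φ p) (X p) (secondFundamentalForm h g φ p u v)) (frame p) := by
    rw [← frameContract_conformal hφ hα, frameContract_eq_sum, frameContract_eq_sum,
      ← Finset.sum_sub_distrib]
    refine Finset.sum_congr rfl fun i _ ↦ ?_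
    rw [← Finset.sum_sub_distrib]
    refine Finset.sum_congr rfl fun l _ ↦ ?_
    rw [fderiv_inner_parVec hφ hX, hT0]
    ring
  rw [Finset.sum_congr rfl fun i _ ↦ hd i, Finset.sum_add_distrib, ← Finset.mul_sum,
    Finset.sum_add_distrib, hdT, hdξ, frameContract_eq_sum p (μ p)
      (fun u v ↦ mvfderiv (𝓡 m) f p u * g.inner (φ p) (X p) (mfderiv (𝓡 m) (𝓡 n) φ p v))]
  simp_rw [hξ0, hT0]
  ring

/-- A contraction with a continuous bilinear form is continuous. -/
lemma continuousAt_frameContract (hφ : IsIsometricImmersion h g φ) (hμ : IsCodazziForm h g φ μ)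
    (C : ∀ x : S, TangentSpace (𝓡 m) x →ₗ[ℝ] TangentSpace (𝓡 m) x →ₗ[ℝ] ℝ) (p : S)
    (hC : ∀ i l, ContinuousAt (fun y ↦ C ((extChartAt (𝓡 m) p).symm y) (parFrame h p y i)
      (parFrame h p y l)) (extChartAt (𝓡 m) p p)) :
    ContinuousAt (fun x ↦ frameContract h g φ x (μ x) (fun u v ↦ C x u v) (frame x)) p := by
  have h1 : ContinuousAt (fun y ↦ ∑ i, ∑ l, C ((extChartAt (𝓡 m) p).symm y) (parFrame h p y i)
      (parFrame h p y l) * newtonCoeff h g φ _ (μ _) (parFrame h p y) i l)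
      (extChartAt (𝓡 m) p p) :=
    tendsto_finsetSum _ fun i _ ↦ tendsto_finsetSum _ fun l _ ↦
      (hC i l).mul (contDiffAt_newtonCoeff hμ p i l).continuousAt
  have h2 : ContinuousAt ((fun x ↦ frameContract h g φ x (μ x) (fun u v ↦ C x u v) (frame x))
      ∘ (extChartAt (𝓡 m) p).symm) (extChartAt (𝓡 m) p p) := by
    refine h1.congr ?_
    filter_upwards [eventually_exists_parFrame h p] with y ⟨hy, P, hP⟩
    rw [Function.comp_apply, frameContract_eq hφ _ _ (C _) hP, frameContract_eq_sum]
  have h3 := h2.comp_of_eq (continuousAt_extChartAt (I := 𝓡 m) p) rfl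
  refine h3.congr ?_
  filter_upwards [(chartAt (Coord m) p).open_source.mem_nhds (mem_chart_source _ p)] with z hz
  simp only [Function.comp_apply]
  rw [(extChartAt (𝓡 m) p).left_inv (mem_source_iff.2 hz)]

/-- The form `(u, v) ↦ ∇_u X · dφ(v)`. -/
def covInner (g : SemiRiemannianMetric n M) (hφ : ContMDiff (𝓡 m) (𝓡 n) ∞ φ)
    (hX : ∀ x, IsSmoothAlongAt m φ X x) (x : S) :
    TangentSpace (𝓡 m) x →ₗ[ℝ] TangentSpace (𝓡 m) x →ₗ[ℝ] ℝ :=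
  LinearMap.mk₂ ℝ
    (fun u v ↦ g.inner (φ x) (covDerivAlong g φ X x u) (mfderiv (𝓡 m) (𝓡 n) φ x v))
    (fun u u' v ↦ by
      rw [← inner_add_left]
      congr 2
      refine coords_injective (mem_chart_source _ (φ x)) ?_
      simp only [coords_add, coords_covDerivAlong g (hφ x) (hX x) (mem_chart_source _ x)
        (mem_chart_source _ (φ x)), cov, map_add, add_apply]
      abel)
    (fun c u v ↦ by
      rw [smul_eq_mul, ← inner_smul_left]
      congr 2
      refine coords_injective (mem_chart_source _ (φ x)) ?_
      simp only [coords_smul, coords_covDerivAlong g (hφ x) (hX x) (mem_chart_source _ x)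
        (mem_chart_source _ (φ x)), cov, map_smul, smul_apply, smul_add])
    (fun u v v' ↦ by rw [map_add, map_add])
    (fun c u v ↦ by rw [map_smul, map_smul])

/-- The form of degree zero, whose Newton tensor is the identity. -/
lemma isCodazziForm_one (h : SemiRiemannianMetric m S) (g : SemiRiemannianMetric n M) (φ : S → M) :
    IsCodazziForm h g φ (k := 0) (fun _ ↦ MultilinearMap.constOfIsEmpty ℝ _ 1) where
  smooth p I L := contDiffAt_const
  divergence_free p l := by
    refine Finset.sum_eq_zero fun i _ ↦ Finset.sum_eq_zero fun I _ ↦ Finset.sum_eq_zero fun L _ ↦ ?_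
    have : localTensor h g φ (k := 0) (fun _ ↦ MultilinearMap.constOfIsEmpty ℝ _ 1) p I L
      = fun _ ↦ 1 := rfl
    rw [this]
    simp

/-- The conformal factor is continuous, as a multiple of the trace of `∇X`. -/
lemma continuous_conformalFactor (hφ : IsIsometricImmersion h g φ)
    (hX : ∀ x, IsSmoothAlongAt m φ X x) {α : S → ℝ} (hα : IsConformalAlong h g φ X α)
    (hm : 0 < m) : Continuous α := by
  refine continuous_iff_continuousAt.2 fun p ↦ ?_
  have hμ := isCodazziForm_one h g φ
  have hp := mem_chart_source (Coord m) p
  have hq := mem_chart_source (Coord n) (φ p)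
  have hF := contDiffAt_localMap (m := m) (n := n) (hφ.contMDiff p) hp hq
  have hXs := (isSmoothAlongAt_iff (hφ.contMDiff p) hp hq).1 (hX p)
  have hqt : localMap m n φ p (φ p) (extChartAt (𝓡 m) p p) ∈ (extChartAt (𝓡 n) (φ p)).target := by
    rw [localMap_apply hp]
    exact mem_extChartAt_target _
  have hΓ : ContDiffAt ℝ ∞ (fun y ↦ connLoc g (φ p) (localMap m n φ p (φ p) y))
    (extChartAt (𝓡 m) p p) := (contDiffAt_connLoc g hqt).comp _ hF
  -- the contraction of the conformal Killing equation in the case `k = 0`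
  have h1 : ∀ x, α x = (1 / (m : ℝ)) * frameContract h g φ x
      (MultilinearMap.constOfIsEmpty ℝ (fun _ : Fin 0 ↦ TangentSpace (𝓡 n) (φ x)) (1 : ℝ))
      (fun u v ↦ covInner g hφ.contMDiff hX x u v) (frame x) := by
    intro x
    have h2 := frameContract_conformal hφ hα x
      (MultilinearMap.constOfIsEmpty ℝ (fun _ : Fin 0 ↦ TangentSpace (𝓡 n) (φ x)) (1 : ℝ)) (frame x)
    rw [frameContract_metric] at h2
    have h3 : (m : ℝ) ≠ 0 := by positivity
    change α x = _ * frameContract h g φ x _ (fun u v ↦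
        g.inner (φ x) (covDerivAlong g φ X x u) (mfderiv (𝓡 m) (𝓡 n) φ x v)) (frame x)
    rw [h2]
    simp [kronecker]
    field_simp
  rw [funext h1]
  refine continuousAt_const.mul (continuousAt_frameContract hφ hμ _ p fun i l ↦ ?_)
  have h2 : ContDiffAt ℝ ∞ (fun y ↦ cov (connLoc g (φ p)) (localMap m n φ p (φ p))
      (localField m φ X p (φ p)) y (parVec h p i y)) (extChartAt (𝓡 m) p p) :=
    ((contDiffAt_fderiv hXs).clm_apply (contDiff_parVec h p i _)).add ((hΓ.clm_apply
      ((contDiffAt_fderiv hF).clm_apply (contDiff_parVec h p i _))).clm_apply hXs)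
  refine (contDiffAt_inner_parVec hφ p h2 l).continuousAt.congr ?_
  filter_upwards [eventually_mem_charts (m := m) (n := n) (q := φ p)
    (hφ.contMDiff p).continuousAt hp hq] with y ⟨hy, hyq⟩
  change _ = g.inner _ _ _
  rw [← metricLoc_coords g hyq, coords_mfderiv (hφ.contMDiff _) (mem_source_of_target hy) hyq,
    coords_covDerivAlong g (hφ.contMDiff _) (hX _) (mem_source_of_target hy) hyq,
    coords_parFrame h hy, coords_parFrame h hy, (extChartAt (𝓡 m) p).right_inv hy]
  rfl

lemma continuous_frameContract_metric (hφ : IsIsometricImmersion h g φ)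
    (hμ : IsCodazziForm h g φ μ) :
    Continuous fun x ↦ frameContract h g φ x (μ x) (fun u v ↦ h.inner x u v) (frame x) := by
  refine continuous_iff_continuousAt.2 fun p ↦ ?_
  refine continuousAt_frameContract hφ hμ (fun x ↦ LinearMap.mk₂ ℝ (fun u v ↦ h.inner x u v)
    (fun u u' v ↦ inner_add_left h x u u' v) (fun c u v ↦ inner_smul_left h x c u v)
    (fun u v v' ↦ map_add _ v v') (fun c u v ↦ map_smul _ c v)) p fun i l ↦ ?_
  exact (contDiffAt_gram_parFrame h p i l).continuousAt

lemma continuous_frameContract_differential (hφ : IsIsometricImmersion h g φ)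
    (hμ : IsCodazziForm h g φ μ) (hf : ContMDiff (𝓡 m) 𝓘(ℝ, ℝ) ∞ f)
    (hX : ∀ x, IsSmoothAlongAt m φ X x) :
    Continuous fun x ↦ frameContract h g φ x (μ x) (fun u v ↦ mvfderiv (𝓡 m) f x u
          * g.inner (φ x) (X x) (mfderiv (𝓡 m) (𝓡 n) φ x v)) (frame x) := by
  refine continuous_iff_continuousAt.2 fun p ↦ ?_
  refine continuousAt_frameContract hφ hμ (fun x ↦ (mvfderiv (𝓡 m) f x).toLinearMap.smulRight
    (innerDifferential g φ x (X x))) p fun i l ↦ ?_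
  have hp := mem_chart_source (Coord m) p
  have hq := mem_chart_source (Coord n) (φ p)
  have hXs := (isSmoothAlongAt_iff (hφ.contMDiff p) hp hq).1 (hX p)
  have hfs := contDiffAt_comp_symm (p := p) hf.contMDiffAt hp
  have h1 : ContinuousAt (fun y ↦ fderiv ℝ (f ∘ (extChartAt (𝓡 m) p).symm) y (parVec h p i y))
      (extChartAt (𝓡 m) p p) :=
    ((contDiffAt_fderiv hfs).clm_apply (contDiff_parVec h p i _)).continuousAt
  refine (h1.mul (contDiffAt_inner_parVec hφ p hXs l).continuousAt).congr ?_
  filter_upwards [eventually_inner_parFrame hφ p (X := X), extChartAt_target_mem_nhds'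
    (mem_extChartAt_target p)] with y hy hyt
  rw [Pi.mul_apply, ← hy l, ← coords_parFrame h hyt]
  have hfy := (contDiffAt_comp_symm (p := p) (hf.contMDiffAt (x := (extChartAt (𝓡 m) p).symm y))
    (mem_source_of_target hyt)).differentiableAt (by simp)
  have h2 := mvfderiv_eq_fderiv (mem_source_of_target hyt) hfy (parFrame h p y i)
  rw [(extChartAt (𝓡 m) p).right_inv hyt] at h2
  rw [← h2]
  rfl

lemma continuous_frameContract_secondFundamentalForm (hφ : IsIsometricImmersion h g φ)
    (hμ : IsCodazziForm h g φ μ) (hX : ∀ x, IsSmoothAlongAt m φ X x) :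
    Continuous fun x ↦ frameContract h g φ x (μ x) (fun u v ↦
          g.inner (φ x) (X x) (secondFundamentalForm h g φ x u v)) (frame x) := by
  refine continuous_iff_continuousAt.2 fun p ↦ ?_
  refine continuousAt_frameContract hφ hμ (fun x ↦ (secondFormL hφ x).compr₂
    (g.inner (φ x) (X x)).toLinearMap) p fun i l ↦ ?_
  have hp := mem_chart_source (Coord m) p
  have hq := mem_chart_source (Coord n) (φ p)
  have hF := contDiffAt_localMap (m := m) (n := n) (hφ.contMDiff p) hp hq
  have hXs := (isSmoothAlongAt_iff (hφ.contMDiff p) hp hq).1 (hX p)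
  have hqt : localMap m n φ p (φ p) (extChartAt (𝓡 m) p p) ∈ (extChartAt (𝓡 n) (φ p)).target := by
    rw [localMap_apply hp]
    exact mem_extChartAt_target _
  have hG : ContDiffAt ℝ ∞ (fun y ↦ metricLoc g (φ p) (localMap m n φ p (φ p) y))
    (extChartAt (𝓡 m) p p) := (contDiffAt_metricLoc g hqt).comp _ hF
  refine ((hG.clm_apply hXs).clm_apply (contDiffAt_secondForm hF (contDiffAt_connLoc g hqt)
    (contDiffAt_connLoc h (mem_extChartAt_target p)) (contDiff_parVec h p i _)
      (contDiff_parVec h p l _))).continuousAt.congr ?_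
  filter_upwards [eventually_mem_charts (m := m) (n := n) (q := φ p)
    (hφ.contMDiff p).continuousAt hp hq] with y ⟨hy, hyq⟩
  change _ = g.inner _ _ (secondFundamentalForm h g φ _ _ _)
  rw [← metricLoc_coords g hyq,
    coords_secondFundamentalForm hφ (mem_source_of_target hy) hyq,
    coords_parFrame h hy, coords_parFrame h hy, (extChartAt (𝓡 m) p).right_inv hy]
  rfl

/-- The integral formula for the contractions with a form `μ` whose Newton tensor is divergence
free. -/
theorem integral_frameContract [T2Space S] [CompactSpace S] [MeasurableSpace S] [BorelSpace S]
    (hφ : IsIsometricImmersion h g φ) (hμ : IsCodazziForm h g φ μ)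
    (hf : ContMDiff (𝓡 m) 𝓘(ℝ, ℝ) ∞ f) (hX : ∀ x, IsSmoothAlongAt m φ X x) {α : S → ℝ}
    (hα : IsConformalAlong h g φ X α) (hm : 0 < m) :
    Integrable (fun x ↦ α x * f x * frameContract h g φ x (μ x) (fun u v ↦ h.inner x u v) (frame x))
      (volumeMeasure h) ∧
    Integrable (fun x ↦ f x * frameContract h g φ x (μ x) (fun u v ↦
      g.inner (φ x) (X x) (secondFundamentalForm h g φ x u v)) (frame x)) (volumeMeasure h) ∧
    Integrable (fun x ↦ frameContract h g φ x (μ x) (fun u v ↦ mvfderiv (𝓡 m) f x u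
      * g.inner (φ x) (X x) (mfderiv (𝓡 m) (𝓡 n) φ x v)) (frame x)) (volumeMeasure h) ∧
    ∫ x, α x * f x * frameContract h g φ x (μ x) (fun u v ↦ h.inner x u v) (frame x)
        ∂(volumeMeasure h)
      = ∫ x, f x * frameContract h g φ x (μ x) (fun u v ↦
          g.inner (φ x) (X x) (secondFundamentalForm h g φ x u v)) (frame x) ∂(volumeMeasure h)
        - ∫ x, frameContract h g φ x (μ x) (fun u v ↦ mvfderiv (𝓡 m) f x u
            * g.inner (φ x) (X x) (mfderiv (𝓡 m) (𝓡 n) φ x v)) (frame x) ∂(volumeMeasure h) := by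
  have i1 : Integrable (fun x ↦ α x * f x *
      frameContract h g φ x (μ x) (fun u v ↦ h.inner x u v) (frame x)) (volumeMeasure h) :=
    integrable_of_continuous h (((continuous_conformalFactor hφ hX hα hm).mul
    hf.continuous).mul (continuous_frameContract_metric hφ hμ))
  have i2 : Integrable (fun x ↦ f x * frameContract h g φ x (μ x) (fun u v ↦
      g.inner (φ x) (X x) (secondFundamentalForm h g φ x u v)) (frame x)) (volumeMeasure h) :=
    integrable_of_continuous h
    (hf.continuous.mul (continuous_frameContract_secondFundamentalForm hφ hμ hX))
  have i3 := integrable_of_continuous h (continuous_frameContract_differential hφ hμ hf hX)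
  refine ⟨i1, i2, i3, ?_⟩
  have h0 := (integral_divergence h (isSmoothAlongAt_newtonField hφ hμ hf hX)).2
  simp_rw [divergence_newtonField hφ hμ hf hX hα] at h0
  have h1 := integral_sub (i3.add i1) i2
  simp only [Pi.add_apply] at h1
  rw [h1, integral_add i3 i1] at h0
  linarith

end NewtonField

/-! ### Curvature tensors determined by their sectional curvatures -/

section Algebraic

variable {V : Type*} [AddCommGroup V] [Module ℝ V]

/-- An algebraic curvature tensor: `S(u, v, w, z)` is linear in `u`, skew in `(u, v)` and in
`(w, z)`, and satisfies the first Bianchi identity. -/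
structure IsCurvatureTensor (S : V → V → V → V → ℝ) : Prop where
  add (u u' v w z : V) : S (u + u') v w z = S u v w z + S u' v w z
  smul (a : ℝ) (u v w z : V) : S (a • u) v w z = a * S u v w z
  skew (u v w z : V) : S u v w z = - S v u w z
  skew' (u v w z : V) : S u v w z = - S u v z w
  bianchi (u v w z : V) : S u v w z + S v w u z + S w u v z = 0

variable {S : V → V → V → V → ℝ}

lemma IsCurvatureTensor.pair_symm (hS : IsCurvatureTensor S) (u v w z : V) :
    S u v w z = S w z u v := by
  linarith [hS.bianchi u v w z, hS.bianchi v w z u, hS.bianchi w z u v, hS.bianchi z u v w,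
    hS.skew u v w z, hS.skew v w u z, hS.skew w u v z, hS.skew v w z u, hS.skew w z v u,
    hS.skew z v w u, hS.skew' v w u z, hS.skew' w z v u, hS.skew' w z u v, hS.skew' z u w v,
    hS.skew' u v w z, hS.skew z u v w, hS.skew u v z w, hS.skew v z u w, hS.skew' z u v w,
    hS.skew' v z u w, hS.skew' w u v z, hS.skew' u w z v, hS.skew u w z v, hS.skew z u w v,
    hS.skew' z v w u, hS.skew w z u v, hS.skew' u v z w, hS.skew u w v z]

lemma IsCurvatureTensor.add' (hS : IsCurvatureTensor S) (u v v' w z : V) :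
    S u (v + v') w z = S u v w z + S u v' w z := by
  rw [hS.skew, hS.add, hS.skew u v, hS.skew u v']
  ring

lemma IsCurvatureTensor.smul' (hS : IsCurvatureTensor S) (a : ℝ) (u v w z : V) :
    S u (a • v) w z = a * S u v w z := by
  rw [hS.skew, hS.smul, hS.skew u v]
  ring

lemma IsCurvatureTensor.add₃ (hS : IsCurvatureTensor S) (u v w w' z : V) :
    S u v (w + w') z = S u v w z + S u v w' z := by
  rw [hS.pair_symm, hS.add, hS.pair_symm u v, hS.pair_symm u v]

lemma IsCurvatureTensor.smul₃ (hS : IsCurvatureTensor S) (a : ℝ) (u v w z : V) :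
    S u v (a • w) z = a * S u v w z := by
  rw [hS.pair_symm, hS.smul, hS.pair_symm u v]

lemma IsCurvatureTensor.add₄ (hS : IsCurvatureTensor S) (u v w z z' : V) :
    S u v w (z + z') = S u v w z + S u v w z' := by
  rw [hS.pair_symm, hS.add', hS.pair_symm u v, hS.pair_symm u v]

lemma IsCurvatureTensor.smul₄ (hS : IsCurvatureTensor S) (a : ℝ) (u v w z : V) :
    S u v w (a • z) = a * S u v w z := by
  rw [hS.pair_symm, hS.smul', hS.pair_symm u v]

/-- Polarization: the sectional curvatures determine a curvature tensor. -/
lemma IsCurvatureTensor.eq_zero (hS : IsCurvatureTensor S) (h0 : ∀ u v, S u v v u = 0)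
    (u v w z : V) : S u v w z = 0 := by
  have h1 : ∀ u v w, S u v w u = 0 := by
    intro u v w
    have e := h0 u (v + w)
    rw [hS.add', hS.add₃, hS.add₃, h0, h0] at e
    have e2 : S u w v u = S u v w u := by
      rw [hS.pair_symm, hS.skew, hS.skew' u v]
      rw [hS.skew', hS.skew' u v u w]
      ring
    linarith
  have h2 : ∀ u v w z, S u v w z = - S z v w u := by
    intro u v w z
    have e := h1 (u + z) v w
    rw [hS.add, hS.add₄, hS.add₄, h1, h1] at e
    linarith
  have h3 : ∀ u v w z, S u v w z = S u w z v := by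
    intro u v w z
    rw [h2, hS.pair_symm, hS.skew]
    ring
  have b := hS.bianchi w z v u
  have e1 : S w z v u = - S u v w z := by rw [hS.skew', hS.pair_symm u v]
  have e2 : S z v w u = - S u w z v := by rw [hS.skew', hS.pair_symm u w]
  have e3 : S v w z u = - S u z v w := by rw [hS.skew', hS.pair_symm u z]
  have e4 := h3 u v w z
  have e5 := h3 u w z v
  linarith

variable {G : V →ₗ[ℝ] V →ₗ[ℝ] ℝ}

/-- The curvature tensor of constant curvature one. -/
lemma isCurvatureTensor_metric (hG : ∀ u v, G u v = G v u) :
    IsCurvatureTensor fun u v w z ↦ G v w * G u z - G u w * G v z where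
  add u u' v w z := by simp only [map_add, LinearMap.add_apply]; ring
  smul a u v w z := by simp only [map_smul, LinearMap.smul_apply, smul_eq_mul]; ring
  skew u v w z := by ring
  skew' u v w z := by ring
  bianchi u v w z := by rw [hG w u, hG v u, hG w v]; ring

open Polynomial in
/-- Sectional curvatures of nondegenerate planes suffice, since these planes are dense. -/
lemma IsCurvatureTensor.eq_zero_of_nondegenerate (hS : IsCurvatureTensor S)
    (hG : ∀ u v, G u v = G v u) (hn : ∀ u, (∀ v, G u v = 0) → u = 0)
    (h0 : ∀ u v, G u u * G v v - G u v ^ 2 ≠ 0 → S u v v u = 0) (u v w z : V) :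
    S u v w z = 0 := by
  refine hS.eq_zero (fun u v ↦ ?_) u v w z
  by_cases hdeg : ∀ u v, G u u * G v v - G u v ^ 2 = 0
  · -- if all planes are degenerate, any two vectors are proportional
    have h1 : ∀ u v w z, G v w * G u z - G u w * G v z = 0 := fun u v w z ↦
      (isCurvatureTensor_metric hG).eq_zero
        (fun u v ↦ by have := hdeg u v; rw [← this]; simp only [hG v u]; ring) u v w z
    by_cases hv : v = 0
    · rw [hv, ← zero_smul ℝ (0 : V), hS.smul', zero_mul]
    · have : ∃ w, G v w ≠ 0 := by
        by_contra hcon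
        push Not at hcon
        exact hv (hn v hcon)
      obtain ⟨w, hw⟩ := this
      have h2 : G v w • u - G u w • v = 0 := hn _ fun z ↦ by
        simpa using h1 u v w z
      have h3 : u = (G u w / G v w) • v := by
        rw [sub_eq_zero] at h2
        rw [div_eq_inv_mul, ← smul_smul, ← h2, smul_smul, inv_mul_cancel₀ hw, one_smul]
      have h4 : ∀ z, S v v v z = 0 := fun z ↦ by linarith [hS.skew v v v z]
      generalize G u w / G v w = a at h3
      rw [h3, hS.smul, h4, mul_zero]
  · push Not at hdeg
    obtain ⟨a, b, hab⟩ := hdeg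
    -- along the line `(u + t a, v + t b)` only finitely many planes are degenerate
    set P : ℝ[X] := C (S u v v u) + C (S a v v u + S u b v u + S u v b u + S u v v a) * X
      + C (S a b v u + S a v b u + S a v v a + S u b b u + S u b v a + S u v b a) * X ^ 2
      + C (S u b b a + S a v b a + S a b v a + S a b b u) * X ^ 3 + C (S a b b a) * X ^ 4 with hP
    set Q : ℝ[X] := (C (G u u) + C (2 * G u a) * X + C (G a a) * X ^ 2)
      * (C (G v v) + C (2 * G v b) * X + C (G b b) * X ^ 2)
      - (C (G u v) + C (G u b + G a v) * X + C (G a b) * X ^ 2) ^ 2 with hQ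
    have hPe : ∀ t, P.eval t = S (u + t • a) (v + t • b) (v + t • b) (u + t • a) := by
      intro t
      simp only [hP, eval_add, eval_mul, eval_C, eval_X, eval_pow, hS.add, hS.add', hS.add₃,
        hS.add₄, hS.smul, hS.smul', hS.smul₃, hS.smul₄]
      ring
    have hQe : ∀ t, Q.eval t = G (u + t • a) (u + t • a) * G (v + t • b) (v + t • b)
        - G (u + t • a) (v + t • b) ^ 2 := by
      intro t
      simp only [hQ, eval_sub, eval_add, eval_mul, eval_C, eval_X, eval_pow, map_add, map_smul,
        LinearMap.add_apply, LinearMap.smul_apply, smul_eq_mul, hG a u, hG b v]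
      ring
    have hQ0 : Q ≠ 0 := by
      intro hq
      have hc : Q = C (G u u * G v v - G u v ^ 2)
          + C (2 * G u u * G v b + 2 * G u a * G v v - 2 * G u v * (G u b + G a v)) * X
          + C (G u u * G b b + 4 * G u a * G v b + G a a * G v v - (G u b + G a v) ^ 2
            - 2 * G u v * G a b) * X ^ 2
          + C (2 * G u a * G b b + 2 * G a a * G v b - 2 * G a b * (G u b + G a v)) * X ^ 3
          + C (G a a * G b b - G a b ^ 2) * X ^ 4 := by
        simp only [hQ, map_sub, map_add, map_mul, map_pow, map_ofNat]
        ring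
      have h4 : Q.coeff 4 = G a a * G b b - G a b ^ 2 := by
        rw [hc]
        simp only [coeff_add, coeff_C_mul, coeff_X_pow, coeff_X, coeff_C]
        norm_num
      rw [hq, coeff_zero] at h4
      exact hab h4.symm
    have hPQ : P * Q = 0 := by
      refine Polynomial.funext fun t ↦ ?_
      rw [eval_mul, eval_zero, hPe, hQe]
      by_cases ht : G (u + t • a) (u + t • a) * G (v + t • b) (v + t • b)
        - G (u + t • a) (v + t • b) ^ 2 = 0
      · rw [ht, mul_zero]
      · rw [h0 _ _ ht, zero_mul]
    have hP0 : P = 0 := (mul_eq_zero.1 hPQ).resolve_right hQ0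
    have := hPe 0
    rw [hP0] at this
    simpa using this.symm

end Algebraic

/-! ### Constant curvature and Einstein metrics in coordinates -/

section Curvature

open Filter Topology

variable {d : ℕ} {N : Type*} [TopologicalSpace N] [ChartedSpace (Coord d) N]
  [IsManifold (𝓡 d) ∞ N]

lemma fderiv_connLoc (g : SemiRiemannianMetric d N) {p : N} {y : Coord d}
    (hy : y ∈ (extChartAt (𝓡 d) p).target) (u a b : Coord d) :
    fderiv ℝ (connLoc g p) y u a b = ∑ k, (∑ i, ∑ j, fderiv ℝ (christoffel g p k i j) y u
      * a i * b j) • (EuclideanSpace.single k (1 : ℝ) : Coord d) := by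
  have hc : ∀ k i j, DifferentiableAt ℝ (christoffel g p k i j) y := fun k i j ↦
    (contDiffAt_christoffel g hy k i j).differentiableAt (by simp)
  have h1 := (fderiv_bilin_apply (F := fun z : Coord d ↦ z)
    ((contDiffAt_connLoc g hy).differentiableAt
    (by simp)) differentiableAt_id (differentiableAt_const a) (differentiableAt_const b) u).2
  simp only [fderiv_fun_id, fderiv_const_apply, zero_apply, map_zero, add_zero,
    ContinuousLinearMap.id_apply] at h1
  rw [← h1]
  simp_rw [connLoc_apply]
  have h2 : ∀ k, HasFDerivAt (fun z ↦ (∑ i, ∑ j, christoffel g p k i j z * a i * b j) •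
      (EuclideanSpace.single k (1 : ℝ) : Coord d))
      ((∑ i, ∑ j, b j • a i • fderiv ℝ (christoffel g p k i j) y).smulRight
        (EuclideanSpace.single k (1 : ℝ) : Coord d)) y := fun k ↦
    (HasFDerivAt.fun_sum fun i _ ↦ HasFDerivAt.fun_sum fun j _ ↦
      (((hc k i j).hasFDerivAt.mul_const (a i)).mul_const (b j))).smul_const _
  rw [(HasFDerivAt.fun_sum fun k _ ↦ h2 k).fderiv]
  simp only [sum_apply, ContinuousLinearMap.smulRight_apply, smul_apply, smul_eq_mul]
  refine Finset.sum_congr rfl fun k _ ↦ ?_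
  congr 1
  exact Finset.sum_congr rfl fun i _ ↦ Finset.sum_congr rfl fun j _ ↦ by ring

lemma sum_smul_single_apply (c : Fin d → ℝ) (l : Fin d) :
    (∑ k, c k • (EuclideanSpace.single k (1 : ℝ) : Coord d)) l = c l := by
  simp [Pi.single_apply]

lemma sum_curvature_linear (D : Fin d → Fin d → Fin d → ℝ) (u v w : Fin d → ℝ) :
    ∑ k, ∑ i, ∑ j, D i j k * u i * v j * w k = ∑ j, ∑ k, (∑ i, u i * D i j k) * v j * w k := by
  simp only [Finset.sum_mul]
  rw [Finset.sum_congr rfl fun k _ ↦ Finset.sum_comm, Finset.sum_comm]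
  exact Finset.sum_congr rfl fun j _ ↦ Finset.sum_congr rfl fun k _ ↦
    Finset.sum_congr rfl fun i _ ↦ by ring

lemma sum_curvature_quadratic (a : Fin d → Fin d → ℝ) (b : Fin d → Fin d → Fin d → ℝ)
    (u v w : Fin d → ℝ) :
    ∑ k, ∑ i, ∑ j, (∑ s, a i s * b s j k) * u i * v j * w k
      = ∑ i, ∑ s, a i s * u i * ∑ j, ∑ k, b s j k * v j * w k := by
  simp only [Finset.sum_mul, Finset.mul_sum]
  rw [Finset.sum_comm]
  refine Finset.sum_congr rfl fun i _ ↦ ?_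
  rw [Finset.sum_congr rfl fun k _ ↦ Finset.sum_comm, Finset.sum_comm]
  refine Finset.sum_congr rfl fun s _ ↦ ?_
  rw [Finset.sum_comm]
  exact Finset.sum_congr rfl fun j _ ↦ Finset.sum_congr rfl fun k _ ↦ by ring

/-- The curvature tensor of the definition is the one of the connection form. -/
lemma coords_curvature (g : SemiRiemannianMetric d N) (p : N) (u v w : TangentSpace (𝓡 d) p) :
    coords p p (curvature g p u v w)
      = curv (connLoc g p) (extChartAt (𝓡 d) p p) (coords p p u) (coords p p v) (coords p p w) := by
  set y := extChartAt (𝓡 d) p p with hy'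
  have hy : y ∈ (extChartAt (𝓡 d) p).target := mem_extChartAt_target p
  rw [curvature, coords_sum]
  simp_rw [coords_smul, coords_frame]
  rw [curv, fderiv_connLoc g hy, fderiv_connLoc g hy]
  simp only [connLoc_apply, fderiv_eq_sum_partialDeriv]
  ext l
  simp only [PiLp.add_apply, PiLp.sub_apply, sum_smul_single_apply, curvatureComponent, add_mul,
    sub_mul, Finset.sum_add_distrib, Finset.sum_sub_distrib, ← hy']
  generalize coords p p u = a
  generalize coords p p v = b
  generalize coords p p w = c
  have e1 := sum_curvature_linear (fun i j k ↦ partialDeriv i (christoffel g p l j k) y) a b c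
  have e2 := sum_curvature_linear (fun i j k ↦ partialDeriv i (christoffel g p l j k) y) b a c
  have e3 := sum_curvature_quadratic (fun i s ↦ christoffel g p l i s y)
    (fun s j k ↦ christoffel g p s j k y) a b c
  have e4 := sum_curvature_quadratic (fun i s ↦ christoffel g p l i s y)
    (fun s j k ↦ christoffel g p s j k y) b a c
  have e2' : ∑ k, ∑ i, ∑ j, partialDeriv j (christoffel g p l i k) y * a i * b j * c k = _ :=
    (Finset.sum_congr rfl fun k _ ↦ by
      rw [Finset.sum_comm]
      exact Finset.sum_congr rfl fun i _ ↦ Finset.sum_congr rfl fun j _ ↦ by ring).trans e2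
  have e4' : ∑ k, ∑ i, ∑ j, (∑ s, christoffel g p l j s y * christoffel g p s i k y) * a i * b j
      * c k = _ :=
    (Finset.sum_congr rfl fun k _ ↦ by
      rw [Finset.sum_comm]
      exact Finset.sum_congr rfl fun i _ ↦ Finset.sum_congr rfl fun j _ ↦ by ring).trans e4
  rw [e1, e2', e3, e4']
  ring

set_option synthInstance.maxHeartbeats 200000 in
lemma curv_add {E : Type*} [NormedAddCommGroup E] [NormedSpace ℝ E]
    (Γ : E → E →L[ℝ] E →L[ℝ] E) (y u u' v w : E) :
    curv Γ y (u + u') v w = curv Γ y u v w + curv Γ y u' v w := by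
  simp only [curv, map_add, add_apply]
  abel

set_option synthInstance.maxHeartbeats 200000 in
lemma curv_smul {E : Type*} [NormedAddCommGroup E] [NormedSpace ℝ E]
    (Γ : E → E →L[ℝ] E →L[ℝ] E) (y : E) (a : ℝ) (u v w : E) :
    curv Γ y (a • u) v w = a • curv Γ y u v w := by
  simp only [curv, map_smul, smul_apply, smul_sub, smul_add]

/-- The Levi-Civita curvature in coordinates, at the center of a chart, has the symmetries of a
curvature tensor. -/
lemma isCurvatureTensor_curv (g : SemiRiemannianMetric d N) (p : N) :
    IsCurvatureTensor fun u v w z ↦ metricLoc g p (extChartAt (𝓡 d) p p)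
      (curv (connLoc g p) (extChartAt (𝓡 d) p p) u v w) z := by
  have hy : extChartAt (𝓡 d) p p ∈ (extChartAt (𝓡 d) p).target := mem_extChartAt_target p
  have hG := contDiffAt_metricLoc g hy
  have hΓ : DifferentiableAt ℝ (connLoc g p) (extChartAt (𝓡 d) p p) :=
    (contDiffAt_connLoc g hy).differentiableAt (by simp)
  have hev := extChartAt_target_mem_nhds' hy
  have hskew : ∀ u v w z, metricLoc g p (extChartAt (𝓡 d) p p)
      (curv (connLoc g p) (extChartAt (𝓡 d) p p) u v w) z
      = - metricLoc g p (extChartAt (𝓡 d) p p)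
        (curv (connLoc g p) (extChartAt (𝓡 d) p p) v u w) z := fun u v w z ↦ by
    rw [curv_antisymm, map_neg, neg_apply]
  refine ⟨fun u u' v w z ↦ ?_, fun a u v w z ↦ ?_, hskew, ?_, fun u v w z ↦ ?_⟩
  · simp only [curv_add, map_add, add_apply]
  · simp only [curv_smul, map_smul, smul_apply, smul_eq_mul]
  · exact inner_curv_skew (by
      filter_upwards [hev] with z hz using isLeviCivitaAt_connLoc g hz)
      (hG.of_le (WithTop.coe_le_coe.2 le_top))
      (Filter.Eventually.of_forall fun z u v ↦ metricLoc_symm g p z u v) hΓ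
  · have hs : ∀ᶠ z in 𝓝 (extChartAt (𝓡 d) p p), ∀ u v,
        connLoc g p z u v = connLoc g p z v u := by
      filter_upwards [hev] with z hz
      exact (isLeviCivitaAt_connLoc g hz).symm
        ((contDiffAt_metricLoc g hz).differentiableAt (by simp))
        (Filter.Eventually.of_forall fun z u v ↦ metricLoc_symm g p z u v)
        (metricLoc_nondegenerate g hz)
    rw [← add_apply, ← map_add, ← add_apply, ← map_add, curv_bianchi hs hΓ]
    simp

/-- The curvature tensor of a metric of constant curvature. -/
lemma inner_curv_of_hasConstantCurvature {g : SemiRiemannianMetric d N}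
    (hg : HasConstantCurvature g) : ∃ c : ℝ, ∀ (p : N) (u v w z : Coord d),
      metricLoc g p (extChartAt (𝓡 d) p p)
        (curv (connLoc g p) (extChartAt (𝓡 d) p p) u v w) z
      = c * (metricLoc g p (extChartAt (𝓡 d) p p) v w * metricLoc g p (extChartAt (𝓡 d) p p) u z
        - metricLoc g p (extChartAt (𝓡 d) p p) u w * metricLoc g p (extChartAt (𝓡 d) p p) v z) := by
  obtain ⟨c, hc⟩ := hg
  refine ⟨c, fun p ↦ ?_⟩
  set y := extChartAt (𝓡 d) p p with hy'
  have hp := mem_chart_source (Coord d) p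
  have hy : y ∈ (extChartAt (𝓡 d) p).target := mem_extChartAt_target p
  set G : Coord d →ₗ[ℝ] Coord d →ₗ[ℝ] ℝ := LinearMap.mk₂ ℝ (fun u v ↦ metricLoc g p y u v)
    (fun u u' v ↦ by rw [map_add, add_apply]) (fun a u v ↦ by rw [map_smul, smul_apply])
    (fun u v v' ↦ map_add _ v v') (fun a u v ↦ map_smul _ a v) with hG
  have hGs : ∀ u v, G u v = G v u := metricLoc_symm g p y
  have h1 := isCurvatureTensor_curv g p
  have h2 := isCurvatureTensor_metric hGs
  have hS : IsCurvatureTensor fun u v w z ↦ metricLoc g p y (curv (connLoc g p) y u v w) z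
      - c * (G v w * G u z - G u w * G v z) := by
    refine ⟨fun u u' v w z ↦ ?_, fun a u v w z ↦ ?_, fun u v w z ↦ ?_, fun u v w z ↦ ?_,
      fun u v w z ↦ ?_⟩
    · linear_combination h1.add u u' v w z - c * h2.add u u' v w z
    · linear_combination h1.smul a u v w z - c * h2.smul a u v w z
    · linear_combination h1.skew u v w z - c * h2.skew u v w z
    · linear_combination h1.skew' u v w z - c * h2.skew' u v w z
    · linear_combination h1.bianchi u v w z - c * h2.bianchi u v w z
  intro u v w z
  refine sub_eq_zero.1 (hS.eq_zero_of_nondegenerate hGs (metricLoc_nondegenerate g hy) ?_ u v w z)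
  intro u v huv
  have hco : ∀ a, coords p p (ofCoords p p a) = a := coords_ofCoords hp
  have hm : ∀ a b : Coord d, g.inner p (ofCoords p p a) (ofCoords p p b) = G a b := by
    intro a b
    rw [← metricLoc_coords g hp, hco, hco]
    rfl
  have harea : planeArea g p (ofCoords p p u) (ofCoords p p v) = G u u * G v v - G u v ^ 2 := by
    rw [planeArea, hm, hm, hm]
  have h3 := hc p (ofCoords p p u) (ofCoords p p v) (by rwa [harea])
  rw [sectionalCurvature, harea, div_eq_iff huv, ← metricLoc_coords g hp, coords_curvature, hco,
    hco] at h3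
  rw [h3, hGs v u]
  ring

/-- The Ricci curvature as a trace in coordinates. -/
lemma ricci_eq_sum_curv (g : SemiRiemannianMetric d N) (p : N) (v w : TangentSpace (𝓡 d) p) :
    ricci g p v w = ∑ i, curv (connLoc g p) (extChartAt (𝓡 d) p p) (EuclideanSpace.single i 1)
      (coords p p v) (coords p p w) i := by
  simp only [ricci, coords_curvature, coords_frame]

end Curvature

/-! ### Codazzi forms in spaces of constant curvature -/

section Codazzi

open Filter Topology

/-- Contractions of tensors that are symmetric in the derivative index and one other index. -/
lemma sum_det_cons_eq_zero {m k : ℕ} (q : Matrix (Fin m) (Fin m) ℝ) (l : Fin m)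
    (D : Fin m → (Fin k → Fin m) → (Fin k → Fin m) → ℝ) (c : Fin k)
    (hD : ∀ i I L, D (I c) (Function.update I c i) L = D i I L) :
    ∑ i, ∑ I : Fin k → Fin m, ∑ L : Fin k → Fin m,
      (q.submatrix (Fin.cons i I : Fin (k + 1) → Fin m) (Fin.cons l L)).det * D i I L = 0 := by
  have h1 := contract_swap_eq_zero q (a := 0) (b := c.succ) (Fin.succ_ne_zero c).symm
    (fun K L ↦ if L 0 = l then D (K 0) (Fin.tail K) (Fin.tail L) else 0) (by
      intro K L
      have e1 : (K ∘ Equiv.swap 0 c.succ) 0 = Fin.tail K c := by simp [Fin.tail]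
      have e2 : Fin.tail (K ∘ Equiv.swap 0 c.succ) = Function.update (Fin.tail K) c (K 0) := by
        ext1 a
        by_cases ha : a = c
        · subst ha
          simp [Fin.tail]
        · rw [Function.update_of_ne ha]
          simp only [Fin.tail, Function.comp_apply]
          rw [Equiv.swap_apply_of_ne_of_ne (Fin.succ_ne_zero a)
            (fun h ↦ ha (Fin.succ_injective _ h))]
      simp only [e1, e2, hD])
  rw [contract, sum_fin_cons] at h1
  rw [← h1]
  refine Finset.sum_congr rfl fun i _ ↦ Finset.sum_congr rfl fun I _ ↦ ?_
  rw [sum_fin_cons, Finset.sum_eq_single l]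
  · simp
  · intro l' _ hl'
    simp [hl']
  · simp

variable {m n : ℕ}
  {S : Type*} [TopologicalSpace S] [ChartedSpace (Coord m) S] [IsManifold (𝓡 m) ∞ S]
  {M : Type*} [TopologicalSpace M] [ChartedSpace (Coord n) M] [IsManifold (𝓡 n) ∞ M]
  {h : SemiRiemannianMetric m S} {g : SemiRiemannianMetric n M} {φ : S → M}

/-- The components of the second fundamental form in the frame `parFrame`, in coordinates. -/
def secondLoc (h : SemiRiemannianMetric m S) (g : SemiRiemannianMetric n M) (φ : S → M) (p : S)
    (i l : Fin m) (y : Coord m) : Coord n :=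
  secondForm (connLoc g (φ p)) (connLoc h p) (localMap m n φ p (φ p)) y (parVec h p i y)
    (parVec h p l y)

lemma localMap_self_mem_target (p : S) :
    localMap m n φ p (φ p) (extChartAt (𝓡 m) p p) ∈ (extChartAt (𝓡 n) (φ p)).target := by
  rw [localMap_apply (mem_chart_source _ p)]
  exact mem_extChartAt_target _

lemma contDiffAt_localMap_self (hφ : IsIsometricImmersion h g φ) (p : S) :
    ContDiffAt ℝ ∞ (localMap m n φ p (φ p)) (extChartAt (𝓡 m) p p) :=
  contDiffAt_localMap (hφ.contMDiff p) (mem_chart_source _ p) (mem_chart_source _ (φ p))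

lemma contDiffAt_secondLoc (hφ : IsIsometricImmersion h g φ) (p : S) (i l : Fin m) :
    ContDiffAt ℝ ∞ (secondLoc h g φ p i l) (extChartAt (𝓡 m) p p) :=
  contDiffAt_secondForm (contDiffAt_localMap_self hφ p)
    (contDiffAt_connLoc g (localMap_self_mem_target p))
    (contDiffAt_connLoc h (mem_extChartAt_target p)) (contDiff_parVec h p i _)
    (contDiff_parVec h p l _)

/-- Inner products with the second fundamental form in coordinates. -/
lemma eventually_inner_secondLoc (hφ : IsIsometricImmersion h g φ) (p : S) :
    ∀ᶠ y in 𝓝 (extChartAt (𝓡 m) p p), ∀ i l w,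
      g.inner (φ ((extChartAt (𝓡 m) p).symm y))
        (secondFundamentalForm h g φ _ (parFrame h p y i) (parFrame h p y l)) w
      = metricLoc g (φ p) (localMap m n φ p (φ p) y) (secondLoc h g φ p i l y)
          (coords (φ p) _ w) := by
  filter_upwards [eventually_mem_charts (m := m) (n := n) (q := φ p)
    (hφ.contMDiff p).continuousAt (mem_chart_source _ p) (mem_chart_source _ (φ p))]
    with y ⟨hy, hyq⟩ i l w
  rw [← metricLoc_coords g hyq,
    coords_secondFundamentalForm hφ (mem_source_of_target hy) hyq, coords_parFrame h hy,
    coords_parFrame h hy, (extChartAt (𝓡 m) p).right_inv hy]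
  rfl

lemma eventually_coords_secondLoc (hφ : IsIsometricImmersion h g φ) (p : S) :
    ∀ᶠ y in 𝓝 (extChartAt (𝓡 m) p p), ∀ i l,
      coords (φ p) _ (secondFundamentalForm h g φ _ (parFrame h p y i) (parFrame h p y l))
        = secondLoc h g φ p i l y := by
  filter_upwards [eventually_mem_charts (m := m) (n := n) (q := φ p)
    (hφ.contMDiff p).continuousAt (mem_chart_source _ p) (mem_chart_source _ (φ p))]
    with y ⟨hy, hyq⟩ i l
  rw [coords_secondFundamentalForm hφ (mem_source_of_target hy) hyq, coords_parFrame h hy,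
    coords_parFrame h hy, (extChartAt (𝓡 m) p).right_inv hy]
  rfl

lemma secondLoc_normal (hφ : IsIsometricImmersion h g φ) (p : S) (i l : Fin m) (w : Coord m) :
    metricLoc g (φ p) (localMap m n φ p (φ p) (extChartAt (𝓡 m) p p))
      (secondLoc h g φ p i l (extChartAt (𝓡 m) p p))
      (fderiv ℝ (localMap m n φ p (φ p)) (extChartAt (𝓡 m) p p) w) = 0 :=
  inner_secondForm hφ (mem_extChartAt_target p)
    (by rw [extChartAt_to_inv]; exact mem_chart_source _ _) _ _ _

/-- The covariant derivative at `p` of the components of the second fundamental form. -/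
def covSecond (h : SemiRiemannianMetric m S) (g : SemiRiemannianMetric n M) (φ : S → M) (p : S)
    (j i l : Fin m) : Coord n :=
  cov (connLoc g (φ p)) (localMap m n φ p (φ p)) (secondLoc h g φ p i l) (extChartAt (𝓡 m) p p)
    (EuclideanSpace.single j 1)

/-- The tangent vectors `dφ(e_i)` at the base point, in coordinates. -/
def tangentLoc (m n : ℕ) [ChartedSpace (Coord m) S] [ChartedSpace (Coord n) M] (φ : S → M) (p : S)
    (i : Fin m) : Coord n :=
  fderiv ℝ (localMap m n φ p (φ p)) (extChartAt (𝓡 m) p p) (EuclideanSpace.single i 1)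

/-- The Codazzi equation for the normal component in direction `N`. -/
lemma inner_covSecond_sub (hφ : IsIsometricImmersion h g φ) (p : S) (j i l : Fin m) {N : Coord n}
    (hN : ∀ w, metricLoc g (φ p) (extChartAt (𝓡 n) (φ p) (φ p)) N
      (fderiv ℝ (localMap m n φ p (φ p)) (extChartAt (𝓡 m) p p) w) = 0) :
    metricLoc g (φ p) (extChartAt (𝓡 n) (φ p) (φ p)) (covSecond h g φ p j i l) N
      - metricLoc g (φ p) (extChartAt (𝓡 n) (φ p) (φ p)) (covSecond h g φ p i j l) N
      = - metricLoc g (φ p) (extChartAt (𝓡 n) (φ p) (φ p)) (curv (connLoc g (φ p))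
          (extChartAt (𝓡 n) (φ p) (φ p)) (tangentLoc m n φ p j) (tangentLoc m n φ p i)
          (tangentLoc m n φ p l)) N := by
  have hyt := mem_extChartAt_target (I := 𝓡 m) p
  obtain ⟨ζ, hζ⟩ := codazzi (contDiffAt_localMap_self hφ p)
    (contDiffAt_connLoc g (localMap_self_mem_target p)) (contDiffAt_connLoc h hyt)
    ((isLeviCivitaAt_connLoc h hyt).symm
      ((contDiffAt_metricLoc h hyt).differentiableAt (by simp))
      (Filter.Eventually.of_forall fun z u v ↦ metricLoc_symm h _ z u v)
      (metricLoc_nondegenerate h hyt)) (EuclideanSpace.single i 1) (EuclideanSpace.single l 1)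
      (EuclideanSpace.single j 1)
  rw [localMap_apply (mem_chart_source _ p)] at hζ
  have h1 : covSecond h g φ p j i l - covSecond h g φ p i j l = _ := hζ
  have h2 := hN ζ
  rw [metricLoc_symm] at h2
  rw [← sub_apply, ← map_sub, h1, map_add, add_apply, h2, map_neg, neg_apply, add_zero]
  rfl

/-- In constant curvature the curvature term of the Codazzi equation is tangential. -/
lemma inner_covSecond_comm (hφ : IsIsometricImmersion h g φ) (hg : HasConstantCurvature g) (p : S)
    (j i l : Fin m) {N : Coord n}
    (hN : ∀ w, metricLoc g (φ p) (extChartAt (𝓡 n) (φ p) (φ p)) N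
      (fderiv ℝ (localMap m n φ p (φ p)) (extChartAt (𝓡 m) p p) w) = 0) :
    metricLoc g (φ p) (extChartAt (𝓡 n) (φ p) (φ p)) (covSecond h g φ p j i l) N
      = metricLoc g (φ p) (extChartAt (𝓡 n) (φ p) (φ p)) (covSecond h g φ p i j l) N := by
  obtain ⟨c, hc⟩ := inner_curv_of_hasConstantCurvature hg
  have h1 := inner_covSecond_sub hφ p j i l hN
  have h2 : ∀ i, metricLoc g (φ p) (extChartAt (𝓡 n) (φ p) (φ p)) (tangentLoc m n φ p i) N = 0 :=
    fun i ↦ by rw [metricLoc_symm]; exact hN _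
  rw [hc, h2, h2] at h1
  linarith

/-- The metric of the ambient manifold as a bilinear map. -/
def innerL (g : SemiRiemannianMetric n M) (q : M) :
    TangentSpace (𝓡 n) q →ₗ[ℝ] TangentSpace (𝓡 n) q →ₗ[ℝ] ℝ :=
  LinearMap.mk₂ ℝ (fun u v ↦ g.inner q u v)
    (fun u u' v ↦ inner_add_left g q u u' v) (fun c u v ↦ inner_smul_left g q c u v)
    (fun _ v v' ↦ map_add _ v v') (fun c _ v ↦ map_smul _ c v)

/-- The pairings of the second fundamental form are parallel, and the Codazzi equation in a space
of constant curvature makes the Newton tensor divergence free. -/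
theorem isCodazziForm_pairForm (hφ : IsIsometricImmersion h g φ) (r : ℕ)
    (hg : HasConstantCurvature g ∨ r = 0) :
    IsCodazziForm h g φ fun x ↦ pairForm (innerL g (φ x)) r := by
  -- the components of the pairings
  set P : S → Fin r → (Fin (2 * r) → Fin m) → (Fin (2 * r) → Fin m) → Coord m → ℝ :=
    fun p a I L y ↦ metricLoc g (φ p) (localMap m n φ p (φ p) y)
      (secondLoc h g φ p (I ⟨2 * a.val, by omega⟩) (L ⟨2 * a.val, by omega⟩) y)
      (secondLoc h g φ p (I ⟨2 * a.val + 1, by omega⟩) (L ⟨2 * a.val + 1, by omega⟩) y) with hP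
  have hPs : ∀ p a I L, ContDiffAt ℝ ∞ (P p a I L) (extChartAt (𝓡 m) p p) := by
    intro p a I L
    have hG : ContDiffAt ℝ ∞ (fun y ↦ metricLoc g (φ p) (localMap m n φ p (φ p) y))
      (extChartAt (𝓡 m) p p) :=
      (contDiffAt_metricLoc g (localMap_self_mem_target p)).comp _ (contDiffAt_localMap_self hφ p)
    exact (hG.clm_apply (contDiffAt_secondLoc hφ p _ _)).clm_apply (contDiffAt_secondLoc hφ p _ _)
  have hloc : ∀ p I L, localTensor h g φ (fun x ↦ pairForm (innerL g (φ x)) r) p I L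
      =ᶠ[𝓝 (extChartAt (𝓡 m) p p)] fun y ↦ ∏ a, P p a I L y := by
    intro p I L
    filter_upwards [eventually_inner_secondLoc hφ p, eventually_coords_secondLoc hφ p]
      with y hy hy'
    rw [localTensor, pairForm_apply]
    refine Finset.prod_congr rfl fun a _ ↦ ?_
    exact (hy _ _ _).trans (by rw [hy'])
  refine ⟨fun p I L ↦ ?_, fun p l ↦ ?_⟩
  · exact (contDiffAt_prod fun a _ ↦ hPs p a I L).congr_of_eventuallyEq (hloc p I L)
  · rcases hg with hg | rfl
    swap
    · refine Finset.sum_eq_zero fun i _ ↦ Finset.sum_eq_zero fun I _ ↦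
        Finset.sum_eq_zero fun L _ ↦ ?_
      rw [(hloc p I L).fderiv_eq]
      simp
    set y₀ := extChartAt (𝓡 m) p p with hy₀
    set z₀ := extChartAt (𝓡 n) (φ p) (φ p) with hz₀
    have hFp : localMap m n φ p (φ p) y₀ = z₀ := localMap_apply (mem_chart_source _ p)
    -- the two terms in the derivative of a pairing
    set D₀ : Fin r → Fin m → (Fin (2 * r) → Fin m) → (Fin (2 * r) → Fin m) → ℝ :=
      fun a i I L ↦ (∏ b ∈ Finset.univ.erase a, P p b I L y₀) * metricLoc g (φ p) z₀
        (covSecond h g φ p i (I ⟨2 * a.val, by omega⟩) (L ⟨2 * a.val, by omega⟩))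
        (secondLoc h g φ p (I ⟨2 * a.val + 1, by omega⟩) (L ⟨2 * a.val + 1, by omega⟩) y₀) with hD₀
    set D₁ : Fin r → Fin m → (Fin (2 * r) → Fin m) → (Fin (2 * r) → Fin m) → ℝ :=
      fun a i I L ↦ (∏ b ∈ Finset.univ.erase a, P p b I L y₀) * metricLoc g (φ p) z₀
        (covSecond h g φ p i (I ⟨2 * a.val + 1, by omega⟩) (L ⟨2 * a.val + 1, by omega⟩))
        (secondLoc h g φ p (I ⟨2 * a.val, by omega⟩) (L ⟨2 * a.val, by omega⟩) y₀) with hD₁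
    have hd : ∀ i I L, fderiv ℝ (localTensor h g φ (fun x ↦ pairForm (innerL g (φ x)) r) p I L) y₀
        (EuclideanSpace.single i 1) = ∑ a, (D₀ a i I L + D₁ a i I L) := by
      intro i I L
      rw [(hloc p I L).fderiv_eq, (HasFDerivAt.finsetProd fun a _ ↦
        ((hPs p a I L).differentiableAt (by simp)).hasFDerivAt).fderiv, sum_apply]
      refine Finset.sum_congr rfl fun a _ ↦ ?_
      simp only [smul_apply, smul_eq_mul, hD₀, hD₁]
      rw [← mul_add]
      congr 1
      have hqt := localMap_self_mem_target (m := m) (n := n) (φ := φ) p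
      simp only [hP]
      rw [fderiv_inner_cov (isLeviCivitaAt_connLoc g hqt)
        ((contDiffAt_metricLoc g hqt).differentiableAt (by simp))
        (Filter.Eventually.of_forall fun z u v ↦ metricLoc_symm g _ z u v)
        ((contDiffAt_localMap_self hφ p).differentiableAt (by simp))
        ((contDiffAt_secondLoc hφ p _ _).differentiableAt (by simp))
        ((contDiffAt_secondLoc hφ p _ _).differentiableAt (by simp)), hFp]
      congr 1
      exact metricLoc_symm g _ _ _ _
    have hN : ∀ i l w, metricLoc g (φ p) z₀ (secondLoc h g φ p i l y₀)
        (fderiv ℝ (localMap m n φ p (φ p)) y₀ w) = 0 := by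
      intro i l w
      rw [← hFp]
      exact secondLoc_normal hφ p i l w
    have hP' : ∀ (a : Fin r) (c : Fin (2 * r)) i I L, c.val / 2 = a.val →
        ∏ b ∈ Finset.univ.erase a, P p b (Function.update I c i) L y₀
          = ∏ b ∈ Finset.univ.erase a, P p b I L y₀ := by
      intro a c i I L hc
      refine Finset.prod_congr rfl fun b hb ↦ ?_
      have hba : b.val ≠ a.val := fun h ↦ (Finset.mem_erase.1 hb).1 (Fin.ext h)
      simp only [hP]
      rw [Function.update_of_ne, Function.update_of_ne]
      · intro h; have := congrArg Fin.val h; simp only at this; omega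
      · intro h; have := congrArg Fin.val h; simp only at this; omega
    simp_rw [hd, Finset.mul_sum, mul_add, Finset.sum_add_distrib]
    have h0 : ∀ a, ∑ i, ∑ I : Fin (2 * r) → Fin m, ∑ L : Fin (2 * r) → Fin m,
        ((inverseMetric h p).submatrix (Fin.cons i I : Fin (2 * r + 1) → Fin m)
          (Fin.cons l L)).det * D₀ a i I L = 0 := by
      intro a
      refine sum_det_cons_eq_zero _ l (D₀ a) ⟨2 * a.val, by omega⟩ fun i I L ↦ ?_
      simp only [hD₀]
      rw [hP' _ _ _ _ _ (by simp), Function.update_self, Function.update_of_ne,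
        inner_covSecond_comm hφ hg p _ _ _ (hN _ _)]
      intro h; have := congrArg Fin.val h; simp only at this; omega
    have h1 : ∀ a, ∑ i, ∑ I : Fin (2 * r) → Fin m, ∑ L : Fin (2 * r) → Fin m,
        ((inverseMetric h p).submatrix (Fin.cons i I : Fin (2 * r + 1) → Fin m)
          (Fin.cons l L)).det * D₁ a i I L = 0 := by
      intro a
      refine sum_det_cons_eq_zero _ l (D₁ a) ⟨2 * a.val + 1, by omega⟩ fun i I L ↦ ?_
      simp only [hD₁]
      rw [hP' _ _ _ _ _ (by simp only; omega), Function.update_self, Function.update_of_ne,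
        inner_covSecond_comm hφ hg p _ _ _ (hN _ _)]
      intro h; have := congrArg Fin.val h; simp only at this; omega
    have hswap : ∀ D : Fin r → Fin m → (Fin (2 * r) → Fin m) → (Fin (2 * r) → Fin m) → ℝ,
        (∀ a, ∑ i, ∑ I, ∑ L, D a i I L = 0) → ∑ i, ∑ I, ∑ L, ∑ a, D a i I L = 0 := by
      intro D hD
      rw [Finset.sum_congr rfl fun i _ ↦ (Finset.sum_congr rfl fun I _ ↦
        Finset.sum_comm).trans Finset.sum_comm, Finset.sum_comm]
      exact Finset.sum_eq_zero fun a _ ↦ hD a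
    rw [hswap _ h0, hswap _ h1, add_zero]

end Codazzi

/-! ### Codazzi forms on hypersurfaces -/

section Hypersurface

open Filter Topology

variable {m n : ℕ}
  {S : Type*} [TopologicalSpace S] [ChartedSpace (Coord m) S] [IsManifold (𝓡 m) ∞ S]
  {M : Type*} [TopologicalSpace M] [ChartedSpace (Coord n) M] [IsManifold (𝓡 n) ∞ M]
  {h : SemiRiemannianMetric m S} {g : SemiRiemannianMetric n M} {φ : S → M}
  {ν : ∀ x : S, TangentSpace (𝓡 n) (φ x)}

lemma inner_normalPart (h : SemiRiemannianMetric m S) (g : SemiRiemannianMetric n M)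
    (hφ : IsIsometricImmersion h g φ) (x : S) (a : TangentSpace (𝓡 n) (φ x))
    (v : TangentSpace (𝓡 m) x) :
    g.inner (φ x) (normalPart h g φ x a) (mfderiv (𝓡 m) (𝓡 n) φ x v) = 0 := by
  rw [normalPart, inner_sub_left, hφ.isometric, inner_tangentialPart, sub_self]

lemma IsUnitNormal.sq_unit (hν : IsUnitNormal m g φ ν) (x : S) :
    g.inner (φ x) (ν x) (ν x) * g.inner (φ x) (ν x) (ν x) = 1 := by
  rcases hν.unit x with h | h <;> rw [h] <;> norm_num

/-- A vector orthogonal to the tangent hyperplane and to the unit normal vanishes. -/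
lemma IsUnitNormal.eq_zero_of_inner_eq_zero (hν : IsUnitNormal m g φ ν)
    (hφ : IsIsometricImmersion h g φ) (hn : n = m + 1) (x : S) {a : TangentSpace (𝓡 n) (φ x)}
    (ha : ∀ v, g.inner (φ x) a (mfderiv (𝓡 m) (𝓡 n) φ x v) = 0)
    (ha' : g.inner (φ x) a (ν x) = 0) : a = 0 := by
  have hε := hν.sq_unit x
  -- `dφ` and `ν` together give an isomorphism, by injectivity and equality of dimensions
  let L : (TangentSpace (𝓡 m) x × ℝ) →ₗ[ℝ] TangentSpace (𝓡 n) (φ x) :=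
    (mfderiv (𝓡 m) (𝓡 n) φ x).toLinearMap.coprod
      (LinearMap.toSpanSingleton ℝ (TangentSpace (𝓡 n) (φ x)) (ν x))
  have hLa : ∀ z, L z = mfderiv (𝓡 m) (𝓡 n) φ x z.1 + z.2 • ν x := fun z ↦ rfl
  have hinj : Function.Injective L := by
    rw [← LinearMap.ker_eq_bot, LinearMap.ker_eq_bot']
    rintro ⟨v, t⟩ hz
    rw [hLa] at hz
    have e1 : g.inner (φ x) (ν x) (mfderiv (𝓡 m) (𝓡 n) φ x v + t • ν x) = 0 := by
      rw [hz, map_zero]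
    rw [map_add, hν.normal, inner_smul_right, zero_add] at e1
    have ht : t = 0 := by linear_combination (g.inner (φ x) (ν x) (ν x)) * e1 - t * hε
    subst ht
    have e2 : mfderiv (𝓡 m) (𝓡 n) φ x v = 0 := by
      rwa [zero_smul, add_zero] at hz
    have e3 : v = 0 := hφ.injective x (e2.trans (map_zero _).symm)
    rw [e3]; rfl
  have hsurj : Function.Surjective L := by
    have : FiniteDimensional ℝ (TangentSpace (𝓡 m) x) :=
      inferInstanceAs (FiniteDimensional ℝ (Coord m))
    have : FiniteDimensional ℝ (TangentSpace (𝓡 n) (φ x)) :=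
      inferInstanceAs (FiniteDimensional ℝ (Coord n))
    refine (LinearMap.injective_iff_surjective_of_finrank_eq_finrank ?_).1 hinj
    change Module.finrank ℝ (Coord m × ℝ) = Module.finrank ℝ (Coord n)
    simp [hn]
  refine g.nondegenerate (φ x) a fun w ↦ ?_
  obtain ⟨⟨v, t⟩, hw⟩ := hsurj w
  rw [← hw, hLa, map_add, ha, inner_smul_right, ha', mul_zero, add_zero]

/-- On a hypersurface the normal space is spanned by the unit normal. -/
lemma IsUnitNormal.normalPart_eq (hν : IsUnitNormal m g φ ν) (hφ : IsIsometricImmersion h g φ)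
    (hn : n = m + 1) (x : S) (a : TangentSpace (𝓡 n) (φ x)) :
    normalPart h g φ x a = (g.inner (φ x) (ν x) (ν x) * g.inner (φ x) a (ν x)) • ν x := by
  refine sub_eq_zero.1 (hν.eq_zero_of_inner_eq_zero hφ hn x (fun v ↦ ?_) ?_)
  · rw [inner_sub_left, inner_normalPart h g hφ, inner_smul_left, hν.normal, mul_zero, sub_zero]
  · rw [inner_sub_left, normalPart, inner_sub_left, inner_smul_left,
      g.symm (φ x) (mfderiv _ _ _ _ _),
      hν.normal]
    linear_combination (- g.inner (φ x) a (ν x)) * hν.sq_unit x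

lemma IsUnitNormal.secondFundamentalForm_eq (hν : IsUnitNormal m g φ ν)
    (hφ : IsIsometricImmersion h g φ) (hn : n = m + 1) (x : S) (u v : TangentSpace (𝓡 m) x) :
    secondFundamentalForm h g φ x u v = (g.inner (φ x) (ν x) (ν x)
      * g.inner (φ x) (secondFundamentalForm h g φ x u v) (ν x)) • ν x := by
  refine sub_eq_zero.1 (hν.eq_zero_of_inner_eq_zero hφ hn x (fun w ↦ ?_) ?_)
  · rw [inner_sub_left, secondFundamentalForm, inner_neg_left, inner_normalPart h g hφ,
      inner_smul_left, hν.normal, mul_zero, neg_zero, sub_zero]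
  · rw [inner_sub_left, inner_smul_left]
    linear_combination (- g.inner (φ x) (secondFundamentalForm h g φ x u v) (ν x)) * hν.sq_unit x

lemma coords_mfderiv_frame (hφ : IsIsometricImmersion h g φ) (p : S) (i : Fin m) :
    coords (φ p) (φ p) (mfderiv (𝓡 m) (𝓡 n) φ p (frame p i)) = tangentLoc m n φ p i := by
  rw [coords_mfderiv (hφ.contMDiff p) (mem_chart_source _ p) (mem_chart_source _ _), coords_frame]
  rfl

/-- A vector is the sum of its tangential and its normal component. -/
lemma IsUnitNormal.eq_sum_tangentLoc (hν : IsUnitNormal m g φ ν) (hφ : IsIsometricImmersion h g φ)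
    (hn : n = m + 1) (p : S) (a : Coord n) :
    a = ∑ i, ∑ l, (inverseMetric h p i l * metricLoc g (φ p) (extChartAt (𝓡 n) (φ p) (φ p)) a
        (tangentLoc m n φ p l)) • tangentLoc m n φ p i
      + (g.inner (φ p) (ν p) (ν p) * metricLoc g (φ p) (extChartAt (𝓡 n) (φ p) (φ p)) a
        (coords (φ p) (φ p) (ν p))) • coords (φ p) (φ p) (ν p) := by
  have hs := mem_chart_source (Coord n) (φ p)
  set w := ofCoords (φ p) (φ p) a with hw
  have ha : coords (φ p) (φ p) w = a := coords_ofCoords hs a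
  have h1 := hν.normalPart_eq hφ hn p w
  rw [normalPart, sub_eq_iff_eq_add, tangentialPart, sharp, map_sum] at h1
  simp_rw [map_sum, map_smul] at h1
  have h2 := congrArg (coords (φ p) (φ p)) h1
  rw [coords_add, coords_sum, coords_smul, ha] at h2
  simp_rw [coords_sum, coords_smul, coords_mfderiv_frame hφ] at h2
  rw [add_comm]
  refine h2.trans ?_
  rw [← metricLoc_coords g hs w, ha]
  congr 1
  refine Finset.sum_congr rfl fun i _ ↦ Finset.sum_congr rfl fun l _ ↦ ?_
  rw [← metricLoc_coords g hs w, ha, coords_mfderiv_frame hφ]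

/-- The trace of an endomorphism in a frame adapted to the hypersurface. -/
lemma IsUnitNormal.trace_eq (hν : IsUnitNormal m g φ ν) (hφ : IsIsometricImmersion h g φ)
    (hn : n = m + 1) (p : S) (T : Coord n →ₗ[ℝ] Coord n) :
    ∑ i, T (EuclideanSpace.single i 1) i
      = ∑ i, ∑ l, inverseMetric h p i l * metricLoc g (φ p) (extChartAt (𝓡 n) (φ p) (φ p))
        (T (tangentLoc m n φ p i)) (tangentLoc m n φ p l)
      + g.inner (φ p) (ν p) (ν p) * metricLoc g (φ p) (extChartAt (𝓡 n) (φ p) (φ p))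
        (T (coords (φ p) (φ p) (ν p))) (coords (φ p) (φ p) (ν p)) := by
  set z₀ := extChartAt (𝓡 n) (φ p) (φ p) with hz₀
  set N := coords (φ p) (φ p) (ν p) with hN
  -- the linear form `G(·, b)`
  let ℓ : Coord n → Coord n →ₗ[ℝ] ℝ := fun b ↦ (metricLoc g (φ p) z₀ b).toLinearMap
  have hℓ : ∀ a b, ℓ b a = metricLoc g (φ p) z₀ a b := fun a b ↦ metricLoc_symm g _ _ _ _
  have hT : T = ∑ i, ∑ l, inverseMetric h p i l •
        (ℓ (tangentLoc m n φ p l)).smulRight (T (tangentLoc m n φ p i))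
      + g.inner (φ p) (ν p) (ν p) • (ℓ N).smulRight (T N) := by
    refine LinearMap.ext fun a ↦ ?_
    conv_lhs => rw [hν.eq_sum_tangentLoc hφ hn p a]
    simp only [map_add, map_sum, map_smul, LinearMap.add_apply, LinearMap.sum_apply,
      LinearMap.smul_apply, LinearMap.smulRight_apply, hℓ, smul_smul, ← hz₀, ← hN]
  rw [← trace_eq_sum_apply_single]
  conv_lhs => rw [hT]
  simp only [map_add, map_sum, map_smul, LinearMap.trace_smulRight, hℓ, smul_eq_mul]

/-- In an Einstein manifold, the contraction of the Codazzi equation of a hypersurface vanishes. -/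
lemma IsUnitNormal.sum_inverseMetric_curv (hν : IsUnitNormal m g φ ν)
    (hφ : IsIsometricImmersion h g φ) (hn : n = m + 1) (hg : IsEinstein g) (p : S) (j : Fin m) :
    ∑ i, ∑ l, inverseMetric h p i l * metricLoc g (φ p) (extChartAt (𝓡 n) (φ p) (φ p))
      (curv (connLoc g (φ p)) (extChartAt (𝓡 n) (φ p) (φ p)) (tangentLoc m n φ p i)
        (tangentLoc m n φ p j) (tangentLoc m n φ p l)) (coords (φ p) (φ p) (ν p)) = 0 := by
  obtain ⟨c, hc⟩ := hg
  set z₀ := extChartAt (𝓡 n) (φ p) (φ p) with hz₀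
  set N := coords (φ p) (φ p) (ν p) with hN
  have hR := isCurvatureTensor_curv g (φ p)
  have h1 := hc (φ p) (mfderiv (𝓡 m) (𝓡 n) φ p (frame p j)) (ν p)
  rw [g.symm, hν.normal, mul_zero, ricci_eq_sum_curv, coords_mfderiv_frame hφ, ← hz₀, ← hN] at h1
  let T : Coord n →ₗ[ℝ] Coord n :=
    { toFun := fun u ↦ curv (connLoc g (φ p)) z₀ u (tangentLoc m n φ p j) N
      map_add' := fun u v ↦ curv_add _ _ _ _ _ _
      map_smul' := fun a u ↦ curv_smul _ _ _ _ _ _ }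
  have h2 := hν.trace_eq hφ hn p T
  rw [show ∑ i, T (EuclideanSpace.single i 1) i = 0 from h1, ← hz₀, ← hN] at h2
  -- the normal direction does not contribute to the trace, by skew symmetry
  have h3 : metricLoc g (φ p) z₀ (T N) N = 0 := by
    have := hR.skew' N (tangentLoc m n φ p j) N N
    change metricLoc g (φ p) z₀ (curv (connLoc g (φ p)) z₀ N (tangentLoc m n φ p j) N) N = 0
    linarith
  rw [h3, mul_zero, add_zero] at h2
  rw [← neg_eq_zero, h2, ← Finset.sum_neg_distrib]
  refine Finset.sum_congr rfl fun i _ ↦ ?_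
  rw [← Finset.sum_neg_distrib]
  refine Finset.sum_congr rfl fun l _ ↦ ?_
  rw [← mul_neg]
  congr 1
  exact (hR.skew' _ _ _ _).symm

/-- The multilinear form that turns the second fundamental form into products of components of the
shape operator. -/
def shapeForm (g : SemiRiemannianMetric n M) (φ : S → M) (ν : ∀ x : S, TangentSpace (𝓡 n) (φ x))
    (k : ℕ) (x : S) : MultilinearMap ℝ (fun _ : Fin k ↦ TangentSpace (𝓡 n) (φ x)) ℝ :=
  powerForm (g.inner (φ x) (ν x) (ν x) • (innerL g (φ x)).flip (ν x)) k

lemma shapeForm_apply (k : ℕ) (x : S) (w : Fin k → TangentSpace (𝓡 n) (φ x)) :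
    shapeForm g φ ν k x w
      = ∏ a, g.inner (φ x) (ν x) (ν x) * g.inner (φ x) (w a) (ν x) := rfl

/-- The components of the shape operator in coordinates. -/
def shapeLoc (h : SemiRiemannianMetric m S) (g : SemiRiemannianMetric n M) (φ : S → M)
    (ν : ∀ x : S, TangentSpace (𝓡 n) (φ x)) (p : S) (i l : Fin m) (y : Coord m) : ℝ :=
  metricLoc g (φ p) (localMap m n φ p (φ p) y) (localField m φ ν p (φ p) y)
      (localField m φ ν p (φ p) y)
    * metricLoc g (φ p) (localMap m n φ p (φ p) y) (secondLoc h g φ p i l y)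
      (localField m φ ν p (φ p) y)

lemma IsUnitNormal.contDiffAt_localField (hν : IsUnitNormal m g φ ν)
    (hφ : IsIsometricImmersion h g φ) (p : S) :
    ContDiffAt ℝ ∞ (localField m φ ν p (φ p)) (extChartAt (𝓡 m) p p) :=
  (isSmoothAlongAt_iff (hφ.contMDiff p) (mem_chart_source _ p) (mem_chart_source _ _)).1
    (hν.smooth p)

lemma contDiffAt_metricLoc_localMap (hφ : IsIsometricImmersion h g φ) (p : S) :
    ContDiffAt ℝ ∞ (fun y ↦ metricLoc g (φ p) (localMap m n φ p (φ p) y))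
      (extChartAt (𝓡 m) p p) :=
  (contDiffAt_metricLoc g (localMap_self_mem_target p)).comp _ (contDiffAt_localMap_self hφ p)

lemma IsUnitNormal.contDiffAt_shapeLoc (hν : IsUnitNormal m g φ ν)
    (hφ : IsIsometricImmersion h g φ) (p : S) (i l : Fin m) :
    ContDiffAt ℝ ∞ (shapeLoc h g φ ν p i l) (extChartAt (𝓡 m) p p) := by
  have hG := contDiffAt_metricLoc_localMap hφ p
  have hN := hν.contDiffAt_localField hφ p
  exact ((hG.clm_apply hN).clm_apply hN).mul
    ((hG.clm_apply (contDiffAt_secondLoc hφ p i l)).clm_apply hN)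

lemma eventually_localTensor_shapeForm (hφ : IsIsometricImmersion h g φ) (k : ℕ) (p : S)
    (I L : Fin k → Fin m) :
    localTensor h g φ (shapeForm g φ ν k) p I L
      =ᶠ[𝓝 (extChartAt (𝓡 m) p p)] fun y ↦ ∏ a, shapeLoc h g φ ν p (I a) (L a) y := by
  filter_upwards [eventually_inner_secondLoc hφ p, eventually_mem_charts (m := m) (n := n)
    (q := φ p) (hφ.contMDiff p).continuousAt (mem_chart_source _ p) (mem_chart_source _ (φ p))]
    with y hy ⟨hyt, hyq⟩
  rw [localTensor, shapeForm_apply]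
  refine Finset.prod_congr rfl fun a _ ↦ ?_
  rw [hy, ← metricLoc_coords g hyq]
  rfl

/-- The square of the unit normal is locally constant, so the covariant derivative of the unit
normal is tangential and does not contribute. -/
lemma IsUnitNormal.fderiv_shapeLoc (hν : IsUnitNormal m g φ ν) (hφ : IsIsometricImmersion h g φ)
    (hn : n = m + 1) (p : S) (i l j : Fin m) :
    fderiv ℝ (shapeLoc h g φ ν p i l) (extChartAt (𝓡 m) p p) (EuclideanSpace.single j 1)
      = g.inner (φ p) (ν p) (ν p) * metricLoc g (φ p) (extChartAt (𝓡 n) (φ p) (φ p))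
        (covSecond h g φ p j i l) (coords (φ p) (φ p) (ν p)) := by
  set y₀ := extChartAt (𝓡 m) p p with hy₀
  set z₀ := extChartAt (𝓡 n) (φ p) (φ p) with hz₀
  set N := coords (φ p) (φ p) (ν p) with hN
  have hqs := mem_chart_source (Coord n) (φ p)
  have hFp : localMap m n φ p (φ p) y₀ = z₀ := localMap_apply (mem_chart_source _ p)
  have hNp : localField m φ ν p (φ p) y₀ = N := localField_apply (mem_chart_source _ p)
  have hG := contDiffAt_metricLoc_localMap (g := g) hφ p
  have hNs := hν.contDiffAt_localField hφ p
  have hAs := contDiffAt_secondLoc hφ p i l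
  have hE := ((hG.clm_apply hNs).clm_apply hNs).differentiableAt (by simp)
  have hC := ((hG.clm_apply hAs).clm_apply hNs).differentiableAt (by simp)
  rw [← hy₀] at hE hC
  have hqt := localMap_self_mem_target (m := m) (n := n) (φ := φ) p
  have hLC := isLeviCivitaAt_connLoc g hqt
  have hGd := (contDiffAt_metricLoc g hqt).differentiableAt (by simp)
  have hsym : ∀ᶠ z in 𝓝 (localMap m n φ p (φ p) y₀), ∀ u v,
      metricLoc g (φ p) z u v = metricLoc g (φ p) z v u :=
    Filter.Eventually.of_forall fun z u v ↦ metricLoc_symm g _ z u v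
  have hF := (contDiffAt_localMap_self hφ p).differentiableAt (by simp)
  have hNd := hNs.differentiableAt (by simp)
  have hAd := hAs.differentiableAt (by simp)
  have hεval : metricLoc g (φ p) z₀ N N = g.inner (φ p) (ν p) (ν p) := metricLoc_coords g hqs _ _
  have hsq := hν.sq_unit p
  -- the derivative of `ν · ν`
  have hE' : fderiv ℝ (fun y ↦ metricLoc g (φ p) (localMap m n φ p (φ p) y)
      (localField m φ ν p (φ p) y) (localField m φ ν p (φ p) y)) y₀ (EuclideanSpace.single j 1)
      = 0 := by
    have h1 : (fun y ↦ metricLoc g (φ p) (localMap m n φ p (φ p) y)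
        (localField m φ ν p (φ p) y) (localField m φ ν p (φ p) y)
        * metricLoc g (φ p) (localMap m n φ p (φ p) y)
        (localField m φ ν p (φ p) y) (localField m φ ν p (φ p) y)) =ᶠ[𝓝 y₀] fun _ ↦ 1 := by
      filter_upwards [eventually_mem_charts (m := m) (n := n)
        (q := φ p) (hφ.contMDiff p).continuousAt (mem_chart_source _ p)
        (mem_chart_source _ (φ p))] with y ⟨_, hyq⟩
      rw [← hν.sq_unit ((extChartAt (𝓡 m) p).symm y), ← metricLoc_coords g hyq]
      rfl
    have h2 := h1.fderiv_eq (𝕜 := ℝ)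
    rw [fderiv_fun_mul hE hE, fderiv_const_apply] at h2
    have h3 := DFunLike.congr_fun h2 (EuclideanSpace.single j (1 : ℝ) : Coord m)
    simp only [add_apply, smul_apply, smul_eq_mul, zero_apply, hFp, hNp, hεval] at h3
    linear_combination (g.inner (φ p) (ν p) (ν p) / 2) * h3 - (fderiv ℝ (fun y ↦
      metricLoc g (φ p) (localMap m n φ p (φ p) y) (localField m φ ν p (φ p) y)
        (localField m φ ν p (φ p) y)) y₀ (EuclideanSpace.single j 1)) * hsq
  have hcov : metricLoc g (φ p) z₀ N (cov (connLoc g (φ p)) (localMap m n φ p (φ p))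
      (localField m φ ν p (φ p)) y₀ (EuclideanSpace.single j 1)) = 0 := by
    have h1 := fderiv_inner_cov hLC hGd hsym hF hNd hNd (EuclideanSpace.single j 1)
    rw [hE', hFp, hNp, metricLoc_symm g _ _ _ N] at h1
    linarith
  -- the second fundamental form is a multiple of `ν`, which is orthogonal to its derivative
  have hA : secondLoc h g φ p i l y₀ = (g.inner (φ p) (ν p) (ν p)
      * metricLoc g (φ p) z₀ (secondLoc h g φ p i l y₀) N) • N := by
    have h1 := hν.eq_sum_tangentLoc hφ hn p (secondLoc h g φ p i l y₀)
    have h2 : ∀ s, metricLoc g (φ p) z₀ (secondLoc h g φ p i l y₀) (tangentLoc m n φ p s) = 0 := by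
      intro s
      rw [← hFp]
      exact secondLoc_normal hφ p i l _
    simpa only [← hz₀, h2, mul_zero, zero_smul, Finset.sum_const_zero, zero_add] using h1
  have hC' := fderiv_inner_cov hLC hGd hsym hF hAd hNd (EuclideanSpace.single j 1)
  rw [hFp, hNp, hA, map_smul, smul_apply, hcov, smul_zero, add_zero] at hC'
  unfold shapeLoc
  rw [fderiv_fun_mul hE hC, add_apply, smul_apply, smul_apply, hE', smul_zero, add_zero, hC', hFp,
    hNp, hεval]
  rfl

/-- The Newton tensors of a hypersurface are divergence free in a space of constant curvature, and
the one of order one already in an Einstein manifold. -/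
theorem IsUnitNormal.isCodazziForm_shapeForm (hν : IsUnitNormal m g φ ν)
    (hφ : IsIsometricImmersion h g φ) (hn : n = m + 1) (k : ℕ)
    (hg : HasConstantCurvature g ∨ k = 0 ∨ k = 1 ∧ IsEinstein g) :
    IsCodazziForm h g φ (shapeForm g φ ν k) := by
  refine ⟨fun p I L ↦ ?_, fun p l ↦ ?_⟩
  · exact (contDiffAt_prod fun a _ ↦ hν.contDiffAt_shapeLoc hφ p _ _).congr_of_eventuallyEq
      (eventually_localTensor_shapeForm hφ k p I L)
  have hN : ∀ w, metricLoc g (φ p) (extChartAt (𝓡 n) (φ p) (φ p)) (coords (φ p) (φ p) (ν p))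
      (fderiv ℝ (localMap m n φ p (φ p)) (extChartAt (𝓡 m) p p) w) = 0 := by
    intro w
    have h1 := coords_mfderiv (hφ.contMDiff p) (mem_chart_source _ p) (mem_chart_source _ (φ p))
      (ofCoords p p w)
    rw [coords_ofCoords (mem_chart_source _ p)] at h1
    rw [← h1, metricLoc_coords g (mem_chart_source _ _), hν.normal]
  set D : Fin m → Fin m → Fin m → ℝ := fun j i l ↦ fderiv ℝ (shapeLoc h g φ ν p i l)
    (extChartAt (𝓡 m) p p) (EuclideanSpace.single j 1) with hD
  have hd : ∀ j I L, fderiv ℝ (localTensor h g φ (shapeForm g φ ν k) p I L)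
      (extChartAt (𝓡 m) p p) (EuclideanSpace.single j 1)
      = ∑ a, (∏ b ∈ Finset.univ.erase a,
        shapeLoc h g φ ν p (I b) (L b) (extChartAt (𝓡 m) p p)) * D j (I a) (L a) := by
    intro j I L
    rw [(eventually_localTensor_shapeForm hφ k p I L).fderiv_eq, (HasFDerivAt.finsetProd fun a _ ↦
      ((hν.contDiffAt_shapeLoc hφ p (I a) (L a)).differentiableAt (by simp)).hasFDerivAt).fderiv,
      sum_apply]
    rfl
  simp_rw [hd]
  rcases hg with hg | rfl | ⟨rfl, hg⟩
  · -- the derivative index can be exchanged with a lower index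
    have hDs : ∀ j i l, D j i l = D i j l := fun j i l ↦ by
      simp only [hD]
      rw [hν.fderiv_shapeLoc hφ hn, hν.fderiv_shapeLoc hφ hn, inner_covSecond_comm hφ hg p _ _ _ hN]
    simp_rw [Finset.mul_sum]
    rw [Finset.sum_congr rfl fun i _ ↦ (Finset.sum_congr rfl fun I _ ↦
      Finset.sum_comm).trans Finset.sum_comm, Finset.sum_comm]
    refine Finset.sum_eq_zero fun a _ ↦ sum_det_cons_eq_zero _ l (fun i I L ↦
      (∏ b ∈ Finset.univ.erase a, shapeLoc h g φ ν p (I b) (L b) (extChartAt (𝓡 m) p p))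
        * D i (I a) (L a)) a fun i I L ↦ ?_
    rw [Function.update_self, hDs]
    congr 1
    refine Finset.prod_congr rfl fun b hb ↦ ?_
    rw [Function.update_of_ne (Finset.mem_erase.1 hb).1]
  · simp
  · -- the defect of symmetry is a contraction of the curvature tensor
    set Q := inverseMetric h p with hQ
    set R : Fin m → Fin m → Fin m → ℝ := fun i j s ↦
      metricLoc g (φ p) (extChartAt (𝓡 n) (φ p) (φ p))
        (curv (connLoc g (φ p)) (extChartAt (𝓡 n) (φ p) (φ p)) (tangentLoc m n φ p i)
        (tangentLoc m n φ p j) (tangentLoc m n φ p s)) (coords (φ p) (φ p) (ν p)) with hR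
    have hDs : ∀ j i l, D j i l - D i j l = g.inner (φ p) (ν p) (ν p) * R i j l := fun j i l ↦ by
      simp only [hD]
      rw [hν.fderiv_shapeLoc hφ hn, hν.fderiv_shapeLoc hφ hn, ← mul_sub,
        inner_covSecond_sub hφ p _ _ _ hN]
      congr 1
      exact ((isCurvatureTensor_curv g (φ p)).skew _ _ _ _).symm
    have hRs : ∀ j, ∑ i, ∑ s, Q i s * R i j s = 0 := hν.sum_inverseMetric_curv hφ hn hg p
    have h1 : ∀ G : Fin m → Fin m → Fin m → ℝ, ∑ i, ∑ I : Fin 1 → Fin m, ∑ L : Fin 1 → Fin m,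
        G i (I 0) (L 0) = ∑ i, ∑ j, ∑ s, G i j s := by
      intro G
      refine Finset.sum_congr rfl fun i _ ↦ ?_
      rw [← (Equiv.funUnique (Fin 1) (Fin m)).symm.sum_comp]
      refine Finset.sum_congr rfl fun j _ ↦ ?_
      rw [← (Equiv.funUnique (Fin 1) (Fin m)).symm.sum_comp]
      rfl
    have h2 := h1 fun i j s ↦ (Q i l * Q j s - Q i s * Q j l) * D i j s
    have h3 : ∀ (i : Fin m) (I L : Fin 1 → Fin m),
        (Q.submatrix (Fin.cons i I : Fin 2 → Fin m) (Fin.cons l L)).det * ∑ a,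
          (∏ b ∈ Finset.univ.erase a, shapeLoc h g φ ν p (I b) (L b) (extChartAt (𝓡 m) p p))
            * D i (I a) (L a)
        = (Q i l * Q (I 0) (L 0) - Q i (L 0) * Q (I 0) l) * D i (I 0) (L 0) := by
      intro i I L
      have e : ∀ (x : Fin m) (f : Fin 1 → Fin m), (Fin.cons x f : Fin 2 → Fin m) 1 = f 0 :=
        fun _ _ ↦ rfl
      rw [Matrix.det_fin_two]
      simp [e]
    simp_rw [h3]
    rw [h2]
    have h4 : ∑ i, ∑ j, ∑ s, Q i s * Q j l * D i j s = ∑ i, ∑ j, ∑ s, Q i l * Q j s * D j i s := by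
      rw [Finset.sum_comm]
      exact Finset.sum_congr rfl fun i _ ↦ Finset.sum_congr rfl fun j _ ↦
        Finset.sum_congr rfl fun s _ ↦ by ring
    simp_rw [sub_mul, Finset.sum_sub_distrib]
    rw [h4]
    simp_rw [← Finset.sum_sub_distrib, ← mul_sub, hDs]
    have h5 : ∀ i, ∑ j, ∑ s, Q i l * Q j s * (g.inner (φ p) (ν p) (ν p) * R j i s)
        = (Q i l * g.inner (φ p) (ν p) (ν p)) * ∑ j, ∑ s, Q j s * R j i s := by
      intro i
      simp_rw [Finset.mul_sum]
      exact Finset.sum_congr rfl fun j _ ↦ Finset.sum_congr rfl fun s _ ↦ by ring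
    simp_rw [h5, hRs, mul_zero, Finset.sum_const_zero]

end Hypersurface

/-! ### The integral formulas -/

section Formulas

variable {m n : ℕ}
  {S : Type*} [TopologicalSpace S] [ChartedSpace (Coord m) S] [IsManifold (𝓡 m) ∞ S]
  {M : Type*} [TopologicalSpace M] [ChartedSpace (Coord n) M] [IsManifold (𝓡 n) ∞ M]
  {h : SemiRiemannianMetric m S} {g : SemiRiemannianMetric n M} {φ : S → M}

/-- The Kronecker symbol is unchanged when both index lists are rotated. -/
lemma kronecker_snoc {k : ℕ} (i j : Fin m) (I J : Fin k → Fin m) :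
    kronecker (Fin.snoc (α := fun _ ↦ Fin m) I i) (Fin.snoc (α := fun _ ↦ Fin m) J j)
      = kronecker (Fin.cons i I : Fin (k + 1) → Fin m) (Fin.cons j J) := by
  rw [Fin.snoc_eq_cons_rotate, Fin.snoc_eq_cons_rotate, kronecker_eq_det, kronecker_eq_det]
  exact Matrix.det_submatrix_equiv_self (finRotate (k + 1))
    ((1 : Matrix (Fin m) (Fin m) ℝ).submatrix (Fin.cons i I) (Fin.cons j J))

/-- Separation of one pair of indices, where `s i I` inserts the index `i` in the list `I`. -/
lemma sum_sum_insert {k : ℕ} {s : Fin m → (Fin k → Fin m) → Fin (k + 1) → Fin m}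
    (hs : ∀ F : (Fin (k + 1) → Fin m) → ℝ, ∑ I, F I = ∑ i, ∑ I, F (s i I))
    {F : (Fin (k + 1) → Fin m) → (Fin (k + 1) → Fin m) → ℝ} {c : Fin m → Fin m → ℝ}
    {Ψ : Fin m → Fin m → (Fin k → Fin m) → (Fin k → Fin m) → ℝ}
    (hF : ∀ i j I J, F (s i I) (s j J) = c i j * Ψ i j I J) :
    ∑ I, ∑ J, F I J = ∑ i, ∑ j, c i j * ∑ I, ∑ J, Ψ i j I J := by
  rw [hs]
  refine Finset.sum_congr rfl fun i _ ↦ ?_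
  simp_rw [hs, hF, Finset.mul_sum]
  exact Finset.sum_comm

lemma coords_gradient (h : SemiRiemannianMetric m S) (f : S → ℝ) (x : S) (j : Fin m) :
    coords x x (gradient h f x) j
      = ∑ l, inverseMetric h x j l * mvfderiv (𝓡 m) f x (frame x l) := by
  rw [gradient, sharp]
  simp_rw [coords_sum, coords_smul, coords_frame, ← Finset.sum_smul]
  exact sum_smul_single_apply _ _

/-- The Newton transformation built from the form `μ`, applied to a gradient and paired with the
tangential part of `X`, is a contraction with `df ⊗ X`. -/
lemma inner_newton_gradient (hφ : IsIsometricImmersion h g φ) {k : ℕ} (x : S)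
    (μ : MultilinearMap ℝ (fun _ : Fin k ↦ TangentSpace (𝓡 n) (φ x)) ℝ) (f : S → ℝ)
    (w : TangentSpace (𝓡 n) (φ x)) :
    h.inner x (∑ i, ∑ j, ((1 / (k.factorial : ℝ)) *
        (∑ I : Fin k → Fin m, ∑ J : Fin k → Fin m,
          kronecker (Fin.cons i I : Fin (k + 1) → Fin m) (Fin.cons j J)
            * μ fun a ↦ mixedA h g φ x (I a) (J a)) * coords x x (gradient h f x) j) • frame x i)
        (tangentialPart h g φ x w)
      = (1 / (k.factorial : ℝ)) * frameContract h g φ x μ (fun u v ↦ mvfderiv (𝓡 m) f x u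
        * g.inner (φ x) w (mfderiv (𝓡 m) (𝓡 n) φ x v)) (frame x) := by
  rw [← frameContract_flip hφ, ← sum_kronecker_cons_mixedA h g φ x μ _
    (C' := fun i j ↦ coords x x (gradient h f x) j
      * g.inner (φ x) w (mfderiv (𝓡 m) (𝓡 n) φ x (frame x i)))
    (fun i j ↦ by
      rw [coords_gradient, Finset.sum_mul]
      exact Finset.sum_congr rfl fun l _ ↦ mul_assoc _ _ _)]
  simp_rw [inner_sum_left, inner_smul_left, h.symm x (frame x _), inner_tangentialPart]
  rw [Finset.mul_sum]
  refine Finset.sum_congr rfl fun i _ ↦ ?_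
  rw [Finset.mul_sum]
  exact Finset.sum_congr rfl fun j _ ↦ by ring

lemma inner_mixedA (h : SemiRiemannianMetric m S) (g : SemiRiemannianMetric n M) (φ : S → M)
    (x : S) (w : TangentSpace (𝓡 n) (φ x)) (i j : Fin m) :
    g.inner (φ x) w (mixedA h g φ x i j) = ∑ l, inverseMetric h x j l
      * g.inner (φ x) w (secondFundamentalForm h g φ x (frame x i) (frame x l)) := by
  rw [mixedA, inner_sum_right]
  simp_rw [inner_smul_right]

lemma factorial_mul_choose_succ {m k : ℕ} (hk : k < m) :
    (((k + 1).factorial : ℕ) : ℝ) * (m.choose (k + 1) : ℝ)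
      = (k.factorial : ℝ) * (((m : ℝ) - k) * (m.choose k : ℝ)) := by
  have h1 : (m.choose (k + 1) : ℝ) * ((k : ℝ) + 1) = (m.choose k : ℝ) * ((m : ℝ) - k) := by
    rw [← Nat.cast_sub hk.le]
    exact_mod_cast Nat.choose_succ_right_eq m k
  rw [Nat.factorial_succ]
  push_cast
  linear_combination (k.factorial : ℝ) * h1

/-- Division of an integral identity by the combinatorial constants. -/
lemma integral_formula_of_mul {Ω : Type*} [MeasurableSpace Ω] {P : Measure Ω}
    {a b c a' b' c' : Ω → ℝ} {F q : ℝ} (hF : F ≠ 0) (hq : q ≠ 0)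
    (ha : ∀ x, a' x = F * q * a x) (hb : ∀ x, b' x = F * q * b x) (hc : ∀ x, c' x = F * c x)
    (H : Integrable a' P ∧ Integrable b' P ∧ Integrable c' P ∧
      ∫ x, a' x ∂P = ∫ x, b' x ∂P - ∫ x, c' x ∂P) :
    Integrable a P ∧ Integrable b P ∧ Integrable c P ∧
      ∫ x, a x ∂P = ∫ x, b x ∂P - 1 / q * ∫ x, c x ∂P := by
  obtain rfl : a' = fun x ↦ F * q * a x := funext ha
  obtain rfl : b' = fun x ↦ F * q * b x := funext hb
  obtain rfl : c' = fun x ↦ F * c x := funext hc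
  have hFq := mul_ne_zero hF hq
  obtain ⟨h1, h2, h3, h4⟩ := H
  refine ⟨(integrable_const_mul_iff (isUnit_iff_ne_zero.2 hFq) _).1 h1,
    (integrable_const_mul_iff (isUnit_iff_ne_zero.2 hFq) _).1 h2,
    (integrable_const_mul_iff (isUnit_iff_ne_zero.2 hF) _).1 h3, ?_⟩
  rw [integral_const_mul, integral_const_mul, integral_const_mul] at h4
  field_simp
  refine mul_left_cancel₀ hF ?_
  linear_combination h4

variable [T2Space S] [CompactSpace S] [MeasurableSpace S] [BorelSpace S]
  {X : ∀ x : S, TangentSpace (𝓡 n) (φ x)} {α f : S → ℝ}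

/-- The integral formula in arbitrary codimension, from the Codazzi form `pairForm`. -/
theorem evenFormula (hφ : IsIsometricImmersion h g φ) (hX : IsSmoothAlong m φ X)
    (hα : IsConformalAlong h g φ X α) (hf : ContMDiff (𝓡 m) 𝓘(ℝ, ℝ) ∞ f) {r : ℕ}
    (hr : 2 * r < m) (hg : HasConstantCurvature g ∨ r = 0) : EvenFormula h g φ X α f r := by
  have H := integral_frameContract hφ (isCodazziForm_pairForm hφ r hg) hf (fun x ↦ hX x) hα
    (by omega)
  have hfac : ((2 * r).factorial : ℝ) ≠ 0 := by positivity
  have hch : (m.choose (2 * r) : ℝ) ≠ 0 := by exact_mod_cast (Nat.choose_pos hr.le).ne'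
  have hch' : (m.choose (2 * r + 1) : ℝ) ≠ 0 := by exact_mod_cast (Nat.choose_pos hr).ne'
  have hfac' : ((2 * r + 1).factorial : ℝ) ≠ 0 := by positivity
  have hmr : (m : ℝ) - 2 * r ≠ 0 := by
    have : (2 * r : ℝ) < m := by exact_mod_cast hr
    linarith
  have hconst := factorial_mul_choose_succ hr
  refine integral_formula_of_mul hfac (mul_ne_zero hmr hch) (fun x ↦ ?_) (fun x ↦ ?_)
    (fun x ↦ ?_) H
  · rw [frameContract_metric]
    have h1 : evenH h g φ r x = (1 / ((2 * r).factorial : ℝ)) *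
      ∑ I : Fin (2 * r) → Fin m, ∑ J : Fin (2 * r) → Fin m,
        kronecker I J * pairForm (innerL g (φ x)) r (fun a ↦ mixedA h g φ x (I a) (J a)) := rfl
    rw [evenSigma, h1]
    push_cast
    field_simp
  · rw [← sum_kronecker_cons_mixedA h g φ x _ _ (fun i j ↦ inner_mixedA h g φ x (X x) i j)]
    have h1 : g.inner (φ x) (oddH h g φ r x) (X x) = (1 / ((2 * r + 1).factorial : ℝ)) *
        ∑ i, ∑ j, g.inner (φ x) (X x) (mixedA h g φ x i j) *
          ∑ I : Fin (2 * r) → Fin m, ∑ J : Fin (2 * r) → Fin m,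
            kronecker (Fin.cons i I : Fin (2 * r + 1) → Fin m) (Fin.cons j J)
              * pairForm (innerL g (φ x)) r (fun a ↦ mixedA h g φ x (I a) (J a)) := by
      rw [oddH, inner_smul_left]
      simp_rw [inner_sum_left, inner_smul_left]
      congr 1
      refine sum_sum_insert (fun F ↦ sum_fin_snoc F) fun i j I J ↦ ?_
      rw [kronecker_snoc, Fin.snoc_last, Fin.snoc_last, g.symm (φ x) (X x)]
      have e : pairProduct h g φ x r (Nat.le_succ (2 * r)) (Fin.snoc (α := fun _ ↦ Fin m) I i)
          (Fin.snoc (α := fun _ ↦ Fin m) J j)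
          = pairForm (innerL g (φ x)) r (fun a ↦ mixedA h g φ x (I a) (J a)) := by
        refine Finset.prod_congr rfl fun a _ ↦ ?_
        have e1 : ∀ (K : Fin (2 * r) → Fin m) (l : Fin m) (b : Fin (2 * r)),
            Fin.snoc (α := fun _ ↦ Fin m) K l ⟨b.val, by omega⟩ = K b := fun K l b ↦
          Fin.snoc_castSucc (α := fun _ ↦ Fin m) l K b
        have e2 := fun K l ↦ e1 K l ⟨2 * a.val, by omega⟩
        have e3 := fun K l ↦ e1 K l ⟨2 * a.val + 1, by omega⟩
        simp only at e2 e3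
        rw [e2, e2, e3, e3]
        rfl
      rw [e]
      ring
    rw [oddSigma, inner_smul_left, h1]
    push_cast at hconst
    rw [← hconst]
    field_simp
  · have h1 := inner_newton_gradient hφ x (pairForm (innerL g (φ x)) r) f (X x)
    have h2 : h.inner x (evenNewton h g φ r x (gradient h f x))
        (tangentialPart h g φ x (X x)) = _ := h1
    rw [h2]
    field_simp

/-- The defining property `A = B ν` of the shape operator. -/
lemma IsUnitNormal.mixedA_eq {ν : ∀ x : S, TangentSpace (𝓡 n) (φ x)} (hν : IsUnitNormal m g φ ν)
    (hφ : IsIsometricImmersion h g φ) (hn : n = m + 1) (x : S) (i j : Fin m) :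
    mixedA h g φ x i j = shapeOperator h g φ ν x i j • ν x := by
  rw [shapeOperator, mixedA, inner_sum_left, Finset.mul_sum, Finset.sum_smul]
  refine Finset.sum_congr rfl fun l _ ↦ ?_
  conv_lhs => rw [hν.secondFundamentalForm_eq hφ hn]
  rw [smul_smul, inner_smul_left]
  congr 1
  ring

/-- The integral formula for hypersurfaces, from the Codazzi form `shapeForm`. -/
theorem hypersurfaceFormula {ν : ∀ x : S, TangentSpace (𝓡 n) (φ x)} (hν : IsUnitNormal m g φ ν)
    (hφ : IsIsometricImmersion h g φ) (hn : n = m + 1) (hX : IsSmoothAlong m φ X)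
    (hα : IsConformalAlong h g φ X α) (hf : ContMDiff (𝓡 m) 𝓘(ℝ, ℝ) ∞ f) {k : ℕ} (hk : k < m)
    (hg : HasConstantCurvature g ∨ k = 0 ∨ k = 1 ∧ IsEinstein g) :
    HypersurfaceFormula h g φ ν X α f k := by
  have H := integral_frameContract hφ (hν.isCodazziForm_shapeForm hφ hn k hg) hf (fun x ↦ hX x) hα
    (by omega)
  have hfac : (k.factorial : ℝ) ≠ 0 := by positivity
  have hch : (m.choose k : ℝ) ≠ 0 := by exact_mod_cast (Nat.choose_pos hk.le).ne'
  have hch' : (m.choose (k + 1) : ℝ) ≠ 0 := by exact_mod_cast (Nat.choose_pos hk).ne'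
  have hfac' : ((k + 1).factorial : ℝ) ≠ 0 := by positivity
  have hmk : (m : ℝ) - k ≠ 0 := by
    have : (k : ℝ) < m := by exact_mod_cast hk
    linarith
  have hconst := factorial_mul_choose_succ hk
  refine integral_formula_of_mul hfac (mul_ne_zero hmk hch) (fun x ↦ ?_) (fun x ↦ ?_)
    (fun x ↦ ?_) H
  · rw [frameContract_metric]
    simp_rw [shapeForm_apply]
    have h1 : hyperH h g φ ν k x = (1 / (k.factorial : ℝ)) *
      ∑ I : Fin k → Fin m, ∑ J : Fin k → Fin m, kronecker I J
        * ∏ a, g.inner (φ x) (ν x) (ν x) * g.inner (φ x) (mixedA h g φ x (I a) (J a)) (ν x) := rfl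
    rw [hyperSigma, h1]
    field_simp
  · rw [← sum_kronecker_cons_mixedA h g φ x _ _ (fun i j ↦ inner_mixedA h g φ x (X x) i j)]
    have h1 : hyperH h g φ ν (k + 1) x * g.inner (φ x) (ν x) (X x)
        = (1 / ((k + 1).factorial : ℝ)) *
        ∑ i, ∑ j, g.inner (φ x) (X x) (mixedA h g φ x i j) *
          ∑ I : Fin k → Fin m, ∑ J : Fin k → Fin m,
            kronecker (Fin.cons i I : Fin (k + 1) → Fin m) (Fin.cons j J)
              * shapeForm g φ ν k x (fun a ↦ mixedA h g φ x (I a) (J a)) := by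
      rw [hyperH, mul_assoc, Finset.sum_mul]
      simp_rw [Finset.sum_mul]
      congr 1
      refine sum_sum_insert (fun F ↦ sum_fin_cons F) fun i j I J ↦ ?_
      have e : shapeForm g φ ν k x (fun a ↦ mixedA h g φ x (I a) (J a))
          = ∏ a, shapeOperator h g φ ν x (I a) (J a) := rfl
      rw [e, hν.mixedA_eq hφ hn, inner_smul_right, g.symm (φ x) (X x), Fin.prod_univ_succ]
      simp only [Fin.cons_zero, Fin.cons_succ]
      ring
    have h2 : hyperSigma h g φ ν (k + 1) x * g.inner (φ x) (ν x) (X x)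
        = hyperH h g φ ν (k + 1) x * g.inner (φ x) (ν x) (X x) / (m.choose (k + 1) : ℝ) := by
      rw [hyperSigma]
      ring
    rw [← hconst, mul_assoc (f x), h2, h1]
    field_simp
  · have h1 := inner_newton_gradient hφ x (shapeForm g φ ν k x) f (X x)
    have h2 : h.inner x (hyperNewton h g φ ν k x (gradient h f x))
        (tangentialPart h g φ x (X x)) = _ := h1
    rw [h2]
    field_simp

end Formulas

end HsiungMinkowski

end

open HsiungMinkowski in
theorem theorem3p2 {m n : ℕ}
    {S : Type*} [TopologicalSpace S] [T2Space S] [CompactSpace S]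
    [ChartedSpace (Coord m) S] [IsManifold (𝓡 m) ∞ S] [MeasurableSpace S] [BorelSpace S]
    {M : Type*} [TopologicalSpace M] [ChartedSpace (Coord n) M] [IsManifold (𝓡 n) ∞ M]
    (h : SemiRiemannianMetric m S) (g : SemiRiemannianMetric n M)
    (φ : S → M) (hφ : IsIsometricImmersion h g φ)
    (X : ∀ x : S, TangentSpace (𝓡 n) (φ x)) (hX : IsSmoothAlong m φ X)
    (α : S → ℝ) (hα : IsConformalAlong h g φ X α)
    (f : S → ℝ) (hf : ContMDiff (𝓡 m) 𝓘(ℝ, ℝ) ∞ f) :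
    -- arbitrary codimension, `k = 2r` even, `0 ≤ k ≤ m - 1`
    (HasConstantCurvature g → ∀ r : ℕ, 2 * r < m → EvenFormula h g φ X α f r) ∧
    (0 < m → EvenFormula h g φ X α f 0) ∧
    -- hypersurfaces, `0 ≤ k ≤ m - 1`
    (n = m + 1 → ∀ ν : (∀ x : S, TangentSpace (𝓡 n) (φ x)), IsUnitNormal m g φ ν →
      (HasConstantCurvature g → ∀ k : ℕ, k < m → HypersurfaceFormula h g φ ν X α f k) ∧
      (IsEinstein g → 1 < m → HypersurfaceFormula h g φ ν X α f 1) ∧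
      (0 < m → HypersurfaceFormula h g φ ν X α f 0)) := by
  refine ⟨fun hg r hr ↦ evenFormula hφ hX hα hf hr (Or.inl hg),
    fun hm ↦ evenFormula hφ hX hα hf (by omega) (Or.inr rfl), fun hn ν hν ↦ ⟨fun hg k hk ↦ ?_,
    fun hg hm ↦ ?_, fun hm ↦ ?_⟩⟩
  · exact hypersurfaceFormula hν hφ hn hX hα hf hk (Or.inl hg)
  · exact hypersurfaceFormula hν hφ hn hX hα hf hm (Or.inr (Or.inr ⟨rfl, hg⟩))
  · exact hypersurfaceFormula hν hφ hn hX hα hf hm (Or.inr (Or.inl rfl))
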